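/- Let $\beta>\frac{\pi}{2}$ and let $$D'_\beta=\Big\{(z_1,z_2)\in\mathbb{C}^2 : z_2\neq 0,\ \big|\operatorname{Im} z_1-\log|z_2|^2\big|<\tfrac{\pi}{2},\ \big|\log|z_2|^2\big|<\beta-\tfrac{\pi}{2}\Big\}$$ be the non-smooth worm domain. Let $P_{D'_\beta}$ be its Bergman projection, i.e. the orthogonal projection of $L^2(D'_\beta)$ (with respect to Lebesgue measure on $\mathbb{C}^2=\mathbb{R}^4$) onto the subspace of square-integrable holomorphic functions. Let $k$ be a positive integer and let $p\in(1,\infty)$. Let $W^{k,p}(D'_\beta)$ be the Sobolev space of all complex-valued $f\in L^p(D'_\beta)$ whose weak partial derivatives $\partial^\alpha f$ in the four real coordinates, $\alpha\in\mathbb{N}^4$, $|\alpha|\le k$, exist and lie in $L^p(D'_\beta)$, normed by $\|f\|_{k,p}=\big(\sum_{|\alpha|\le k}\|\partial^\alpha f\|_{L^p}^p\big)^{1/p}$. Then $P_{D'_\beta}$ extends to a bounded linear operator from $W^{k,p}(D'_\beta)$ to itself: there is a bounded linear operator $T:W^{k,p}(D'_\beta)\to W^{k,p}(D'_\beta)$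 such that $Tf=P_{D'_\beta}f$ almost everywhere for every $f\in W^{k,p}(D'_\beta)\cap L^2(D'_\beta)$. -/

import Mathlib

open MeasureTheory Set
open scoped ENNReal ContDiff

noncomputable section

namespace Worm

/-- The non-smooth worm domain
`{(z₁, z₂) ∈ ℂ² : |Im z₁ - log |z₂|²| < π/2, |log |z₂|²| < β - π/2}`.
The condition `z₂ ≠ 0`, implicit in the use of `log |z₂|²`, is needed because `Real.log 0 = 0`. -/
def wormDomain (β : ℝ) : Set (ℂ × ℂ) :=
  {z | z.2 ≠ 0 ∧ |z.1.im - Real.log (‖z.2‖ ^ 2)| < Real.pi / 2 ∧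
    |Real.log (‖z.2‖ ^ 2)| < β - Real.pi / 2}

/-- Lebesgue measure of `ℂ² = ℝ⁴` restricted to `D`. -/
abbrev vol (D : Set (ℂ × ℂ)) : Measure (ℂ × ℂ) := volume.restrict D

/-! ### The Bergman space and the Bergman projection -/

/-- The Bergman space `A²(D)`: the classes in `L²(D)` that have a representative which is
holomorphic on `D`. -/
def bergmanSpace (D : Set (ℂ × ℂ)) : Submodule ℂ (Lp ℂ 2 (vol D)) where
  carrier := {f | ∃ F : ℂ × ℂ → ℂ, DifferentiableOn ℂ F D ∧ f =ᵐ[vol D] F}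
  zero_mem' := ⟨0, differentiableOn_const 0, Lp.coeFn_zero ℂ 2 (vol D)⟩
  add_mem' := by
    rintro f g ⟨F, hF, hfF⟩ ⟨G, hG, hgG⟩
    exact ⟨F + G, hF.add hG, (Lp.coeFn_add f g).trans (hfF.add hgG)⟩
  smul_mem' := by
    rintro c f ⟨F, hF, hfF⟩
    exact ⟨c • F, hF.const_smul c, (Lp.coeFn_smul c f).trans (hfF.const_smul c)⟩

/-- `g` is the Bergman projection of `f`, i.e. the orthogonal projection of `f ∈ L²(D)` to the
Bergman space: `g ∈ A²(D)` and `f - g ⊥ A²(D)`. (Such a `g` is unique.) -/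
def IsBergmanProjection (D : Set (ℂ × ℂ)) (f g : Lp ℂ 2 (vol D)) : Prop :=
  g ∈ bergmanSpace D ∧ f - g ∈ (bergmanSpace D)ᗮ

/-! ### Weak derivatives and Sobolev spaces -/

/-- The four real coordinate directions `x₁, y₁, x₂, y₂` of `ℂ² = ℝ⁴`, where `z_j = x_j + i y_j`. -/
def coordDir : Fin 4 → ℂ × ℂ :=
  ![(1, 0), (Complex.I, 0), (0, 1), (0, Complex.I)]

/-- The classical partial derivative in the `i`-th real coordinate direction. -/
def partialDeriv (i : Fin 4) (φ : ℂ × ℂ → ℝ) : ℂ × ℂ → ℝ :=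
  fun z => fderiv ℝ φ z (coordDir i)

/-- The classical partial derivative `∂^α φ` for a multi-index `α ∈ ℕ⁴`. -/
def multiDeriv (α : Fin 4 → ℕ) (φ : ℂ × ℂ → ℝ) : ℂ × ℂ → ℝ :=
  (partialDeriv 0)^[α 0] ((partialDeriv 1)^[α 1] ((partialDeriv 2)^[α 2]
    ((partialDeriv 3)^[α 3] φ)))

/-- Test functions: smooth functions with compact support contained in `D`. -/
def IsTestFunction (D : Set (ℂ × ℂ)) (φ : ℂ × ℂ → ℝ) : Prop :=
  ContDiff ℝ ∞ φ ∧ HasCompactSupport φ ∧ tsupport φ ⊆ D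

/-- `g` is the weak derivative `∂^α f` on `D`:
`∫_D (∂^α φ) f = (-1)^|α| ∫_D φ g` for all test functions `φ`. -/
def HasWeakDeriv (D : Set (ℂ × ℂ)) (α : Fin 4 → ℕ) (f g : ℂ × ℂ → ℂ) : Prop :=
  ∀ φ : ℂ × ℂ → ℝ, IsTestFunction D φ →
    ∫ z in D, (multiDeriv α φ z : ℂ) * f z = (-1) ^ (∑ i, α i) * ∫ z in D, (φ z : ℂ) * g z

/-- The multi-indices `α ∈ ℕ⁴` with `|α| ≤ k` (each of their entries is at most `k`). -/
abbrev MultiIndex (k : ℕ) : Type := {α : Fin 4 → Fin (k + 1) // ∑ i, (α i : ℕ) ≤ k}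

/-- The entries of a multi-index, as natural numbers. -/
def MultiIndex.toNat {k : ℕ} (α : MultiIndex k) : Fin 4 → ℕ := fun i => (α.1 i : ℕ)

/-- The multi-index `0`. -/
def MultiIndex.zero (k : ℕ) : MultiIndex k := ⟨fun _ => 0, by simp⟩

lemma partialDeriv_iterate_good (i : Fin 4) (n : ℕ) {φ : ℂ × ℂ → ℝ}
    (h : ContDiff ℝ ∞ φ ∧ HasCompactSupport φ) :
    ContDiff ℝ ∞ ((partialDeriv i)^[n] φ) ∧ HasCompactSupport ((partialDeriv i)^[n] φ) := by
  induction n with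
  | zero => exact h
  | succ n ih =>
    rw [Function.iterate_succ_apply']
    exact ⟨(ih.1.fderiv_right (m := ∞) (by simp)).clm_apply contDiff_const,
      ih.2.fderiv_apply (𝕜 := ℝ) (coordDir i)⟩

lemma multiDeriv_good (α : Fin 4 → ℕ) {φ : ℂ × ℂ → ℝ}
    (h : ContDiff ℝ ∞ φ ∧ HasCompactSupport φ) :
    ContDiff ℝ ∞ (multiDeriv α φ) ∧ HasCompactSupport (multiDeriv α φ) :=
  partialDeriv_iterate_good 0 _ (partialDeriv_iterate_good 1 _
    (partialDeriv_iterate_good 2 _ (partialDeriv_iterate_good 3 _ h)))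

lemma integrable_test_mul {D : Set (ℂ × ℂ)} {p : ℝ≥0∞} [hp : Fact (1 ≤ p)]
    (f : Lp ℂ p (vol D)) {ψ : ℂ × ℂ → ℝ} (h : ContDiff ℝ ∞ ψ ∧ HasCompactSupport ψ) :
    Integrable (fun z => (ψ z : ℂ) * f z) (vol D) := by
  have := ((Lp.memLp f).locallyIntegrable hp.out).integrable_smul_left_of_hasCompactSupport
    h.1.continuous h.2
  simpa using this

/-- The Sobolev space `W^{k,p}(D)` of the `f ∈ L^p(D)` whose weak derivatives `∂^α f`, `|α| ≤ k`,
exist and lie in `L^p(D)`. An element is stored as the family `(∂^α f)_{|α| ≤ k}`, which `f`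
determines, inside the `ℓ^p`-sum of copies of `L^p(D)`; so the norm is
`‖f‖ = (∑_{|α| ≤ k} ‖∂^α f‖_p ^ p) ^ (1/p)`. -/
def sobolevSpace (D : Set (ℂ × ℂ)) (k : ℕ) (p : ℝ≥0∞) [Fact (1 ≤ p)] :
    Submodule ℂ (PiLp p (fun _ : MultiIndex k => Lp ℂ p (vol D))) where
  carrier := {u | ∀ α : MultiIndex k, HasWeakDeriv D α.toNat (u (MultiIndex.zero k)) (u α)}
  zero_mem' := by
    intro α φ _
    have h0 : ((0 : Lp ℂ p (vol D)) : ℂ × ℂ → ℂ) =ᵐ[vol D] 0 := Lp.coeFn_zero ℂ p (vol D)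
    have e : ∀ ψ : ℂ × ℂ → ℝ,
        ∫ z in D, (ψ z : ℂ) * (0 : Lp ℂ p (vol D)) z = 0 := fun ψ =>
      integral_eq_zero_of_ae (h0.mono fun z hz => by
        change (ψ z : ℂ) * ((0 : Lp ℂ p (vol D)) : ℂ × ℂ → ℂ) z = 0
        rw [hz, Pi.zero_apply, mul_zero])
    rw [PiLp.zero_apply, PiLp.zero_apply, e, e, mul_zero]
  add_mem' := by
    intro u v hu hv α φ hφ
    have e : ∀ (f g : Lp ℂ p (vol D)) (ψ : ℂ × ℂ → ℝ),
        ContDiff ℝ ∞ ψ ∧ HasCompactSupport ψ →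
        ∫ z in D, (ψ z : ℂ) * (f + g) z =
          (∫ z in D, (ψ z : ℂ) * f z) + ∫ z in D, (ψ z : ℂ) * g z := by
      intro f g ψ hψ
      rw [← integral_add (integrable_test_mul f hψ) (integrable_test_mul g hψ)]
      exact integral_congr_ae ((Lp.coeFn_add f g).mono fun z hz => by
        simp only [hz, Pi.add_apply, mul_add])
    have hφ' : ContDiff ℝ ∞ φ ∧ HasCompactSupport φ := ⟨hφ.1, hφ.2.1⟩
    rw [PiLp.add_apply, PiLp.add_apply, e _ _ _ (multiDeriv_good _ hφ'), e _ _ _ hφ',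
      hu α φ hφ, hv α φ hφ, mul_add]
  smul_mem' := by
    intro c u hu α φ hφ
    have e : ∀ (f : Lp ℂ p (vol D)) (ψ : ℂ × ℂ → ℝ),
        ∫ z in D, (ψ z : ℂ) * (c • f) z = c * ∫ z in D, (ψ z : ℂ) * f z := by
      intro f ψ
      rw [← integral_const_mul]
      exact integral_congr_ae ((Lp.coeFn_smul c f).mono fun z hz => by
        simp only [hz, Pi.smul_apply, smul_eq_mul]; ring)
    rw [PiLp.smul_apply, PiLp.smul_apply, e, e, hu α φ hφ]
    ring

/-- The function `f ∈ L^p(D)` underlying an element of `W^{k,p}(D)`. -/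
def sobolevSpace.toLp {D : Set (ℂ × ℂ)} {k : ℕ} {p : ℝ≥0∞} [Fact (1 ≤ p)]
    (u : sobolevSpace D k p) : Lp ℂ p (vol D) := u.1 (MultiIndex.zero k)

end Worm

end

/-! The worm domain is covered by a product of two horizontal strips through `coverMap`, (u, v) ↦ (u
+ v, exp(-iv/2)): there log|z₂|² = Im v and Im z₁ - log|z₂|² = Im u, so the two defining
inequalities decouple. The deck group is ℤ, acting by the real translations (u, v) ↦ (u - 4πn, v +
4πn). The complex Jacobian has squared modulus |z₂|²/4, so Lebesgue measure on the cover corresponds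
to 4|z₂|⁻² dV below (`coverVol`).

The Bergman kernel of a strip is explicit, a multiple of cosh(κ(z - w̄))⁻², and the kernel of the
cover is a product of two of these. Integrating the lift of a function against it gives a
deck-invariant function, which descends to `wormOp`. Lifts are periodic, so they cannot be treated
as L² functions on the cover; everything rests on absolute convergence instead. This comes from the
Schur test with powers of the distance to the boundary as weights. These weights depend only on
imaginary parts, hence are deck invariant, and the test gives L^p bounds on the worm domain for 1 <
p < ∞ (`exists_lintegral_coverMajorant_le`). A Harnack inequality for the kernel turns almost
everywhere finiteness into finiteness at every point and supplies the domination that makes `wormOp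
β F` holomorphic.

`wormOp` reproduces holomorphic functions (`wormOp_eq_self`, from the mean value property on the
disc carried to the strip) and is symmetric for `coverVol` (`integral_conj_mul_wormOp`), so it is
the orthogonal projection for the weight |z₂|⁻². Multiplication by z₂ intertwines the weighted and
unweighted norms up to a constant and preserves holomorphy. Hence the Bergman projection is f ↦ z₂⁻¹
· `wormOp`(z₂ f), which is `wormProj`.

For derivatives, translations in Re z₁ and rotations in z₂ preserve the domain and lift to real
translations of the cover, under which the kernel is invariant. So `wormOp` commutes with weak
derivatives along ∂/∂x₁ and x₂ ∂/∂y₂ - y₂ ∂/∂x₂ (`HasWeakFlowDeriv.fderiv_wormOp`). On the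
holomorphic image these two fields act as ∂/∂z₁ and i z₂ ∂/∂z₂. As z₂ stays away from 0 and ∞, they
determine all first derivatives of `wormOp β f` by applying `wormOp` to first derivatives of f,
without loss of order. Induction on k gives the Sobolev bound for `wormOp`
(`isSobolevBounded_wormOp`), and multiplication by z₂ and z₂⁻¹ transfers it to `wormProj`. The last
part identifies iterated first-order weak derivatives with the families indexed by multi-indices. -/

noncomputable section

namespace Worm

/-! ### The Bergman kernel of a horizontal strip -/

/-- The horizontal strip `|Im z| < a`. -/
def strip (a : ℝ) : Set ℂ := {z | |z.im| < a}

/-- The function `k` for which `k (z - conj w)` is the Bergman kernel of `strip a`. -/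
def stripKernel (a : ℝ) (z : ℂ) : ℂ :=
  ((Real.pi / (4 * a)) ^ 2 / Real.pi : ℝ) / Complex.cosh ((Real.pi / (4 * a) : ℝ) * z) ^ 2

lemma isOpen_strip (a : ℝ) : IsOpen (strip a) :=
  isOpen_lt (by fun_prop) continuous_const

lemma measurableSet_strip (a : ℝ) : MeasurableSet (strip a) := (isOpen_strip a).measurableSet

lemma norm_cosh_sq (z : ℂ) : ‖Complex.cosh z‖ ^ 2 = Real.sinh z.re ^ 2 + Real.cos z.im ^ 2 := by
  have h : Complex.cosh z = ⟨Real.cosh z.re * Real.cos z.im, Real.sinh z.re * Real.sin z.im⟩ := by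
    conv_lhs => rw [← Complex.re_add_im z, Complex.cosh_add, Complex.cosh_mul_I,
      Complex.sinh_mul_I]
    apply Complex.ext <;> simp [Complex.cos_ofReal_re, Complex.sin_ofReal_re,
      Complex.cosh_ofReal_re, Complex.sinh_ofReal_re, Complex.cos_ofReal_im, Complex.sin_ofReal_im,
      Complex.cosh_ofReal_im, Complex.sinh_ofReal_im]
  rw [← Complex.normSq_eq_norm_sq, h, Complex.normSq_mk]
  nlinarith [Real.cosh_sq z.re, Real.sin_sq_add_cos_sq z.im]

lemma norm_sinh_sq (z : ℂ) : ‖Complex.sinh z‖ ^ 2 = Real.sinh z.re ^ 2 + Real.sin z.im ^ 2 := by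
  have h : Complex.sinh z = ⟨Real.sinh z.re * Real.cos z.im, Real.cosh z.re * Real.sin z.im⟩ := by
    conv_lhs => rw [← Complex.re_add_im z, Complex.sinh_add, Complex.cosh_mul_I,
      Complex.sinh_mul_I]
    apply Complex.ext <;> simp [Complex.cos_ofReal_re, Complex.sin_ofReal_re,
      Complex.cosh_ofReal_re, Complex.sinh_ofReal_re, Complex.cos_ofReal_im, Complex.sin_ofReal_im,
      Complex.cosh_ofReal_im, Complex.sinh_ofReal_im]
  rw [← Complex.normSq_eq_norm_sq, h, Complex.normSq_mk]
  nlinarith [Real.cosh_sq z.re, Real.sin_sq_add_cos_sq z.im]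

/-- The argument of the cosine in the kernel stays away from ±π/2 by a multiple of the sum of the
two distances to the boundary. -/
lemma abs_mul_im_le {a : ℝ} {z w : ℂ} (hz : z ∈ strip a) :
    |Real.pi / (4 * a) * (z - (starRingEnd ℂ) w).im| ≤
      Real.pi / 2 - Real.pi / (4 * a) * (a - |z.im| + (a - |w.im|)) := by
  have hz' : |z.im| < a := hz
  have ha : 0 < a := (abs_nonneg _).trans_lt hz'
  have : |(z - (starRingEnd ℂ) w).im| ≤ |z.im| + |w.im| := by
    simpa using abs_add_le z.im w.im
  rw [abs_mul, abs_of_pos (by positivity)]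
  have h2 : Real.pi / 2 - Real.pi / (4 * a) * (a - |z.im| + (a - |w.im|)) =
      Real.pi / (4 * a) * (|z.im| + |w.im|) := by field_simp; ring
  rw [h2]
  gcongr

/-- Jordan's inequality sin x ≥ 2x/π, applied to the complementary angle. This is the quantitative
form of the nonvanishing of the denominator of the kernel. -/
lemma cos_ge_of_mem_strip {a : ℝ} {z w : ℂ} (hz : z ∈ strip a) (hw : w ∈ strip a) :
    (a - |z.im| + (a - |w.im|)) / (2 * a) ≤
      Real.cos (Real.pi / (4 * a) * (z - (starRingEnd ℂ) w).im) := by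
  have hz' : |z.im| < a := hz
  have hw' : |w.im| < a := hw
  have ha : 0 < a := (abs_nonneg _).trans_lt hz'
  have h := abs_mul_im_le (w := w) hz
  rw [← Real.cos_abs]
  set s := a - |z.im| + (a - |w.im|)
  have hs : 0 < s := by simp only [s]; linarith
  have hs' : s ≤ 2 * a := by simp only [s]; linarith [abs_nonneg z.im, abs_nonneg w.im]
  have hp := Real.pi_pos
  calc s / (2 * a) = 2 / Real.pi * (Real.pi / (4 * a) * s) := by field_simp; ring
    _ ≤ Real.sin (Real.pi / (4 * a) * s) := by
        apply Real.mul_le_sin (by positivity)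
        rw [div_mul_eq_mul_div, div_le_div_iff₀ (by positivity) (by positivity)]
        nlinarith
    _ = Real.cos (Real.pi / 2 - Real.pi / (4 * a) * s) := (Real.cos_pi_div_two_sub _).symm
    _ ≤ _ := by
        apply Real.cos_le_cos_of_nonneg_of_le_pi (abs_nonneg _) _ h
        have : 0 ≤ Real.pi / (4 * a) * s := by positivity
        linarith

lemma cosh_ne_zero_of_mem_strip {a : ℝ} {z w : ℂ} (hz : z ∈ strip a) (hw : w ∈ strip a) :
    Complex.cosh ((Real.pi / (4 * a) : ℝ) * (z - (starRingEnd ℂ) w)) ≠ 0 := by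
  have hz' : |z.im| < a := hz
  have hw' : |w.im| < a := hw
  have ha : 0 < a := (abs_nonneg _).trans_lt hz'
  have h := norm_cosh_sq ((Real.pi / (4 * a) : ℝ) * (z - (starRingEnd ℂ) w))
  rw [Complex.re_ofReal_mul, Complex.im_ofReal_mul] at h
  have h2 := cos_ge_of_mem_strip hz hw
  have h3 : 0 < (a - |z.im| + (a - |w.im|)) / (2 * a) := by
    apply div_pos <;> linarith
  intro h0
  rw [h0] at h
  have := pow_pos (h3.trans_le h2) 2
  nlinarith [sq_nonneg (Real.sinh (Real.pi / (4 * a) * (z - (starRingEnd ℂ) w).re)), norm_zero (E := ℂ)]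

lemma stripKernel_neg (a : ℝ) (z : ℂ) : stripKernel a (-z) = stripKernel a z := by
  simp [stripKernel, Complex.cosh_neg]

lemma stripKernel_conj (a : ℝ) (z : ℂ) :
    stripKernel a ((starRingEnd ℂ) z) = (starRingEnd ℂ) (stripKernel a z) := by
  simp only [stripKernel, map_div₀, map_pow, Complex.conj_ofReal, ← Complex.cosh_conj, map_mul]

/-- Hermitian symmetry of the Bergman kernel. -/
lemma stripKernel_swap (a : ℝ) (z w : ℂ) :
    stripKernel a (w - (starRingEnd ℂ) z) = (starRingEnd ℂ) (stripKernel a (z - (starRingEnd ℂ) w)) := by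
  rw [← stripKernel_conj, ← stripKernel_neg]
  congr 1; simp

lemma norm_stripKernel (a : ℝ) (ha : 0 < a) (z : ℂ) :
    ‖stripKernel a z‖ = (Real.pi / (4 * a)) ^ 2 / Real.pi /
      (Real.sinh (Real.pi / (4 * a) * z.re) ^ 2 + Real.cos (Real.pi / (4 * a) * z.im) ^ 2) := by
  rw [stripKernel, norm_div, norm_pow, norm_cosh_sq, Complex.re_ofReal_mul, Complex.im_ofReal_mul,
    Complex.norm_real, Real.norm_of_nonneg (by positivity)]

lemma differentiableAt_stripKernel {a : ℝ} {z w : ℂ} (hz : z ∈ strip a) (hw : w ∈ strip a) :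
    DifferentiableAt ℂ (fun z => stripKernel a (z - (starRingEnd ℂ) w)) z := by
  have h := cosh_ne_zero_of_mem_strip hz hw
  unfold stripKernel
  fun_prop (disch := exact pow_ne_zero 2 h)

lemma measurable_stripKernel (a : ℝ) : Measurable (stripKernel a) := by
  unfold stripKernel
  fun_prop

/-- Harnack inequality for the Bergman kernel of the strip. -/
lemma exists_stripKernel_comparable {a : ℝ} {z₀ : ℂ} (hz₀ : z₀ ∈ strip a) :
    ∃ r > 0, Metric.ball z₀ r ⊆ strip a ∧ ∀ z ∈ Metric.ball z₀ r, ∀ w ∈ strip a,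
      ‖stripKernel a (z - (starRingEnd ℂ) w)‖ ≤ 4 * ‖stripKernel a (z₀ - (starRingEnd ℂ) w)‖ ∧
      ‖stripKernel a (z₀ - (starRingEnd ℂ) w)‖ ≤ 4 * ‖stripKernel a (z - (starRingEnd ℂ) w)‖ := by
  have hz' : |z₀.im| < a := hz₀
  have ha : 0 < a := (abs_nonneg _).trans_lt hz'
  set κ : ℝ := Real.pi / (4 * a) with hκ
  have hκ0 : 0 < κ := by positivity
  -- A lower bound for the cosine at z₀ which is uniform in w ∈ `strip a`.
  set c : ℝ := (a - |z₀.im|) / (2 * a) with hc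
  have hc0 : 0 < c := by apply div_pos <;> linarith
  -- By the addition formula this quantity bounds the relative change of cosh(κ(z - w̄)) when z₀
  -- moves to z; the radius r makes it less than 1/2.
  have hlim : Filter.Tendsto (fun z : ℂ => ‖Complex.cosh (κ * (z - z₀)) - 1‖ +
      ‖Complex.sinh (κ * (z - z₀))‖ / c) (nhds z₀) (nhds 0) := by
    have : ContinuousAt (fun z : ℂ => ‖Complex.cosh (κ * (z - z₀)) - 1‖ +
      ‖Complex.sinh (κ * (z - z₀))‖ / c) z₀ := by fun_prop
    simpa [ContinuousAt] using this
  obtain ⟨r, hr, hball⟩ := Metric.eventually_nhds_iff_ball.1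
    ((hlim.eventually (gt_mem_nhds (show (0 : ℝ) < 1 / 2 by norm_num))).and
      ((isOpen_strip a).mem_nhds hz₀))
  refine ⟨r, hr, fun z hz => (hball z hz).2, fun z hz w hw => ?_⟩
  have hsmall := (hball z hz).1
  have hzs := (hball z hz).2
  set X : ℂ := κ * (z₀ - (starRingEnd ℂ) w) with hX
  set δ : ℂ := κ * (z - z₀) with hδ
  have hXδ : (κ : ℂ) * (z - (starRingEnd ℂ) w) = X + δ := by rw [hX, hδ]; ring
  have hw' : |w.im| < a := hw
  have hcos : c ≤ Real.cos X.im := by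
    rw [hX, Complex.im_ofReal_mul]
    refine le_trans ?_ (cos_ge_of_mem_strip hz₀ hw)
    rw [hc]
    gcongr
    linarith
  have hXne : Complex.cosh X ≠ 0 := cosh_ne_zero_of_mem_strip hz₀ hw
  have hYne : Complex.cosh (X + δ) ≠ 0 := by
    rw [← hXδ]; exact cosh_ne_zero_of_mem_strip hzs hw
  -- |cosh X|² and |sinh X|² share the term sinh²(Re X) and differ only by cos² against sin² of Im
  -- X, where c ≤ cos ≤ 1.
  have hsinh : ‖Complex.sinh X‖ ≤ ‖Complex.cosh X‖ / c := by
    rw [le_div_iff₀ hc0, ← abs_of_nonneg (norm_nonneg (Complex.cosh X)),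
      ← abs_of_nonneg (mul_nonneg (norm_nonneg (Complex.sinh X)) hc0.le), ← sq_le_sq, mul_pow,
      norm_cosh_sq, norm_sinh_sq]
    have h1 : c ^ 2 ≤ Real.cos X.im ^ 2 := by gcongr
    have h2 := Real.sin_sq_add_cos_sq X.im
    nlinarith [sq_nonneg (Real.sinh X.re), sq_nonneg (Real.sin X.im),
      mul_nonneg (sq_nonneg (Real.sinh X.re)) (sub_nonneg.2 h1),
      mul_nonneg (sq_nonneg (Real.sin X.im)) (sub_nonneg.2 h1), sq_nonneg (Real.cos X.im),
      mul_nonneg (sq_nonneg (Real.sinh X.re)) (sq_nonneg (Real.sin X.im))]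
  have hdiff : ‖Complex.cosh (X + δ) - Complex.cosh X‖ ≤ 1 / 2 * ‖Complex.cosh X‖ := by
    have e : Complex.cosh (X + δ) - Complex.cosh X =
      Complex.cosh X * (Complex.cosh δ - 1) + Complex.sinh X * Complex.sinh δ := by
      rw [Complex.cosh_add]; ring
    rw [e]
    calc _ ≤ ‖Complex.cosh X‖ * ‖Complex.cosh δ - 1‖ + ‖Complex.sinh X‖ * ‖Complex.sinh δ‖ := by
          refine (norm_add_le _ _).trans ?_
          rw [norm_mul, norm_mul]
      _ ≤ ‖Complex.cosh X‖ * ‖Complex.cosh δ - 1‖ + ‖Complex.cosh X‖ / c * ‖Complex.sinh δ‖ := by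
          gcongr
      _ = (‖Complex.cosh δ - 1‖ + ‖Complex.sinh δ‖ / c) * ‖Complex.cosh X‖ := by ring
      _ ≤ _ := by gcongr
  have h1 : ‖Complex.cosh (X + δ)‖ ≤ 2 * ‖Complex.cosh X‖ := by
    have := norm_le_norm_add_norm_sub (Complex.cosh X) (Complex.cosh (X + δ))
    rw [norm_sub_rev] at this
    linarith [norm_nonneg (Complex.cosh X)]
  have h2 : ‖Complex.cosh X‖ ≤ 2 * ‖Complex.cosh (X + δ)‖ := by
    have := norm_le_norm_add_norm_sub (Complex.cosh (X + δ)) (Complex.cosh X)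
    linarith [norm_nonneg (Complex.cosh X)]
  -- The kernel has the square of cosh in its denominator, so the factor 2 for cosh becomes 4.
  have key : ∀ A B K : ℝ, 0 ≤ K → 0 < A → 0 < B → A ≤ 2 * B → K / B ^ 2 ≤ 4 * (K / A ^ 2) := by
    intro A B K hK hA hB hAB
    rw [← mul_div_assoc, div_le_div_iff₀ (by positivity) (by positivity)]
    nlinarith [mul_le_mul_of_nonneg_left (pow_le_pow_left₀ hA.le hAB 2) hK]
  unfold stripKernel
  rw [← hκ, hXδ, ← hX, norm_div, norm_div, norm_pow, norm_pow]
  exact ⟨key _ _ _ (norm_nonneg _) (norm_pos_iff.2 hXne) (norm_pos_iff.2 hYne) h2,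
    key _ _ _ (norm_nonneg _) (norm_pos_iff.2 hYne) (norm_pos_iff.2 hXne) h1⟩

/-! ### Schur estimates for the strip kernel. -/

lemma lintegral_rpow_neg_div_add_le {ε d : ℝ} (hε : 0 < ε) (hε1 : ε < 1) (hd : 0 < d) :
    ∫⁻ t in Ioi 0, ENNReal.ofReal (t ^ (-ε) / (d + t)) ≤
      ENNReal.ofReal ((1 / (1 - ε) + 1 / ε) * d ^ (-ε)) := by
  -- Below d the denominator is at least d and ε < 1 gives convergence at 0; above d it is at least
  -- t and ε > 0 gives convergence at infinity.
  have hsplit : Ioi (0 : ℝ) = Ioc 0 d ∪ Ioi d := (Ioc_union_Ioi_eq_Ioi hd.le).symm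
  have h1 : ∫⁻ t in Ioc 0 d, ENNReal.ofReal (t ^ (-ε) / (d + t)) ≤
      ENNReal.ofReal (1 / (1 - ε) * d ^ (-ε)) := by
    have hi : IntervalIntegrable (fun t : ℝ => t ^ (-ε)) volume 0 d :=
      intervalIntegral.intervalIntegrable_rpow' (by linarith)
    have hi' : IntegrableOn (fun t : ℝ => t ^ (-ε) / d) (Ioc 0 d) :=
      ((intervalIntegrable_iff_integrableOn_Ioc_of_le hd.le).1 hi).div_const d
    calc _ ≤ ∫⁻ t in Ioc 0 d, ENNReal.ofReal (t ^ (-ε) / d) := by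
          refine setLIntegral_mono' measurableSet_Ioc fun t ht => ?_
          have := ht.1
          apply ENNReal.ofReal_le_ofReal
          gcongr
          linarith
      _ = ENNReal.ofReal (∫ t in Ioc 0 d, t ^ (-ε) / d) := by
          rw [ofReal_integral_eq_lintegral_ofReal hi']
          filter_upwards [ae_restrict_mem measurableSet_Ioc] with t ht
          have := ht.1
          show 0 ≤ t ^ (-ε) / d
          positivity
      _ = _ := by
          rw [integral_div, ← intervalIntegral.integral_of_le hd.le,
            integral_rpow (Or.inl (by linarith)), Real.zero_rpow (by linarith),
            Real.rpow_add_one hd.ne', sub_zero]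
          congr 1
          have : 1 - ε ≠ 0 := by linarith
          have : -ε + 1 ≠ 0 := by linarith
          field_simp
          ring
  have h2 : ∫⁻ t in Ioi d, ENNReal.ofReal (t ^ (-ε) / (d + t)) ≤
      ENNReal.ofReal (1 / ε * d ^ (-ε)) := by
    have hi : IntegrableOn (fun t : ℝ => t ^ (-ε - 1)) (Ioi d) :=
      integrableOn_Ioi_rpow_of_lt (by linarith) hd
    calc _ ≤ ∫⁻ t in Ioi d, ENNReal.ofReal (t ^ (-ε - 1)) := by
          refine setLIntegral_mono' measurableSet_Ioi fun t ht => ?_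
          have ht0 : 0 < t := hd.trans ht
          apply ENNReal.ofReal_le_ofReal
          rw [Real.rpow_sub_one ht0.ne']
          gcongr
          linarith
      _ = ENNReal.ofReal (∫ t in Ioi d, t ^ (-ε - 1)) := by
          rw [ofReal_integral_eq_lintegral_ofReal hi]
          filter_upwards [ae_restrict_mem measurableSet_Ioi] with t ht
          have ht0 : 0 < t := hd.trans ht
          show 0 ≤ t ^ (-ε - 1)
          positivity
      _ = _ := by
          rw [integral_Ioi_rpow_of_lt (by linarith) hd]
          congr 1
          rw [sub_add_cancel]
          field_simp
  rw [hsplit]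
  refine (lintegral_union_le _ _ _).trans ((add_le_add h1 h2).trans_eq ?_)
  rw [← ENNReal.ofReal_add, ← add_mul]
  · have : 0 < 1 - ε := by linarith
    positivity
  · positivity

/-- The arctangent integral after an affine substitution. It carries out the integration in the real
direction in the Schur estimate. -/
lemma lintegral_inv_sq_add_sq {κ s : ℝ} (hκ : 0 < κ) (hs : 0 < s) (x : ℝ) :
    ∫⁻ x', ENNReal.ofReal (κ ^ 2 / Real.pi / ((κ * (x - x')) ^ 2 + s ^ 2)) =
      ENNReal.ofReal (κ / s) := by
  have hp := Real.pi_pos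
  have e : ∀ x' : ℝ, κ ^ 2 / Real.pi / ((κ * (x - x')) ^ 2 + s ^ 2) =
      κ ^ 2 / (Real.pi * s ^ 2) * (1 + (κ / s * (x - x')) ^ 2)⁻¹ := by
    intro x'
    have : (κ * (x - x')) ^ 2 + s ^ 2 ≠ 0 := by positivity
    have : 1 + (κ / s * (x - x')) ^ 2 ≠ 0 := by positivity
    field_simp
    ring
  have hi : Integrable (fun x' : ℝ => (1 + (κ / s * (x - x')) ^ 2)⁻¹) :=
    (integrable_inv_one_add_sq.comp_mul_left' (by positivity : κ / s ≠ 0)).comp_sub_left x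
  simp_rw [e]
  rw [← ofReal_integral_eq_lintegral_ofReal (hi.const_mul _)
    (Filter.Eventually.of_forall fun _ => by positivity), integral_const_mul,
    integral_sub_left_eq_self (fun y => (1 + (κ / s * y) ^ 2)⁻¹) volume x,
    Measure.integral_comp_mul_left (fun y => (1 + y ^ 2)⁻¹), integral_univ_inv_one_add_sq,
    smul_eq_mul, abs_of_pos (by positivity)]
  congr 1
  field_simp

/-- Since |sinh x| ≥ |x| and the cosine satisfies Jordan's inequality, the kernel is dominated by
one of half-plane type, for which the Schur integral is elementary. -/
lemma norm_stripKernel_le {a : ℝ} {z w : ℂ} (hz : z ∈ strip a) (hw : w ∈ strip a) :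
    ‖stripKernel a (z - (starRingEnd ℂ) w)‖ ≤ (Real.pi / (4 * a)) ^ 2 / Real.pi /
      ((Real.pi / (4 * a) * (z.re - w.re)) ^ 2 + ((a - |z.im| + (a - |w.im|)) / (2 * a)) ^ 2) := by
  have hz' : |z.im| < a := hz
  have hw' : |w.im| < a := hw
  have ha : 0 < a := (abs_nonneg _).trans_lt hz'
  have hs : 0 < (a - |z.im| + (a - |w.im|)) / (2 * a) := by apply div_pos <;> linarith
  have h1 : (Real.pi / (4 * a) * (z.re - w.re)) ^ 2 ≤
      Real.sinh (Real.pi / (4 * a) * (z - (starRingEnd ℂ) w).re) ^ 2 := by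
    rw [sq_le_sq, Real.abs_sinh]
    simpa using Real.self_le_sinh_iff.2 (abs_nonneg (Real.pi / (4 * a) * (z.re - w.re)))
  have h2 := pow_le_pow_left₀ hs.le (cos_ge_of_mem_strip hz hw) 2
  rw [norm_stripKernel a ha]
  gcongr

/-- The Schur test integral for the Bergman kernel of the strip. -/
lemma lintegral_stripKernel_mul_le {a ε : ℝ} (hε : 0 < ε) (hε1 : ε < 1) {z : ℂ}
    (hz : z ∈ strip a) :
    ∫⁻ w in strip a, ‖stripKernel a (z - (starRingEnd ℂ) w)‖ₑ *
        ENNReal.ofReal ((a - |w.im|) ^ (-ε)) ≤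
      ENNReal.ofReal (Real.pi * (1 / (1 - ε) + 1 / ε)) * ENNReal.ofReal ((a - |z.im|) ^ (-ε)) := by
  have hz' : |z.im| < a := hz
  have ha : 0 < a := (abs_nonneg _).trans_lt hz'
  have hp := Real.pi_pos
  set κ : ℝ := Real.pi / (4 * a) with hκ
  have hκ0 : 0 < κ := by positivity
  set d := a - |z.im| with hd
  have hd0 : 0 < d := by linarith
  set G : ℝ → ℝ → ℝ≥0∞ := fun x y => indicator (Ioo (-a) a) (fun y =>
    ENNReal.ofReal (κ ^ 2 / Real.pi / ((κ * (z.re - x)) ^ 2 + ((d + (a - |y|)) / (2 * a)) ^ 2)) *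
      ENNReal.ofReal ((a - |y|) ^ (-ε))) y with hG
  have hGm : Measurable (fun q : ℝ × ℝ => G q.1 q.2) := by
    have : (fun q : ℝ × ℝ => G q.1 q.2) = indicator (Prod.snd ⁻¹' Ioo (-a) a) (fun q : ℝ × ℝ =>
        ENNReal.ofReal (κ ^ 2 / Real.pi /
          ((κ * (z.re - q.1)) ^ 2 + ((d + (a - |q.2|)) / (2 * a)) ^ 2)) *
        ENNReal.ofReal ((a - |q.2|) ^ (-ε))) := by
      ext q; simp only [hG, indicator, mem_preimage]
    rw [this]
    refine Measurable.indicator ?_ (measurable_snd measurableSet_Ioo)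
    fun_prop
  have step1 : ∫⁻ w in strip a, ‖stripKernel a (z - (starRingEnd ℂ) w)‖ₑ *
      ENNReal.ofReal ((a - |w.im|) ^ (-ε)) ≤ ∫⁻ w : ℂ, G w.re w.im := by
    rw [← lintegral_indicator (measurableSet_strip a)]
    refine lintegral_mono fun w => ?_
    by_cases hw : w ∈ strip a
    · have hw' : |w.im| < a := hw
      have hw2 : w.im ∈ Ioo (-a) a := abs_lt.1 hw'
      simp only [hG, indicator_of_mem hw, indicator_of_mem hw2]
      gcongr
      rw [← ofReal_norm]
      exact ENNReal.ofReal_le_ofReal (norm_stripKernel_le hz hw)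
    · simp [indicator_of_notMem hw]
  have step2 : ∫⁻ w : ℂ, G w.re w.im = ∫⁻ y, ∫⁻ x, G x y := by
    have := Complex.volume_preserving_equiv_real_prod.lintegral_comp hGm
    rw [← lintegral_prod_symm' _ hGm, ← Measure.volume_eq_prod, ← this]
    rfl
  -- The x-integral is κ/s with s = (d + (a - |y|))/(2a), and 2aκ = π/2.
  have step3 : ∀ y, ∫⁻ x, G x y ≤ indicator (Ioo (-a) a) (fun y =>
      ENNReal.ofReal (Real.pi / 2) * (ENNReal.ofReal ((a - |y|) ^ (-ε) / (d + (a - |y|))))) y := by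
    intro y
    by_cases hy : y ∈ Ioo (-a) a
    · have hy' : |y| < a := abs_lt.2 hy
      have hs : 0 < (d + (a - |y|)) / (2 * a) := by apply div_pos <;> linarith
      simp only [hG, indicator_of_mem hy]
      rw [lintegral_mul_const' _ _ ENNReal.ofReal_ne_top, lintegral_inv_sq_add_sq hκ0 hs,
        ← ENNReal.ofReal_mul (by positivity), ← ENNReal.ofReal_mul (by positivity)]
      apply le_of_eq
      congr 1
      have : d + (a - |y|) ≠ 0 := by linarith
      rw [hκ]
      field_simp
      norm_num
    · simp [hG, indicator_of_notMem hy]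
  set g : ℝ → ℝ≥0∞ := indicator (Ioi 0) fun t => ENNReal.ofReal (t ^ (-ε) / (d + t)) with hg
  have hgm : Measurable g := by
    refine Measurable.indicator ?_ measurableSet_Ioi
    fun_prop
  -- The nearest boundary line is y = a or y = -a according to the sign of y. Adding both
  -- contributions avoids a case split and costs a factor 2.
  have step4 : ∀ y, indicator (Ioo (-a) a) (fun y =>
      ENNReal.ofReal (Real.pi / 2) * (ENNReal.ofReal ((a - |y|) ^ (-ε) / (d + (a - |y|))))) y ≤
      ENNReal.ofReal (Real.pi / 2) * (g (a - y) + g (a + y)) := by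
    intro y
    by_cases hy : y ∈ Ioo (-a) a
    · have h1 : a - y ∈ Ioi (0 : ℝ) := by have := hy.2; simp; linarith
      have h2 : a + y ∈ Ioi (0 : ℝ) := by have := hy.1; simp; linarith
      rw [indicator_of_mem hy]
      gcongr
      rcases le_total 0 y with h | h
      · rw [abs_of_nonneg h, hg, indicator_of_mem h1]
        exact le_self_add
      · rw [abs_of_nonpos h, sub_neg_eq_add, hg, indicator_of_mem h2]
        exact le_add_self
    · simp [indicator_of_notMem hy]
  calc _ ≤ ∫⁻ y, ENNReal.ofReal (Real.pi / 2) * (g (a - y) + g (a + y)) :=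
        step1.trans (step2.trans_le (lintegral_mono fun y => (step3 y).trans (step4 y)))
    _ = ENNReal.ofReal (Real.pi / 2) * (2 * ∫⁻ t, g t) := by
        rw [lintegral_const_mul' _ _ ENNReal.ofReal_ne_top, lintegral_add_left (by fun_prop),
          lintegral_sub_left_eq_self g a, lintegral_add_left_eq_self g a, two_mul]
    _ ≤ ENNReal.ofReal (Real.pi / 2) *
        (2 * ENNReal.ofReal ((1 / (1 - ε) + 1 / ε) * d ^ (-ε))) := by
        gcongr
        rw [hg, lintegral_indicator measurableSet_Ioi]
        exact lintegral_rpow_neg_div_add_le hε hε1 hd0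
    _ = _ := by
        have : 0 < 1 - ε := by linarith
        rw [show (2 : ℝ≥0∞) = ENNReal.ofReal 2 by simp, ← ENNReal.ofReal_mul (by positivity),
          ← ENNReal.ofReal_mul (by positivity), ← ENNReal.ofReal_mul (by positivity)]
        congr 1
        ring

/-! ### The reproducing property, transported from the unit disc. -/

lemma det_restrictScalars_toSpanSingleton (c : ℂ) :
    ((ContinuousLinearMap.toSpanSingleton ℂ c).restrictScalars ℝ).det = ‖c‖ ^ 2 := by
  have : (((ContinuousLinearMap.toSpanSingleton ℂ c).restrictScalars ℝ : ℂ →L[ℝ] ℂ) : ℂ →ₗ[ℝ] ℂ) =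
      (LinearMap.toSpanSingleton ℂ ℂ c).restrictScalars ℝ := rfl
  rw [ContinuousLinearMap.det, this, LinearMap.det_restrictScalars]
  simp [Algebra.norm_complex_eq, Complex.normSq_eq_norm_sq]

/-- The mean value property over the unit disc. -/
lemma setIntegral_ball_eq_of_differentiableOn {F : ℂ → ℂ}
    (hF : DifferentiableOn ℂ F (Metric.ball 0 1)) (hi : IntegrableOn F (Metric.ball 0 1)) :
    ∫ z in Metric.ball 0 1, F z = Real.pi * F 0 := by
  set f : ℂ → ℂ := indicator (Metric.ball 0 1) F with hf
  have hfi : Integrable f := (integrable_indicator_iff measurableSet_ball).2 hi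
  have hfm : AEStronglyMeasurable (fun p : ℝ × ℝ => p.1 • f (Complex.polarCoord.symm p))
      (volume.restrict polarCoord.target) := by
    have hm : Measurable f := by
      classical
      rw [hf, ← piecewise_eq_indicator]
      exact hF.continuousOn.measurable_piecewise continuousOn_const measurableSet_ball
    have : Measurable fun p : ℝ × ℝ => Complex.polarCoord.symm p := by
      simp_rw [Complex.polarCoord_symm_apply]; fun_prop
    exact (measurable_fst.smul (hm.comp this)).aestronglyMeasurable
  have hint : IntegrableOn (fun p : ℝ × ℝ => p.1 • f (Complex.polarCoord.symm p))
      (Ioi 0 ×ˢ Ioo (-Real.pi) Real.pi) := by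
    refine ⟨hfm, ?_⟩
    have h := Complex.lintegral_comp_polarCoord_symm fun z => ‖f z‖ₑ
    have h2 : ∫⁻ z, ‖f z‖ₑ < ⊤ := hfi.2
    rw [← h] at h2
    refine lt_of_le_of_lt (le_of_eq ?_) h2
    refine setLIntegral_congr_fun (measurableSet_Ioi.prod measurableSet_Ioo) fun p hp => ?_
    simp only [enorm_smul]
    rw [Real.enorm_of_nonneg (le_of_lt hp.1)]
    rfl
  -- In polar coordinates the angular integral is a circle average, hence a multiple of F 0 for
  -- every radius below 1.
  have hinner : ∀ r ∈ Ioi (0 : ℝ), ∫ θ in Ioo (-Real.pi) Real.pi,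
      r • f (Complex.polarCoord.symm (r, θ)) =
        indicator (Iio 1) (fun r => (2 * Real.pi * r : ℝ) * F 0) r := by
    intro r hr
    have hr0 : 0 < r := hr
    have hn : ∀ θ, ‖Complex.polarCoord.symm (r, θ)‖ = r := fun θ => by
      rw [Complex.norm_polarCoord_symm, abs_of_pos hr0]
    by_cases h1 : r < 1
    · rw [indicator_of_mem (show r ∈ Iio 1 from h1)]
      have hd : DiffContOnCl ℂ F (Metric.ball 0 |r|) := by
        apply DifferentiableOn.diffContOnCl
        rw [abs_of_pos hr0]
        exact hF.mono ((Metric.closure_ball_subset_closedBall).trans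
          (Metric.closedBall_subset_ball h1))
      have hav := hd.circleAverage
      rw [Real.circleAverage_eq_integral_add (-Real.pi)] at hav
      have e : ∀ θ, r • f (Complex.polarCoord.symm (r, θ)) = r • F (circleMap 0 r θ) := by
        intro θ
        have hmem : Complex.polarCoord.symm (r, θ) ∈ Metric.ball (0 : ℂ) 1 := by
          rw [mem_ball_zero_iff, hn]; exact h1
        rw [hf, indicator_of_mem hmem, Complex.polarCoord_symm_apply]
        simp [circleMap, Complex.exp_mul_I]
      simp_rw [e]
      rw [integral_smul, ← integral_Ioc_eq_integral_Ioo, ← intervalIntegral.integral_of_le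
        (by linarith [Real.pi_pos])]
      have e2 : ∫ θ in (-Real.pi)..Real.pi, F (circleMap 0 r θ) =
          ∫ θ in (0 : ℝ)..2 * Real.pi, F (circleMap 0 r (θ + -Real.pi)) := by
        rw [intervalIntegral.integral_comp_add_right (fun θ => F (circleMap 0 r θ))]
        congr 1 <;> ring
      rw [e2]
      rw [inv_smul_eq_iff₀ (by positivity)] at hav
      rw [hav]
      simp only [Complex.real_smul]
      push_cast
      ring
    · rw [indicator_of_notMem (show r ∉ Iio 1 from h1)]
      apply integral_eq_zero_of_ae
      refine Filter.Eventually.of_forall fun θ => ?_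
      have hmem : Complex.polarCoord.symm (r, θ) ∉ Metric.ball (0 : ℂ) 1 := by
        rw [mem_ball_zero_iff, hn]; exact h1
      simp only [hf, indicator_of_notMem hmem, smul_zero, Pi.zero_apply]
  rw [← integral_indicator measurableSet_ball, ← hf, ← Complex.integral_comp_polarCoord_symm f]
  rw [show polarCoord.target = Ioi (0 : ℝ) ×ˢ Ioo (-Real.pi) Real.pi from rfl,
    Measure.volume_eq_prod, setIntegral_prod _ hint, setIntegral_congr_fun measurableSet_Ioi hinner,
    integral_indicator measurableSet_Iio, Measure.restrict_restrict measurableSet_Iio,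
    show Iio (1 : ℝ) ∩ Ioi 0 = Ioo 0 1 by ext; simp [and_comm], integral_mul_const, integral_complex_ofReal,
    ← integral_Ioc_eq_integral_Ioo, ← intervalIntegral.integral_of_le zero_le_one,
    intervalIntegral.integral_const_mul, integral_id]
  push_cast
  ring

/-- The scaled exponential carries the strip into the right half-plane, and the bound on the
imaginary part makes the principal logarithm its inverse. -/
lemma exp_re_pos_of_mem_strip {a : ℝ} {z : ℂ} (hz : z ∈ strip a) :
    |((Real.pi / (2 * a) : ℝ) * z).im| < Real.pi / 2 ∧
      0 < (Complex.exp ((Real.pi / (2 * a) : ℝ) * z)).re := by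
  have hz' : |z.im| < a := hz
  have ha : 0 < a := (abs_nonneg _).trans_lt hz'
  have h : |((Real.pi / (2 * a) : ℝ) * z).im| < Real.pi / 2 := by
    rw [Complex.im_ofReal_mul, abs_mul, abs_of_pos (by positivity)]
    calc _ < Real.pi / (2 * a) * a := by gcongr
      _ = _ := by field_simp
  refine ⟨h, ?_⟩
  rw [Complex.exp_re]
  exact mul_pos (Real.exp_pos _) (Real.cos_pos_of_mem_Ioo (abs_lt.1 h))

/-- The reproducing property of the Bergman kernel of the strip, for holomorphic functions for which
the integral converges absolutely. -/
lemma setIntegral_stripKernel_mul {a : ℝ} {z : ℂ} (hz : z ∈ strip a) {H : ℂ → ℂ}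
    (hH : DifferentiableOn ℂ H (strip a))
    (hi : IntegrableOn (fun w => stripKernel a (z - (starRingEnd ℂ) w) * H w) (strip a)) :
    ∫ w in strip a, stripKernel a (z - (starRingEnd ℂ) w) * H w = H z := by
  have hz' : |z.im| < a := hz
  have ha : 0 < a := (abs_nonneg _).trans_lt hz'
  set c : ℝ := Real.pi / (2 * a) with hc
  have hc0 : 0 < c := by positivity
  have hc0' : (c : ℂ) ≠ 0 := by exact_mod_cast hc0.ne'
  set e : ℂ := Complex.exp (c * z) with he
  set e' : ℂ := (starRingEnd ℂ) e with he'
  have hre : 0 < e.re := (exp_re_pos_of_mem_strip hz).2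
  have hsum : e + e' = (2 * e.re : ℝ) := Complex.add_conj e
  have hsum0 : e + e' ≠ 0 := by rw [hsum]; exact_mod_cast (by positivity : 2 * e.re ≠ 0)
  have hden : ∀ ζ ∈ Metric.ball (0 : ℂ) 1, 1 - ζ ≠ 0 := by
    intro ζ hζ h
    rw [sub_eq_zero] at h
    rw [mem_ball_zero_iff, ← h] at hζ
    simp at hζ
  -- The Möbius map of the disc onto the right half-plane with N(0) = e = exp(cz).
  set N : ℂ → ℂ := fun ζ => (e + ζ * e') / (1 - ζ) with hN
  have hNre : ∀ ζ ∈ Metric.ball (0 : ℂ) 1, 0 < (N ζ).re := by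
    intro ζ hζ
    have h1 := hden ζ hζ
    have h2 : (N ζ).re = e.re * (1 - ‖ζ‖ ^ 2) / Complex.normSq (1 - ζ) := by
      simp only [hN, Complex.div_re, ← Complex.normSq_eq_norm_sq, Complex.normSq_apply, he']
      simp
      field_simp
      ring
    rw [h2]
    rw [mem_ball_zero_iff] at hζ
    have h3 : 0 < 1 - ‖ζ‖ ^ 2 := by nlinarith [norm_nonneg ζ]
    have := Complex.normSq_pos.2 h1
    positivity
  have hNd : ∀ ζ ∈ Metric.ball (0 : ℂ) 1, HasDerivAt N ((e + e') / (1 - ζ) ^ 2) ζ := by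
    intro ζ hζ
    have h1 := hden ζ hζ
    have h := (((hasDerivAt_id ζ).mul_const e').const_add e).div ((hasDerivAt_id ζ).const_sub 1) h1
    refine h.congr_deriv ?_
    congr 1
    simp
    ring
  -- The Riemann map of the disc onto the strip with g(0) = z, the point at which H is to be
  -- reproduced.
  set g : ℂ → ℂ := fun ζ => Complex.log (N ζ) / c with hg
  have hslit : ∀ ζ ∈ Metric.ball (0 : ℂ) 1, N ζ ∈ Complex.slitPlane := fun ζ hζ =>
    Or.inl (hNre ζ hζ)
  have hN0 : ∀ ζ ∈ Metric.ball (0 : ℂ) 1, N ζ ≠ 0 := fun ζ hζ =>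
    Complex.slitPlane_ne_zero (hslit ζ hζ)
  set g' : ℂ → ℂ := fun ζ => (e + e') / (1 - ζ) ^ 2 / N ζ / c with hg'
  have hgd : ∀ ζ ∈ Metric.ball (0 : ℂ) 1, HasDerivAt g (g' ζ) ζ := fun ζ hζ =>
    ((hNd ζ hζ).clog (hslit ζ hζ)).div_const _
  have hexp : ∀ ζ ∈ Metric.ball (0 : ℂ) 1, Complex.exp (c * g ζ) = N ζ := by
    intro ζ hζ
    rw [hg, mul_div_cancel₀ _ hc0', Complex.exp_log (hN0 ζ hζ)]
  have hmaps : ∀ ζ ∈ Metric.ball (0 : ℂ) 1, g ζ ∈ strip a := by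
    intro ζ hζ
    have h1 := Complex.abs_arg_lt_pi_div_two_iff.2 (Or.inl (hNre ζ hζ))
    show |(Complex.log (N ζ) / c).im| < a
    rw [Complex.div_ofReal_im, Complex.log_im, abs_div, abs_of_pos hc0, div_lt_iff₀ hc0, hc]
    calc _ < Real.pi / 2 := h1
      _ = _ := by field_simp
  have hinj : InjOn g (Metric.ball 0 1) := by
    intro x hx y hy hxy
    have h := (hexp x hx).symm.trans ((congrArg (fun t => Complex.exp (c * t)) hxy).trans (hexp y hy))
    have h1 := hden x hx
    have h2 := hden y hy
    simp only [hN] at h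
    rw [div_eq_div_iff h1 h2] at h
    have : (e + e') * (x - y) = 0 := by linear_combination h
    rcases mul_eq_zero.1 this with h0 | h0
    · exact absurd h0 hsum0
    · exact sub_eq_zero.1 h0
  have himage : g '' Metric.ball 0 1 = strip a := by
    refine Subset.antisymm (image_subset_iff.2 hmaps) fun w hw => ?_
    obtain ⟨hwim, hwre⟩ := exp_re_pos_of_mem_strip hw
    rw [← hc] at hwim hwre
    set W := Complex.exp (c * w) with hW
    have hWe : W + e' ≠ 0 := by
      intro h
      have := congrArg Complex.re h
      simp [he'] at this
      linarith
    have hζ : (W - e) / (W + e') ∈ Metric.ball (0 : ℂ) 1 := by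
      rw [mem_ball_zero_iff, norm_div, div_lt_one (norm_pos_iff.2 hWe), ← abs_of_nonneg
        (norm_nonneg (W - e)), ← abs_of_nonneg (norm_nonneg (W + e')), ← sq_lt_sq,
        ← Complex.normSq_eq_norm_sq, ← Complex.normSq_eq_norm_sq, Complex.normSq_apply,
        Complex.normSq_apply]
      simp [he']
      nlinarith [mul_pos hwre hre]
    refine ⟨_, hζ, ?_⟩
    have h1 := hden _ hζ
    have hNW : N ((W - e) / (W + e')) = W := by
      simp only [hN]
      rw [div_eq_iff h1]
      field_simp
      ring
    show Complex.log (N ((W - e) / (W + e'))) / c = w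
    rw [hNW, hW, Complex.log_exp (by linarith [(abs_lt.1 hwim).1, Real.pi_pos])
      (by linarith [(abs_lt.1 hwim).2, Real.pi_pos]), mul_div_cancel_left₀ _ hc0']
  have hfd : ∀ ζ ∈ Metric.ball (0 : ℂ) 1, HasFDerivWithinAt g
      ((ContinuousLinearMap.toSpanSingleton ℂ (g' ζ)).restrictScalars ℝ) (Metric.ball 0 1) ζ :=
    fun ζ hζ => ((hgd ζ hζ).hasFDerivAt.restrictScalars ℝ).hasFDerivWithinAt
  -- By the transformation law of the Bergman kernel, K(z, g(ζ)) times the conjugate of g'(ζ) is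
  -- constant in ζ, and C is that constant. One factor of |g'|² is thus absorbed and the integrand
  -- becomes holomorphic, so the mean value property applies.
  set C : ℂ := c * e / (e + e') / Real.pi with hC
  have hker : ∀ ζ ∈ Metric.ball (0 : ℂ) 1,
      |((ContinuousLinearMap.toSpanSingleton ℂ (g' ζ)).restrictScalars ℝ).det| •
        (stripKernel a (z - (starRingEnd ℂ) (g ζ)) * H (g ζ)) = C * (g' ζ * H (g ζ)) := by
    intro ζ hζ
    have h1 := hden ζ hζ
    have h1' : 1 - (starRingEnd ℂ) ζ ≠ 0 := by
      intro h; apply h1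
      simpa using congrArg (starRingEnd ℂ) h
    have hNN : (starRingEnd ℂ) (N ζ) = (e' + (starRingEnd ℂ) ζ * e) / (1 - (starRingEnd ℂ) ζ) := by
      simp [hN, he']
    have hNN0 : (starRingEnd ℂ) (N ζ) ≠ 0 := by
      rw [Ne, map_eq_zero]; exact hN0 ζ hζ
    have hk : stripKernel a (z - (starRingEnd ℂ) (g ζ)) =
        c ^ 2 / Real.pi * (e * (starRingEnd ℂ) (N ζ)) / (e + (starRingEnd ℂ) (N ζ)) ^ 2 := by
      have hcosh := cosh_ne_zero_of_mem_strip hz (hmaps ζ hζ)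
      have hce : Real.pi / (4 * a) = c / 2 := by rw [hc]; field_simp; norm_num
      have hP : e * (starRingEnd ℂ) (N ζ) =
          Complex.exp ((c / 2 : ℝ) * (z + (starRingEnd ℂ) (g ζ))) ^ 2 := by
        rw [← hexp ζ hζ, ← Complex.exp_conj, he, ← Complex.exp_add, ← Complex.exp_nat_mul]
        congr 1
        rw [map_mul, Complex.conj_ofReal]
        push_cast
        ring
      have hS : e + (starRingEnd ℂ) (N ζ) = 2 *
          Complex.exp ((c / 2 : ℝ) * (z + (starRingEnd ℂ) (g ζ))) *
          Complex.cosh ((c / 2 : ℝ) * (z - (starRingEnd ℂ) (g ζ))) := by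
        rw [Complex.cosh, ← hexp ζ hζ, ← Complex.exp_conj, he]
        rw [mul_assoc, mul_left_comm, mul_div_cancel₀ _ two_ne_zero, mul_add, ← Complex.exp_add,
          ← Complex.exp_add, map_mul, Complex.conj_ofReal]
        push_cast
        congr 2 <;> ring
      rw [hce] at hcosh
      have hx := Complex.exp_ne_zero ((c / 2 : ℝ) * (z + (starRingEnd ℂ) (g ζ)))
      have hpi : (Real.pi : ℂ) ≠ 0 := by exact_mod_cast Real.pi_ne_zero
      rw [hP, hS, stripKernel, hce]
      push_cast at hcosh hx ⊢
      field_simp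
    have hg0 : (starRingEnd ℂ) (g' ζ) =
        (e + e') / (1 - (starRingEnd ℂ) ζ) ^ 2 / (starRingEnd ℂ) (N ζ) / c := by
      simp only [hg', map_div₀, map_pow, map_sub, map_one, map_add, Complex.conj_ofReal, he',
        Complex.conj_conj]
      rw [add_comm]
    rw [det_restrictScalars_toSpanSingleton, abs_of_nonneg (by positivity), Complex.real_smul,
      Complex.ofReal_pow, ← Complex.mul_conj', hg0, hk]
    have hS2 : e + (starRingEnd ℂ) (N ζ) = (e + e') / (1 - (starRingEnd ℂ) ζ) := by
      rw [hNN]; field_simp; ring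
    have hpi : (Real.pi : ℂ) ≠ 0 := by exact_mod_cast Real.pi_ne_zero
    rw [hS2, hC]
    field_simp
  have hFd : DifferentiableOn ℂ (fun ζ => C * (g' ζ * H (g ζ))) (Metric.ball 0 1) := by
    intro ζ hζ
    have h1 := hden ζ hζ
    have h2 := hN0 ζ hζ
    have h3 : DifferentiableAt ℂ g' ζ := by
      have := (hNd ζ hζ).differentiableAt
      simp only [hg']
      fun_prop (disch := first | assumption | exact pow_ne_zero 2 h1)
    have h4 : DifferentiableAt ℂ (fun ζ => H (g ζ)) ζ :=
      ((hH _ (hmaps ζ hζ)).differentiableAt ((isOpen_strip a).mem_nhds (hmaps ζ hζ))).comp ζ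
        (hgd ζ hζ).differentiableAt
    exact ((h3.mul h4).const_mul C).differentiableWithinAt
  have hFi : IntegrableOn (fun ζ => C * (g' ζ * H (g ζ))) (Metric.ball 0 1) := by
    rw [← himage, integrableOn_image_iff_integrableOn_abs_det_fderiv_smul volume measurableSet_ball
      hfd hinj] at hi
    exact hi.congr_fun hker measurableSet_ball
  rw [← himage, integral_image_eq_integral_abs_det_fderiv_smul volume measurableSet_ball hfd hinj,
    setIntegral_congr_fun measurableSet_ball hker, setIntegral_ball_eq_of_differentiableOn hFd hFi]
  have hpi : (Real.pi : ℂ) ≠ 0 := by exact_mod_cast Real.pi_ne_zero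
  have he0 : e ≠ 0 := Complex.exp_ne_zero _
  have hg0 : g 0 = z := by
    obtain ⟨him, -⟩ := exp_re_pos_of_mem_strip hz
    simp only [hg, hN, zero_mul, add_zero, sub_zero, div_one, he]
    rw [Complex.log_exp (by linarith [(abs_lt.1 him).1, Real.pi_pos])
      (by linarith [(abs_lt.1 him).2, Real.pi_pos]), mul_div_cancel_left₀ _ hc0']
  rw [hg0, hC, hg']
  simp only [hN, zero_mul, add_zero, sub_zero, div_one, one_pow]
  field_simp

/-! ### The covering of the worm domain by a product of two strips -/

/-- The product of strips which covers the worm domain. -/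
def coverDomain (β : ℝ) : Set (ℂ × ℂ) := strip (Real.pi / 2) ×ˢ strip (β - Real.pi / 2)

/-- The covering map. -/
def coverMap (m : ℂ × ℂ) : ℂ × ℂ := (m.1 + m.2, Complex.exp (-(Complex.I * m.2 / 2)))

/-- The second coordinates of the points of the cover over `(z₁, w)`. -/
def liftSnd (n : ℤ) (w : ℂ) : ℂ := 2 * Complex.I * Complex.log w + 4 * Real.pi * n

/-- The points of the cover over `w`. -/
def lift (n : ℤ) (w : ℂ × ℂ) : ℂ × ℂ := (w.1 - liftSnd n w.2, liftSnd n w.2)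

/-- The annulus `|log |w|²| < b`. -/
def annulus (b : ℝ) : Set ℂ := {w | w ≠ 0 ∧ |Real.log (‖w‖ ^ 2)| < b}

lemma measurableSet_annulus (b : ℝ) : MeasurableSet (annulus b) :=
  (measurableSet_singleton (0 : ℂ)).compl.inter
    (measurableSet_lt (f := fun w : ℂ => |Real.log (‖w‖ ^ 2)|) (by fun_prop) measurable_const)

lemma isOpen_coverDomain (β : ℝ) : IsOpen (coverDomain β) := (isOpen_strip _).prod (isOpen_strip _)

lemma measurableSet_coverDomain (β : ℝ) : MeasurableSet (coverDomain β) :=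
  (isOpen_coverDomain β).measurableSet

lemma log_norm_exp_sq (v : ℂ) :
    Real.log (‖Complex.exp (-(Complex.I * v / 2))‖ ^ 2) = v.im := by
  rw [Complex.norm_exp, ← Real.exp_nat_mul, Real.log_exp]
  simp
  ring

/-- With log|exp(-iv/2)|² = Im v, the defining inequalities become bounds on Im u and on Im v
separately. -/
lemma coverMap_mem_iff {β : ℝ} {m : ℂ × ℂ} : coverMap m ∈ wormDomain β ↔ m ∈ coverDomain β := by
  simp [coverMap, wormDomain, coverDomain, strip, log_norm_exp_sq, -Real.log_pow]

lemma exp_liftSnd (n : ℤ) {w : ℂ} (hw : w ≠ 0) :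
    Complex.exp (-(Complex.I * liftSnd n w / 2)) = w := by
  have : -(Complex.I * liftSnd n w / 2) = Complex.log w + (-n : ℤ) * (2 * Real.pi * Complex.I) := by
    rw [liftSnd]
    push_cast
    linear_combination (-Complex.log w) * Complex.I_mul_I
  rw [this, Complex.exp_add, Complex.exp_log hw, Complex.exp_int_mul_two_pi_mul_I, mul_one]

lemma coverMap_lift (n : ℤ) {w : ℂ × ℂ} (hw : w.2 ≠ 0) : coverMap (lift n w) = w := by
  simp [coverMap, lift, exp_liftSnd n hw]

lemma lift_mem {β : ℝ} (n : ℤ) {w : ℂ × ℂ} (hw : w ∈ wormDomain β) : lift n w ∈ coverDomain β := by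
  rw [← coverMap_mem_iff, coverMap_lift n hw.1]
  exact hw

lemma liftSnd_im (n : ℤ) (w : ℂ) : (liftSnd n w).im = Real.log (‖w‖ ^ 2) := by
  rw [Real.log_pow]
  simp [liftSnd, Complex.log_re]

lemma isOpen_wormDomain (β : ℝ) : IsOpen (wormDomain β) := by
  have e : wormDomain β = {z | z.2 ≠ 0} ∩ ({z | z.2 ≠ 0} ∩ (fun z : ℂ × ℂ =>
      (|z.1.im - Real.log (‖z.2‖ ^ 2)|, |Real.log (‖z.2‖ ^ 2)|)) ⁻¹'
      (Iio (Real.pi / 2) ×ˢ Iio (β - Real.pi / 2))) := by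
    ext z; simp [wormDomain]
  have ho : IsOpen {z : ℂ × ℂ | z.2 ≠ 0} := isOpen_ne_fun continuous_snd continuous_const
  rw [e]
  refine ho.inter (ContinuousOn.isOpen_inter_preimage ?_ ho (isOpen_Iio.prod isOpen_Iio))
  have : ContinuousOn (fun z : ℂ × ℂ => Real.log (‖z.2‖ ^ 2)) {z | z.2 ≠ 0} := by
    apply ContinuousOn.log (by fun_prop)
    intro z hz
    have : z.2 ≠ 0 := hz
    positivity
  fun_prop

lemma measurableSet_wormDomain (β : ℝ) : MeasurableSet (wormDomain β) :=
  (isOpen_wormDomain β).measurableSet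

lemma measurable_liftSnd (n : ℤ) : Measurable (liftSnd n) := by
  unfold liftSnd
  fun_prop

lemma measurable_lift (n : ℤ) : Measurable (lift n) := by
  have := measurable_liftSnd n
  unfold lift
  fun_prop

lemma continuous_coverMap : Continuous coverMap := by
  unfold coverMap
  fun_prop

/-- The strip is cut into rectangles of width 4π, each mapped bijectively onto the annulus by v ↦
exp(-iv/2), whose real Jacobian is |w|²/4. -/
lemma lintegral_strip_eq {b : ℝ} {G : ℂ → ℝ≥0∞} (hG : Measurable G) :
    ∫⁻ v in strip b, G v =
      ∫⁻ w in annulus b, ∑' n : ℤ, G (liftSnd n w) * ENNReal.ofReal (4 / ‖w‖ ^ 2) := by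
  have hp := Real.pi_pos
  -- Closed on the left because Re (`liftSnd n w`) = 4πn - 2 arg w with arg w ∈ (-π, π].
  set S : ℤ → Set ℂ := fun n => strip b ∩
    {v | v.re ∈ Ico (4 * Real.pi * n - 2 * Real.pi) (4 * Real.pi * n + 2 * Real.pi)} with hS
  have hSm : ∀ n, MeasurableSet (S n) := fun n =>
    (measurableSet_strip b).inter (Complex.measurable_re measurableSet_Ico)
  have hU : strip b = ⋃ n, S n := by
    ext v
    simp only [hS, mem_iUnion, mem_inter_iff, mem_ofPred_eq]
    refine ⟨fun hv => ⟨⌊(v.re + 2 * Real.pi) / (4 * Real.pi)⌋, hv, ?_⟩, fun ⟨n, hv, _⟩ => hv⟩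
    have h1 := Int.floor_le ((v.re + 2 * Real.pi) / (4 * Real.pi))
    have h2 := Int.lt_floor_add_one ((v.re + 2 * Real.pi) / (4 * Real.pi))
    rw [le_div_iff₀ (by positivity)] at h1
    rw [div_lt_iff₀ (by positivity)] at h2
    constructor <;> linarith
  have hdisj : Pairwise (Function.onFun Disjoint S) := by
    intro m n hmn
    refine Set.disjoint_left.2 fun v hm hn => hmn ?_
    have h1 := hm.2.1; have h2 := hm.2.2; have h3 := hn.2.1; have h4 := hn.2.2
    have h5 : (m : ℝ) < n + 1 := by nlinarith
    have h6 : (n : ℝ) < m + 1 := by nlinarith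
    norm_cast at h5 h6
    omega
  set φ : ℂ → ℂ := fun v => Complex.exp (-(Complex.I * v / 2)) with hφ
  have hlift : ∀ n, ∀ v ∈ S n, liftSnd n (φ v) = v := by
    intro n v hv
    have h1 := hv.2.1; have h2 := hv.2.2
    have e : φ v = Complex.exp (-(Complex.I * (v - 4 * Real.pi * n) / 2)) := by
      have : -(Complex.I * v / 2) = -(Complex.I * (v - 4 * Real.pi * n) / 2) +
        (-n : ℤ) * (2 * Real.pi * Complex.I) := by push_cast; ring
      rw [hφ]
      beta_reduce
      rw [this, Complex.exp_add, Complex.exp_int_mul_two_pi_mul_I, mul_one]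
    have him : (-(Complex.I * (v - 4 * Real.pi * n) / 2)).im = -((v.re - 4 * Real.pi * n) / 2) := by
      simp
    rw [liftSnd, e, Complex.log_exp (by rw [him]; linarith) (by rw [him]; linarith)]
    linear_combination (-(v - 4 * Real.pi * n)) * Complex.I_mul_I
  have himage : ∀ n, φ '' S n = annulus b := by
    intro n
    ext w
    constructor
    · rintro ⟨v, hv, rfl⟩
      refine ⟨Complex.exp_ne_zero _, ?_⟩
      rw [log_norm_exp_sq]
      exact hv.1
    · rintro ⟨hw0, hw⟩
      refine ⟨liftSnd n w, ⟨?_, ?_⟩, exp_liftSnd n hw0⟩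
      · show |(liftSnd n w).im| < b
        rwa [liftSnd_im]
      · have e : (liftSnd n w).re = 4 * Real.pi * n - 2 * w.arg := by
          simp [liftSnd, Complex.log_im]; ring
        have h1 := Complex.neg_pi_lt_arg w
        have h2 := Complex.arg_le_pi w
        simp only [mem_ofPred_eq, mem_Ico, e]
        constructor <;> linarith
  have hder : ∀ n, ∀ v ∈ S n, HasFDerivWithinAt φ ((ContinuousLinearMap.toSpanSingleton ℂ
      (φ v * -(Complex.I / 2))).restrictScalars ℝ) (S n) v := by
    intro n v _
    have h : HasDerivAt φ (φ v * -(Complex.I / 2)) v := by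
      have := ((((hasDerivAt_id v).const_mul Complex.I).div_const 2).neg).cexp
      simpa [hφ] using this
    exact (h.hasFDerivAt.restrictScalars ℝ).hasFDerivWithinAt
  have hinj : ∀ n, InjOn φ (S n) := fun n x hx y hy hxy => by
    rw [← hlift n x hx, ← hlift n y hy, hxy]
  have key : ∀ n, ∫⁻ v in S n, G v =
      ∫⁻ w in annulus b, G (liftSnd n w) * ENNReal.ofReal (4 / ‖w‖ ^ 2) := by
    intro n
    rw [← himage n, lintegral_image_eq_lintegral_abs_det_fderiv_mul volume (hSm n) (hder n) (hinj n)]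
    refine setLIntegral_congr_fun (hSm n) fun v hv => ?_
    have h0 : φ v ≠ 0 := Complex.exp_ne_zero _
    rw [hlift n v hv, det_restrictScalars_toSpanSingleton, mul_left_comm,
      ← ENNReal.ofReal_mul (abs_nonneg _), abs_of_nonneg (by positivity)]
    have : ‖φ v * -(Complex.I / 2)‖ ^ 2 * (4 / ‖φ v‖ ^ 2) = 1 := by
      rw [norm_mul, norm_neg, norm_div, Complex.norm_I]
      simp
      field_simp
      norm_num
    rw [this, ENNReal.ofReal_one, mul_one]
  rw [hU, lintegral_iUnion hSm hdisj, lintegral_tsum]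
  · simp_rw [key]
  · intro n
    exact ((hG.comp (measurable_liftSnd n)).mul (by fun_prop)).aemeasurable

/-- Unfolding: integration over the cover. -/
lemma lintegral_coverDomain_eq {β : ℝ} {G : ℂ × ℂ → ℝ≥0∞} (hG : Measurable G) :
    ∫⁻ m in coverDomain β, G m = ∫⁻ w in wormDomain β, ∑' n : ℤ,
      G (lift n w) * ENNReal.ofReal (4 / ‖w.2‖ ^ 2) := by
  have hL : Measurable fun w : ℂ × ℂ => ∑' n : ℤ, G (lift n w) * ENNReal.ofReal (4 / ‖w.2‖ ^ 2) := by
    refine Measurable.tsum fun n => ?_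
    exact (hG.comp (measurable_lift n)).mul (by fun_prop)
  rw [coverDomain, Measure.volume_eq_prod, ← Measure.prod_restrict,
    lintegral_prod_symm' _ hG, lintegral_strip_eq hG.lintegral_prod_left',
    ← lintegral_indicator (measurableSet_wormDomain β), ← lintegral_indicator
    (measurableSet_annulus _), lintegral_prod_symm' _ (hL.indicator (measurableSet_wormDomain β))]
  refine lintegral_congr fun w => ?_
  by_cases hw : w ∈ annulus (β - Real.pi / 2)
  · rw [indicator_of_mem hw]
    have e : ∀ x, (wormDomain β).indicator (fun w : ℂ × ℂ => ∑' n : ℤ, G (lift n w) *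
        ENNReal.ofReal (4 / ‖w.2‖ ^ 2)) (x, w) = ∑' n : ℤ, (strip (Real.pi / 2)).indicator
        (fun u => G (u, liftSnd n w)) (x - liftSnd n w) * ENNReal.ofReal (4 / ‖w‖ ^ 2) := by
      intro x
      -- All lifts of w have the same imaginary part, so over fixed w each sheet differs from the
      -- fibre of the worm domain by a translation.
      have hiff : ∀ n, (x, w) ∈ wormDomain β ↔ x - liftSnd n w ∈ strip (Real.pi / 2) := by
        intro n
        have h1 := hw.1; have h2 := hw.2
        simp only [wormDomain, mem_ofPred_eq, strip, Complex.sub_im, liftSnd_im]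
        tauto
      by_cases hx : (x, w) ∈ wormDomain β
      · rw [indicator_of_mem hx]
        refine tsum_congr fun n => ?_
        rw [indicator_of_mem ((hiff n).1 hx)]
        rfl
      · rw [indicator_of_notMem hx, eq_comm, ENNReal.tsum_eq_zero]
        intro n
        rw [indicator_of_notMem (fun h => hx ((hiff n).2 h)), zero_mul]
    have hm : ∀ n, Measurable fun u => (strip (Real.pi / 2)).indicator
        (fun u => G (u, liftSnd n w)) u := fun n =>
      (hG.comp (by fun_prop : Measurable fun u => (u, liftSnd n w))).indicator
        (measurableSet_strip _)
    simp_rw [e]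
    rw [lintegral_tsum]
    · refine tsum_congr fun n => ?_
      rw [lintegral_mul_const' _ _ ENNReal.ofReal_ne_top,
        lintegral_sub_right_eq_self (fun u => (strip (Real.pi / 2)).indicator
        (fun u => G (u, liftSnd n w)) u), lintegral_indicator (measurableSet_strip _)]
    · intro n
      have := (hm n).comp (measurable_sub_const (liftSnd n w))
      exact (this.mul_const _).aemeasurable
  · rw [indicator_of_notMem hw, eq_comm]
    convert lintegral_zero with x
    rw [indicator_of_notMem]
    exact fun h => hw ⟨h.1, h.2.2⟩

/-- The measure on the worm domain which corresponds to Lebesgue measure on the cover. -/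
def coverVol (β : ℝ) : Measure (ℂ × ℂ) :=
  (vol (wormDomain β)).withDensity fun w => ENNReal.ofReal (4 / ‖w.2‖ ^ 2)

lemma measurable_coverDensity : Measurable fun w : ℂ × ℂ => ENNReal.ofReal (4 / ‖w.2‖ ^ 2) := by
  fun_prop

instance (β : ℝ) : SigmaFinite (coverVol β) :=
  SigmaFinite.withDensity_ofReal _

lemma measurable_uncurry_lift : Measurable fun q : (ℂ × ℂ) × ℤ => lift q.2 q.1 :=
  measurable_from_prod_countable_left fun n => measurable_lift n

/-- The sheet number becomes a coordinate with counting measure, so sums over sheets can be handled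
by Fubini like any other integral. -/
lemma measurePreserving_lift (β : ℝ) : MeasurePreserving (fun q : (ℂ × ℂ) × ℤ => lift q.2 q.1)
    ((coverVol β).prod Measure.count) (volume.restrict (coverDomain β)) := by
  refine ⟨measurable_uncurry_lift, Measure.ext_of_lintegral _ fun G hG => ?_⟩
  have hm : ∀ n, Measurable fun w => G (lift n w) := fun n => hG.comp (measurable_lift n)
  have hGl : Measurable fun q : (ℂ × ℂ) × ℤ => G (lift q.2 q.1) := hG.comp measurable_uncurry_lift
  rw [lintegral_map hG measurable_uncurry_lift, lintegral_prod _ hGl.aemeasurable, lintegral_coverDomain_eq hG,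
    coverVol, lintegral_withDensity_eq_lintegral_mul _ measurable_coverDensity]
  · refine lintegral_congr fun w => ?_
    simp only [Pi.mul_apply, lintegral_count]
    rw [ENNReal.tsum_mul_right, mul_comm]
  · simp only [lintegral_count]
    exact Measurable.tsum hm

/-! ### The Schur test -/

/-- The Schur test for `L^p` boundedness of a positive integral operator. -/
lemma lintegral_rpow_lintegral_le_of_schur {X : Type*} [MeasurableSpace X] {μ : Measure X} [SFinite μ]
    {p q : ℝ} (hpq : p.HolderConjugate q) {k : X → X → ℝ≥0∞} (hk : Measurable (Function.uncurry k))
    {h : X → ℝ≥0∞} (hh : Measurable h) (h0 : ∀ᵐ x ∂μ, h x ≠ 0 ∧ h x ≠ ⊤) {A B : ℝ≥0∞}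
    (hA : ∀ᵐ x ∂μ, ∫⁻ y, k x y * h y ^ q ∂μ ≤ A * h x ^ q)
    (hB : ∀ᵐ y ∂μ, ∫⁻ x, k x y * h x ^ p ∂μ ≤ B * h y ^ p)
    {f : X → ℝ≥0∞} (hf : Measurable f) :
    ∫⁻ x, (∫⁻ y, k x y * f y ∂μ) ^ p ∂μ ≤ A ^ (p / q) * B * ∫⁻ x, f x ^ p ∂μ := by
  have hp := hpq.pos
  have hq := hpq.symm.pos
  have hkx : ∀ x, Measurable (k x) := fun x => hk.of_uncurry_left
  have hky : ∀ y, Measurable fun x => k x y := fun y => hk.of_uncurry_right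
  have step1 : ∀ᵐ x ∂μ, (∫⁻ y, k x y * f y ∂μ) ^ p ≤
      A ^ (p / q) * ∫⁻ y, h x ^ p * (k x y * (h y ^ (-p) * f y ^ p)) ∂μ := by
    filter_upwards [hA] with x hx
    have hxk := hkx x
    -- The kernel is split as k^{1/p} k^{1/q}, with the weight inserted as h⁻¹h, in preparation for
    -- Hölder.
    have e1 : ∫⁻ y, k x y * f y ∂μ =
        ∫⁻ y, (fun y => k x y ^ (1 / p) * (h y ^ (-1 : ℝ) * f y)) y *
          (fun y => k x y ^ (1 / q) * h y) y ∂μ := by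
      refine lintegral_congr_ae ?_
      filter_upwards [h0] with y hy
      have e : k x y ^ (1 / p) * k x y ^ (1 / q) = k x y := by
        rw [← ENNReal.rpow_add_of_nonneg _ _ (by positivity) (by positivity), one_div, one_div,
          hpq.inv_add_inv_eq_one, ENNReal.rpow_one]
      have e' : h y ^ (-1 : ℝ) * h y = 1 := by
        rw [ENNReal.rpow_neg_one, ENNReal.inv_mul_cancel hy.1 hy.2]
      calc k x y * f y = (k x y ^ (1 / p) * k x y ^ (1 / q)) * ((h y ^ (-1 : ℝ) * h y) * f y) := by
            rw [e, e', one_mul]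
        _ = _ := by ring
    have e2 := ENNReal.lintegral_mul_le_Lp_mul_Lq μ hpq
      (f := fun y => k x y ^ (1 / p) * (h y ^ (-1 : ℝ) * f y))
      (g := fun y => k x y ^ (1 / q) * h y) (by fun_prop) (by fun_prop)
    have e3 : ∀ y, (k x y ^ (1 / p) * (h y ^ (-1 : ℝ) * f y)) ^ p =
        k x y * (h y ^ (-p) * f y ^ p) := by
      intro y
      rw [ENNReal.mul_rpow_of_nonneg _ _ hp.le, ENNReal.mul_rpow_of_nonneg _ _ hp.le,
        ← ENNReal.rpow_mul, ← ENNReal.rpow_mul, one_div_mul_cancel hp.ne', ENNReal.rpow_one,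
        neg_one_mul]
    have e4 : ∀ y, (k x y ^ (1 / q) * h y) ^ q = k x y * h y ^ q := by
      intro y
      rw [ENNReal.mul_rpow_of_nonneg _ _ hq.le, ← ENNReal.rpow_mul, one_div_mul_cancel hq.ne',
        ENNReal.rpow_one]
    simp only [Pi.mul_apply] at e2
    simp only [e3, e4] at e2
    rw [e1]
    calc _ ≤ ((∫⁻ y, k x y * (h y ^ (-p) * f y ^ p) ∂μ) ^ (1 / p) *
          (A * h x ^ q) ^ (1 / q)) ^ p := by
          gcongr
          refine e2.trans ?_
          gcongr
      _ = A ^ (p / q) * (h x ^ p * ∫⁻ y, k x y * (h y ^ (-p) * f y ^ p) ∂μ) := by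
          rw [ENNReal.mul_rpow_of_nonneg _ _ hp.le, ← ENNReal.rpow_mul, ← ENNReal.rpow_mul,
            one_div_mul_cancel hp.ne', ENNReal.rpow_one,
            ENNReal.mul_rpow_of_nonneg _ _ (by positivity), ← ENNReal.rpow_mul,
            show q * (1 / q * p) = p by field_simp, show 1 / q * p = p / q by ring]
          ring
      _ = _ := by rw [lintegral_const_mul _ (by fun_prop)]
  have hm : Measurable (Function.uncurry fun x y => h x ^ p * (k x y * (h y ^ (-p) * f y ^ p))) := by
    have : Measurable fun z : X × X => k z.1 z.2 := hk
    unfold Function.uncurry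
    fun_prop
  calc _ ≤ ∫⁻ x, A ^ (p / q) * ∫⁻ y, h x ^ p * (k x y * (h y ^ (-p) * f y ^ p)) ∂μ ∂μ :=
        lintegral_mono_ae step1
    _ = A ^ (p / q) * ∫⁻ y, ∫⁻ x, h x ^ p * (k x y * (h y ^ (-p) * f y ^ p)) ∂μ ∂μ := by
        rw [lintegral_const_mul _ (by exact hm.lintegral_prod_right),
          lintegral_lintegral_swap hm.aemeasurable]
    _ ≤ A ^ (p / q) * ∫⁻ y, B * f y ^ p ∂μ := by
        gcongr 1
        refine lintegral_mono_ae ?_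
        filter_upwards [hB, h0] with y hy hy0
        have hyk := hky y
        calc _ = (h y ^ (-p) * f y ^ p) * ∫⁻ x, k x y * h x ^ p ∂μ := by
              rw [← lintegral_const_mul _ (by fun_prop)]
              refine lintegral_congr fun x => ?_
              ring
          _ ≤ (h y ^ (-p) * f y ^ p) * (B * h y ^ p) := by gcongr
          _ = (h y ^ (-p) * h y ^ p) * (B * f y ^ p) := by ring
          _ = _ := by
              rw [← ENNReal.rpow_add _ _ hy0.1 hy0.2, neg_add_cancel, ENNReal.rpow_zero, one_mul]
    _ = _ := by rw [lintegral_const_mul _ (by fun_prop), mul_assoc]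

/-! ### The Bergman kernel on the cover -/

/-- The Bergman kernel of the product of the two strips. -/
def coverKernel (β : ℝ) (m m' : ℂ × ℂ) : ℂ :=
  stripKernel (Real.pi / 2) (m.1 - (starRingEnd ℂ) m'.1) *
    stripKernel (β - Real.pi / 2) (m.2 - (starRingEnd ℂ) m'.2)

lemma measurable_coverKernel (β : ℝ) :
    Measurable fun q : (ℂ × ℂ) × (ℂ × ℂ) => coverKernel β q.1 q.2 := by
  have h1 := measurable_stripKernel (Real.pi / 2)
  have h2 := measurable_stripKernel (β - Real.pi / 2)
  have hc : Measurable (starRingEnd ℂ) := Complex.continuous_conj.measurable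
  exact (h1.comp (measurable_fst.fst.sub (hc.comp measurable_snd.fst))).mul
    (h2.comp (measurable_fst.snd.sub (hc.comp measurable_snd.snd)))

lemma coverKernel_swap (β : ℝ) (m m' : ℂ × ℂ) :
    coverKernel β m' m = (starRingEnd ℂ) (coverKernel β m m') := by
  rw [coverKernel, coverKernel, map_mul, stripKernel_swap _ m.1 m'.1,
    stripKernel_swap _ m.2 m'.2]

/-- Deck transformations are real translations and the kernel sees only differences m - m̄', so a
change of sheet can be moved from one variable to the other. -/
lemma coverKernel_lift (β : ℝ) (n : ℤ) (z w : ℂ × ℂ) :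
    coverKernel β (lift 0 z) (lift n w) = coverKernel β (lift (-n) z) (lift 0 w) := by
  have e : (starRingEnd ℂ) (4 * Real.pi * n : ℂ) = 4 * Real.pi * n := by
    rw [map_mul, map_mul, map_ofNat, Complex.conj_ofReal, map_intCast]
  simp only [coverKernel, lift, liftSnd, map_sub, map_add, e]
  congr 2 <;> push_cast <;> simp <;> ring

/-- The weights of the Schur test. -/
def coverWeight (β ε : ℝ) (m : ℂ × ℂ) : ℝ≥0∞ :=
  ENNReal.ofReal ((Real.pi / 2 - |m.1.im|) ^ (-ε)) *
    ENNReal.ofReal ((β - Real.pi / 2 - |m.2.im|) ^ (-ε))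

lemma measurable_coverWeight (β ε : ℝ) : Measurable (coverWeight β ε) := by
  unfold coverWeight
  fun_prop

lemma coverWeight_rpow {β ε r : ℝ} (hr : 0 ≤ r) {m : ℂ × ℂ} (hm : m ∈ coverDomain β) :
    coverWeight β ε m ^ r = coverWeight β (ε * r) m := by
  have h1 : 0 < Real.pi / 2 - |m.1.im| := sub_pos.2 hm.1
  have h2 : 0 < β - Real.pi / 2 - |m.2.im| := sub_pos.2 hm.2
  rw [coverWeight, coverWeight, ENNReal.mul_rpow_of_nonneg _ _ hr,
    ENNReal.ofReal_rpow_of_nonneg (by positivity) hr,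
    ENNReal.ofReal_rpow_of_nonneg (by positivity) hr, ← Real.rpow_mul h1.le,
    ← Real.rpow_mul h2.le, neg_mul]

lemma coverWeight_ne {β ε : ℝ} {m : ℂ × ℂ} (hm : m ∈ coverDomain β) :
    coverWeight β ε m ≠ 0 ∧ coverWeight β ε m ≠ ⊤ := by
  have h1 : 0 < Real.pi / 2 - |m.1.im| := sub_pos.2 hm.1
  have h2 : 0 < β - Real.pi / 2 - |m.2.im| := sub_pos.2 hm.2
  refine ⟨?_, ENNReal.mul_ne_top ENNReal.ofReal_ne_top ENNReal.ofReal_ne_top⟩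
  refine mul_ne_zero ?_ ?_
  · simpa using Real.rpow_pos_of_pos h1 _
  · simpa using Real.rpow_pos_of_pos h2 _

lemma lintegral_coverKernel_mul_le {β ε : ℝ} (hε : 0 < ε) (hε1 : ε < 1) {m : ℂ × ℂ}
    (hm : m ∈ coverDomain β) :
    ∫⁻ m' in coverDomain β, ‖coverKernel β m m'‖ₑ * coverWeight β ε m' ≤
      ENNReal.ofReal (Real.pi * (1 / (1 - ε) + 1 / ε)) ^ 2 * coverWeight β ε m := by
  have h1 := measurable_stripKernel (Real.pi / 2)
  have h2 := measurable_stripKernel (β - Real.pi / 2)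
  have hc : Measurable (starRingEnd ℂ) := Complex.continuous_conj.measurable
  have e : ∀ m', ‖coverKernel β m m'‖ₑ * coverWeight β ε m' =
      (‖stripKernel (Real.pi / 2) (m.1 - (starRingEnd ℂ) m'.1)‖ₑ *
        ENNReal.ofReal ((Real.pi / 2 - |m'.1.im|) ^ (-ε))) *
      (‖stripKernel (β - Real.pi / 2) (m.2 - (starRingEnd ℂ) m'.2)‖ₑ *
        ENNReal.ofReal ((β - Real.pi / 2 - |m'.2.im|) ^ (-ε))) := by
    intro m'
    rw [coverKernel, coverWeight, enorm_mul]
    ring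
  simp_rw [e]
  rw [coverDomain, Measure.volume_eq_prod, ← Measure.prod_restrict, lintegral_prod_mul
    (f := fun w => ‖stripKernel (Real.pi / 2) (m.1 - (starRingEnd ℂ) w)‖ₑ *
        ENNReal.ofReal ((Real.pi / 2 - |w.im|) ^ (-ε)))
    (g := fun w => ‖stripKernel (β - Real.pi / 2) (m.2 - (starRingEnd ℂ) w)‖ₑ *
        ENNReal.ofReal ((β - Real.pi / 2 - |w.im|) ^ (-ε)))]
  · refine (mul_le_mul' (lintegral_stripKernel_mul_le hε hε1 hm.1)
      (lintegral_stripKernel_mul_le hε hε1 hm.2)).trans_eq ?_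
    rw [coverWeight]
    ring
  · exact ((h1.comp (hc.const_sub _)).enorm.mul (by fun_prop)).aemeasurable
  · exact ((h2.comp (hc.const_sub _)).enorm.mul (by fun_prop)).aemeasurable

/-- The majorant of the projection operator on the cover. -/
def coverMajorant (β : ℝ) (f : ℂ × ℂ → ℝ≥0∞) (m : ℂ × ℂ) : ℝ≥0∞ :=
  ∫⁻ m' in coverDomain β, ‖coverKernel β m m'‖ₑ * f (coverMap m')

/-- The kernel of the majorant, pushed down to the worm domain. -/
def wormKernelMajorant (β : ℝ) (z w : ℂ × ℂ) : ℝ≥0∞ :=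
  ∑' n : ℤ, ‖coverKernel β (lift 0 z) (lift n w)‖ₑ * ENNReal.ofReal (4 / ‖w.2‖ ^ 2)

lemma measurable_wormKernelMajorant (β : ℝ) :
    Measurable (Function.uncurry (wormKernelMajorant β)) := by
  refine Measurable.tsum fun n => ?_
  refine ((measurable_coverKernel β).comp (((measurable_lift 0).comp measurable_fst).prodMk
    ((measurable_lift n).comp measurable_snd))).enorm.mul ?_
  fun_prop

/-- Unfolding: integration over the cover becomes a sum over sheets, which puts the operator in the
form needed for the Schur test on the worm domain. -/
lemma coverMajorant_lift {β : ℝ} {f : ℂ × ℂ → ℝ≥0∞} (hf : Measurable f) (z : ℂ × ℂ) :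
    coverMajorant β f (lift 0 z) = ∫⁻ w in wormDomain β, wormKernelMajorant β z w * f w := by
  have hm : Measurable fun m' => ‖coverKernel β (lift 0 z) m'‖ₑ * f (coverMap m') :=
    ((measurable_coverKernel β).comp (measurable_const.prodMk measurable_id)).enorm.mul
      (hf.comp continuous_coverMap.measurable)
  rw [coverMajorant, lintegral_coverDomain_eq hm]
  refine setLIntegral_congr_fun (measurableSet_wormDomain β) fun w hw => ?_
  simp only [wormKernelMajorant]
  rw [← ENNReal.tsum_mul_right]
  refine tsum_congr fun n => ?_
  rw [coverMap_lift n hw.1]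
  ring

lemma ofReal_coverDensity_le {β : ℝ} {z w : ℂ × ℂ} (hz : z ∈ wormDomain β) (hw : w ∈ wormDomain β) :
    ENNReal.ofReal (4 / ‖w.2‖ ^ 2) ≤
      ENNReal.ofReal (Real.exp (2 * (β - Real.pi / 2))) * ENNReal.ofReal (4 / ‖z.2‖ ^ 2) := by
  have h : ∀ z ∈ wormDomain β, Real.exp (-(β - Real.pi / 2)) ≤ ‖z.2‖ ^ 2 ∧
      ‖z.2‖ ^ 2 ≤ Real.exp (β - Real.pi / 2) := by
    intro z hz
    have h0 : 0 < ‖z.2‖ ^ 2 := by have := norm_pos_iff.2 hz.1; positivity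
    have h1 := abs_lt.1 hz.2.2
    exact ⟨(Real.le_log_iff_exp_le h0).1 h1.1.le, (Real.log_le_iff_le_exp h0).1 h1.2.le⟩
  have h0 : 0 < ‖z.2‖ ^ 2 := by have := norm_pos_iff.2 hz.1; positivity
  have h0' : 0 < ‖w.2‖ ^ 2 := by have := norm_pos_iff.2 hw.1; positivity
  rw [← ENNReal.ofReal_mul (Real.exp_pos _).le]
  apply ENNReal.ofReal_le_ofReal
  rw [← mul_div_assoc, div_le_div_iff₀ h0' h0]
  have h3 := (h z hz).2.trans_eq (show Real.exp (β - Real.pi / 2) =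
    Real.exp (2 * (β - Real.pi / 2)) * Real.exp (-(β - Real.pi / 2)) by
      rw [← Real.exp_add]; congr 1; ring)
  have h4 := mul_le_mul_of_nonneg_left (h w hw).1 (Real.exp_pos (2 * (β - Real.pi / 2))).le
  linarith

/-- Hermitian symmetry and the reindexing n ↦ -n make the sum over sheets symmetric. Only the
density 4/|w₂|² is not, and its variation on the domain is bounded. One Schur estimate then serves
for both variables. -/
lemma wormKernelMajorant_le_swap {β : ℝ} {z w : ℂ × ℂ} (hz : z ∈ wormDomain β)
    (hw : w ∈ wormDomain β) : wormKernelMajorant β z w ≤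
      ENNReal.ofReal (Real.exp (2 * (β - Real.pi / 2))) * wormKernelMajorant β w z := by
  have e : wormKernelMajorant β w z =
      ∑' n : ℤ, ‖coverKernel β (lift 0 z) (lift n w)‖ₑ * ENNReal.ofReal (4 / ‖z.2‖ ^ 2) := by
    rw [wormKernelMajorant, ← (Equiv.neg ℤ).tsum_eq]
    refine tsum_congr fun n => ?_
    rw [Equiv.neg_apply, coverKernel_lift, neg_neg, coverKernel_swap, RCLike.enorm_conj]
  rw [e, wormKernelMajorant, ← ENNReal.tsum_mul_left]
  refine ENNReal.tsum_le_tsum fun n => ?_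
  rw [mul_left_comm]
  gcongr
  exact ofReal_coverDensity_le hz hw

/-- The majorant of the projection operator is bounded on `L^p`. -/
lemma exists_lintegral_coverMajorant_le (β : ℝ) {p : ℝ} (hp : 1 < p) :
    ∃ C : ℝ≥0∞, C ≠ ⊤ ∧ ∀ f : ℂ × ℂ → ℝ≥0∞, Measurable f →
      ∫⁻ z in wormDomain β, coverMajorant β f (lift 0 z) ^ p ≤ C * ∫⁻ z in wormDomain β, f z ^ p := by
  set q := p.conjExponent with hq
  have hpq : p.HolderConjugate q := Real.HolderConjugate.conjExponent hp
  have hp0 := hpq.pos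
  have hq0 := hpq.symm.pos
  have hq1 := hpq.symm.lt
  have hpi1 : 1 / p < 1 := by rw [div_lt_one hp0]; exact hp
  have hqi1 : 1 / q < 1 := by rw [div_lt_one hq0]; exact hq1
  set A := ENNReal.ofReal (Real.pi * (1 / (1 - 1 / p) + 1 / (1 / p))) ^ 2
  set B := ENNReal.ofReal (Real.exp (2 * (β - Real.pi / 2))) *
    ENNReal.ofReal (Real.pi * (1 / (1 - 1 / q) + 1 / (1 / q))) ^ 2
  have hAt : A ≠ ⊤ := by finiteness
  have hBt : B ≠ ⊤ := by finiteness
  refine ⟨A ^ (p / q) * B, ENNReal.mul_ne_top (ENNReal.rpow_ne_top_of_nonneg (by positivity) hAt)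
    hBt, fun f hf => ?_⟩
  simp_rw [coverMajorant_lift hf]
  -- With this exponent, h^q and h^p are weights with exponents 1/p and 1/q, both in (0, 1) as the
  -- strip estimate requires.
  set h : ℂ × ℂ → ℝ≥0∞ := fun z => coverWeight β (1 / (p * q)) (lift 0 z) with hh
  have hhq : ∀ z ∈ wormDomain β, h z ^ q = coverWeight β (1 / p) (lift 0 z) := by
    intro z hz
    rw [hh, coverWeight_rpow hq0.le (lift_mem 0 hz)]
    congr 1; field_simp
  have hhp : ∀ z ∈ wormDomain β, h z ^ p = coverWeight β (1 / q) (lift 0 z) := by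
    intro z hz
    rw [hh, coverWeight_rpow hp0.le (lift_mem 0 hz)]
    congr 1; field_simp
  have key : ∀ ε : ℝ, 0 < ε → ε < 1 → ∀ z ∈ wormDomain β,
      ∫⁻ w in wormDomain β, wormKernelMajorant β z w * coverWeight β ε (lift 0 w) ≤
        ENNReal.ofReal (Real.pi * (1 / (1 - ε) + 1 / ε)) ^ 2 * coverWeight β ε (lift 0 z) := by
    intro ε hε hε1 z hz
    rw [← coverMajorant_lift (f := fun w => coverWeight β ε (lift 0 w))
      ((measurable_coverWeight β ε).comp (measurable_lift 0))]
    refine le_trans (le_of_eq ?_) (lintegral_coverKernel_mul_le hε hε1 (lift_mem 0 hz))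
    refine setLIntegral_congr_fun (measurableSet_coverDomain β) fun m _ => ?_
    congr 1
    -- The weight depends only on imaginary parts, so it is constant along the fibres of the
    -- covering and the estimate on the cover descends.
    have him : (liftSnd 0 (coverMap m).2).im = m.2.im := by
      rw [liftSnd_im, coverMap, log_norm_exp_sq]
    simp only [coverWeight, lift, Complex.sub_im, him]
    simp [coverMap]
  have hm : Measurable h := (measurable_coverWeight β _).comp (measurable_lift 0)
  refine lintegral_rpow_lintegral_le_of_schur hpq (measurable_wormKernelMajorant β) hm ?_ ?_ ?_ hf
  · filter_upwards [ae_restrict_mem (measurableSet_wormDomain β)] with z hz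
    exact coverWeight_ne (lift_mem 0 hz)
  · filter_upwards [ae_restrict_mem (measurableSet_wormDomain β)] with z hz
    rw [hhq z hz, setLIntegral_congr_fun (measurableSet_wormDomain β)
      (fun w hw => by rw [hhq w hw])]
    exact key _ (by positivity) hpi1 z hz
  · filter_upwards [ae_restrict_mem (measurableSet_wormDomain β)] with w hw
    rw [hhp w hw]
    calc _ ≤ ∫⁻ z in wormDomain β, ENNReal.ofReal (Real.exp (2 * (β - Real.pi / 2))) *
          (wormKernelMajorant β w z * coverWeight β (1 / q) (lift 0 z)) := by
          refine setLIntegral_mono' (measurableSet_wormDomain β) fun z hz => ?_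
          rw [hhp z hz, ← mul_assoc]
          gcongr
          exact wormKernelMajorant_le_swap hz hw
      _ ≤ _ := by
          rw [lintegral_const_mul' _ _ ENNReal.ofReal_ne_top, mul_assoc]
          gcongr
          exact key _ (by positivity) hqi1 w hw

/-- Harnack inequality for the Bergman kernel on the cover. -/
lemma exists_coverKernel_comparable {β : ℝ} {m₀ : ℂ × ℂ} (hm₀ : m₀ ∈ coverDomain β) :
    ∃ r > 0, Metric.ball m₀ r ⊆ coverDomain β ∧ ∀ m ∈ Metric.ball m₀ r, ∀ m' ∈ coverDomain β,
      ‖coverKernel β m m'‖ ≤ 16 * ‖coverKernel β m₀ m'‖ ∧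
      ‖coverKernel β m₀ m'‖ ≤ 16 * ‖coverKernel β m m'‖ := by
  obtain ⟨r₁, hr₁, hs₁, h₁⟩ := exists_stripKernel_comparable hm₀.1
  obtain ⟨r₂, hr₂, hs₂, h₂⟩ := exists_stripKernel_comparable hm₀.2
  have hsub : ∀ m ∈ Metric.ball m₀ (min r₁ r₂), m.1 ∈ Metric.ball m₀.1 r₁ ∧
      m.2 ∈ Metric.ball m₀.2 r₂ := by
    intro m hm
    rw [Metric.mem_ball, Prod.dist_eq, max_lt_iff, lt_min_iff, lt_min_iff] at hm
    exact ⟨hm.1.1, hm.2.2⟩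
  refine ⟨min r₁ r₂, lt_min hr₁ hr₂, fun m hm => ⟨hs₁ (hsub m hm).1, hs₂ (hsub m hm).2⟩,
    fun m hm m' hm' => ?_⟩
  obtain ⟨a₁, a₂⟩ := h₁ _ (hsub m hm).1 _ hm'.1
  obtain ⟨b₁, b₂⟩ := h₂ _ (hsub m hm).2 _ hm'.2
  simp only [coverKernel, norm_mul]
  constructor
  · calc _ ≤ (4 * _) * (4 * _) := mul_le_mul a₁ b₁ (norm_nonneg _) (by positivity)
      _ = _ := by ring
  · calc _ ≤ (4 * _) * (4 * _) := mul_le_mul a₂ b₂ (norm_nonneg _) (by positivity)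
      _ = _ := by ring

lemma coverMajorant_le_of_kernel_le {β : ℝ} {m m₀ : ℂ × ℂ}
    (h : ∀ m' ∈ coverDomain β, ‖coverKernel β m m'‖ ≤ 16 * ‖coverKernel β m₀ m'‖)
    (f : ℂ × ℂ → ℝ≥0∞) : coverMajorant β f m ≤ 16 * coverMajorant β f m₀ := by
  rw [coverMajorant, coverMajorant, ← lintegral_const_mul' _ _ (by simp)]
  refine setLIntegral_mono' (measurableSet_coverDomain β) fun m' hm' => ?_
  rw [← mul_assoc]
  gcongr
  have := ENNReal.ofReal_le_ofReal (h m' hm')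
  rwa [ENNReal.ofReal_mul (by norm_num), ofReal_norm, ofReal_norm, ENNReal.ofReal_ofNat] at this

/-- By unfolding, the preimage of a null set is a countable union of null pieces. Infinitely many
sheets rule out preservation of measure, but this suffices to pull back almost everywhere
statements. -/
lemma quasiMeasurePreserving_coverMap (β : ℝ) : Measure.QuasiMeasurePreserving coverMap
    (volume.restrict (coverDomain β)) (vol (wormDomain β)) := by
  refine ⟨continuous_coverMap.measurable, Measure.AbsolutelyContinuous.mk fun s hs h0 => ?_⟩
  rw [Measure.map_apply continuous_coverMap.measurable hs,
    ← lintegral_indicator_one (continuous_coverMap.measurable hs),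
    lintegral_coverDomain_eq (measurable_one.indicator (continuous_coverMap.measurable hs))]
  have : ∀ᵐ w ∂(vol (wormDomain β)), w ∉ s := by
    rwa [ae_iff, show {a | ¬ a ∉ s} = s by ext; simp]
  rw [← lintegral_zero (μ := vol (wormDomain β))]
  refine lintegral_congr_ae ?_
  filter_upwards [this, ae_restrict_mem (measurableSet_wormDomain β)] with w hw hwD
  rw [ENNReal.tsum_eq_zero]
  intro n
  rw [indicator_of_notMem, zero_mul]
  rwa [mem_preimage, coverMap_lift n hwD.1]

lemma coverMajorant_congr {β : ℝ} {f g : ℂ × ℂ → ℝ≥0∞} (h : f =ᵐ[vol (wormDomain β)] g)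
    (m : ℂ × ℂ) : coverMajorant β f m = coverMajorant β g m := by
  refine lintegral_congr_ae ?_
  filter_upwards [(quasiMeasurePreserving_coverMap β).ae h] with m' hm'
  rw [hm']

/-- The operator on the cover with the Bergman kernel of the product of strips, acting on lifts of
functions on the worm domain. -/
def coverOp (β : ℝ) (F : ℂ × ℂ → ℂ) (m : ℂ × ℂ) : ℂ :=
  ∫ m' in coverDomain β, coverKernel β m m' * F (coverMap m')

lemma coverOp_congr {β : ℝ} {F G : ℂ × ℂ → ℂ} (h : F =ᵐ[vol (wormDomain β)] G) :
    coverOp β F = coverOp β G := by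
  ext m
  refine integral_congr_ae ?_
  filter_upwards [(quasiMeasurePreserving_coverMap β).ae h] with m' hm'
  rw [hm']

lemma aestronglyMeasurable_coverKernel_mul {β : ℝ} {F : ℂ × ℂ → ℂ}
    (hF : AEStronglyMeasurable F (vol (wormDomain β))) (m : ℂ × ℂ) :
    AEStronglyMeasurable (fun m' => coverKernel β m m' * F (coverMap m'))
      (volume.restrict (coverDomain β)) :=
  ((measurable_coverKernel β).comp (measurable_const.prodMk measurable_id)).aestronglyMeasurable.mul
    (hF.comp_quasiMeasurePreserving (quasiMeasurePreserving_coverMap β))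

/-- The projection operator on the worm domain, with respect to the measure `|z₂|⁻² dV`. -/
def wormOp (β : ℝ) (F : ℂ × ℂ → ℂ) (z : ℂ × ℂ) : ℂ := coverOp β F (lift 0 z)

lemma enorm_coverOp_le (β : ℝ) (F : ℂ × ℂ → ℂ) (m : ℂ × ℂ) :
    ‖coverOp β F m‖ₑ ≤ coverMajorant β (fun z => ‖F z‖ₑ) m := by
  refine (enorm_integral_le_lintegral_enorm _).trans_eq ?_
  simp_rw [enorm_mul]
  rfl

/-- `L^p` bound for the majorant of the projection operator. -/
lemma exists_eLpNorm_coverMajorant_le (β : ℝ) {p : ℝ≥0∞} (hp1 : 1 < p) (hp2 : p < ⊤) :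
    ∃ C : NNReal, ∀ F : ℂ × ℂ → ℂ, AEStronglyMeasurable F (vol (wormDomain β)) →
      eLpNorm (fun z => coverMajorant β (fun z => ‖F z‖ₑ) (lift 0 z)) p (vol (wormDomain β)) ≤
        C * eLpNorm F p (vol (wormDomain β)) := by
  have hp : 1 < p.toReal := by
    rw [← ENNReal.toReal_one]
    exact (ENNReal.toReal_lt_toReal ENNReal.one_ne_top hp2.ne).2 hp1
  have hp0 : 0 < p.toReal := by linarith
  obtain ⟨C, hC, h⟩ := exists_lintegral_coverMajorant_le β hp
  have hC' : C ^ (1 / p.toReal) ≠ ⊤ := ENNReal.rpow_ne_top_of_nonneg (by positivity) hC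
  refine ⟨(C ^ (1 / p.toReal)).toNNReal, fun F hF => ?_⟩
  rw [ENNReal.coe_toNNReal hC']
  have hae := hF.ae_eq_mk
  rw [eLpNorm_congr_ae hae, eLpNorm_eq_lintegral_rpow_enorm_toReal (by positivity) hp2.ne,
    eLpNorm_eq_lintegral_rpow_enorm_toReal (by positivity) hp2.ne,
    ← ENNReal.mul_rpow_of_nonneg _ _ (by positivity)]
  gcongr
  refine le_trans (le_of_eq ?_) (h (fun z => ‖hF.mk F z‖ₑ) hF.stronglyMeasurable_mk.enorm)
  refine lintegral_congr fun z => ?_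
  rw [coverMajorant_congr (hae.mono fun z hz => congrArg enorm hz)]
  rfl

/-! ### Symmetries -/

instance : (volume : Measure (ℂ × ℂ)).IsAddHaarMeasure :=
  inferInstanceAs ((volume : Measure ℂ).prod (volume : Measure ℂ)).IsAddHaarMeasure

/-- A one-parameter group of symmetries of the worm domain. -/
def flow (c₁ c₂ t : ℝ) (z : ℂ × ℂ) : ℂ × ℂ :=
  (z.1 + (t * c₁ : ℝ), z.2 * Complex.exp ((t * c₂ : ℝ) * Complex.I))

/-- The translations which lift the symmetries to the cover. -/
def flowShift (c₁ c₂ t : ℝ) : ℂ × ℂ := ((t * (c₁ + 2 * c₂) : ℝ), (-(2 * (t * c₂)) : ℝ))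

/-- Rotating z₂ by the angle tc₂ shifts v by -2tc₂; the first component of the shift compensates for
this in z₁ = u + v. Thus symmetries lift to real translations, the source of all commutation
relations below. -/
lemma coverMap_add_flowShift (c₁ c₂ t : ℝ) (m : ℂ × ℂ) :
    coverMap (m + flowShift c₁ c₂ t) = flow c₁ c₂ t (coverMap m) := by
  simp only [coverMap, flowShift, flow, Prod.fst_add, Prod.snd_add]
  refine Prod.ext ?_ ?_
  · push_cast; ring
  · simp only []
    rw [← Complex.exp_add]
    congr 1
    push_cast
    ring

lemma add_flowShift_mem_iff {β : ℝ} (c₁ c₂ t : ℝ) {m : ℂ × ℂ} :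
    m + flowShift c₁ c₂ t ∈ coverDomain β ↔ m ∈ coverDomain β := by
  simp [coverDomain, strip, flowShift, -Complex.ofReal_mul, -Complex.ofReal_neg]

lemma coverKernel_add_flowShift (β c₁ c₂ t : ℝ) (m m' : ℂ × ℂ) :
    coverKernel β (m + flowShift c₁ c₂ t) (m' + flowShift c₁ c₂ t) = coverKernel β m m' := by
  simp only [coverKernel, flowShift, Prod.fst_add, Prod.snd_add, map_add, Complex.conj_ofReal]
  congr 2 <;> ring

lemma measurePreserving_add_flowShift (β c₁ c₂ t : ℝ) :
    MeasurePreserving (fun m => m + flowShift c₁ c₂ t) (volume.restrict (coverDomain β))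
      (volume.restrict (coverDomain β)) := by
  have h := (measurePreserving_add_right (volume : Measure (ℂ × ℂ)) (flowShift c₁ c₂ t)).restrict_preimage
    (measurableSet_coverDomain β)
  rwa [show (fun m => m + flowShift c₁ c₂ t) ⁻¹' coverDomain β = coverDomain β from
    Set.ext fun m => add_flowShift_mem_iff c₁ c₂ t] at h

lemma coverMajorant_add_flowShift (β c₁ c₂ t : ℝ) (f : ℂ × ℂ → ℝ≥0∞) (m : ℂ × ℂ) :
    coverMajorant β f (m + flowShift c₁ c₂ t) = coverMajorant β (fun z => f (flow c₁ c₂ t z)) m := by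
  rw [coverMajorant, ← (measurePreserving_add_flowShift β c₁ c₂ t).lintegral_comp_emb
    (measurableEmbedding_addRight _)]
  simp_rw [coverKernel_add_flowShift, coverMap_add_flowShift]
  rfl

lemma coverOp_add_flowShift (β c₁ c₂ t : ℝ) (F : ℂ × ℂ → ℂ) (m : ℂ × ℂ) :
    coverOp β F (m + flowShift c₁ c₂ t) = coverOp β (fun z => F (flow c₁ c₂ t z)) m := by
  rw [coverOp, ← (measurePreserving_add_flowShift β c₁ c₂ t).integral_comp
    (measurableEmbedding_addRight _)]
  simp_rw [coverKernel_add_flowShift, coverMap_add_flowShift]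
  rfl

/-- Full turns act trivially below while their lifts are the deck transformations, so invariance
under `flowShift` includes deck invariance. -/
lemma flow_two_pi (n : ℤ) (z : ℂ × ℂ) : flow 0 (2 * Real.pi) n z = z := by
  have : ((n * (2 * Real.pi) : ℝ) * Complex.I : ℂ) = n * (2 * Real.pi * Complex.I) := by
    push_cast; ring
  rw [flow, this, Complex.exp_int_mul_two_pi_mul_I]
  simp

lemma exists_lift_coverMap (m : ℂ × ℂ) :
    ∃ n : ℤ, lift 0 (coverMap m) = m + flowShift 0 (2 * Real.pi) n := by
  have h0 : Complex.exp (-(Complex.I * m.2 / 2)) ≠ 0 := Complex.exp_ne_zero _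
  obtain ⟨n, hn⟩ := Complex.exp_eq_exp_iff_exists_int.1 (Complex.exp_log h0)
  refine ⟨n, ?_⟩
  have e : liftSnd 0 (coverMap m).2 = m.2 - 4 * Real.pi * n := by
    rw [liftSnd, coverMap]
    simp only []
    rw [hn]
    push_cast
    linear_combination (-m.2 + 4 * Real.pi * n) * Complex.I_mul_I
  refine Prod.ext ?_ ?_
  · simp only [lift, e, flowShift, Prod.fst_add]
    simp only [coverMap]
    push_cast
    ring
  · simp only [lift, e, flowShift, Prod.snd_add]
    push_cast
    ring

lemma coverMajorant_lift_coverMap (β : ℝ) (f : ℂ × ℂ → ℝ≥0∞) (m : ℂ × ℂ) :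
    coverMajorant β f (lift 0 (coverMap m)) = coverMajorant β f m := by
  obtain ⟨n, hn⟩ := exists_lift_coverMap m
  rw [hn, coverMajorant_add_flowShift]
  simp_rw [flow_two_pi]

/-- `lift 0` uses the principal logarithm and may land on a sheet other than that of m; deck
invariance makes the choice, and the jump along the cut, irrelevant. -/
lemma wormOp_coverMap (β : ℝ) (F : ℂ × ℂ → ℂ) (m : ℂ × ℂ) :
    wormOp β F (coverMap m) = coverOp β F m := by
  obtain ⟨n, hn⟩ := exists_lift_coverMap m
  rw [wormOp, hn, coverOp_add_flowShift]
  simp_rw [flow_two_pi]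

/-! ### Absolute convergence at every point of the cover. -/

lemma coverMajorant_lt_top {β : ℝ} {p : ℝ≥0∞} (hp1 : 1 < p) (hp2 : p < ⊤) {F : ℂ × ℂ → ℂ}
    (hF : MemLp F p (vol (wormDomain β))) {m : ℂ × ℂ} (hm : m ∈ coverDomain β) :
    coverMajorant β (fun z => ‖F z‖ₑ) m < ⊤ := by
  obtain ⟨C, hC⟩ := exists_eLpNorm_coverMajorant_le β hp1 hp2
  have hp0 : p ≠ 0 := (zero_lt_one.trans hp1).ne'
  have h1 := (hC F hF.1).trans_lt (ENNReal.mul_lt_top ENNReal.coe_lt_top hF.2)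
  have h2 : ∀ᵐ z ∂(vol (wormDomain β)), coverMajorant β (fun z => ‖F z‖ₑ) (lift 0 z) < ⊤ := by
    set f : ℂ × ℂ → ℝ≥0∞ := fun z => ‖hF.1.mk F z‖ₑ
    have e : ∀ m, coverMajorant β (fun z => ‖F z‖ₑ) m = coverMajorant β f m :=
      coverMajorant_congr (hF.1.ae_eq_mk.mono fun z hz => congrArg enorm hz)
    have hf : Measurable f := hF.1.stronglyMeasurable_mk.enorm
    simp_rw [e] at h1 ⊢
    have hm : Measurable fun z => coverMajorant β f (lift 0 z) := by
      simp_rw [coverMajorant_lift hf]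
      have hk : Measurable fun q : (ℂ × ℂ) × (ℂ × ℂ) => wormKernelMajorant β q.1 q.2 :=
        measurable_wormKernelMajorant β
      exact Measurable.lintegral_prod_right' (hk.mul (hf.comp measurable_snd))
    rw [eLpNorm_eq_lintegral_rpow_enorm_toReal hp0 hp2.ne] at h1
    have hpr := ENNReal.toReal_pos hp0 hp2.ne
    have h3 := ae_lt_top (hm.enorm.pow_const p.toReal)
      ((ENNReal.rpow_lt_top_iff_of_pos (by positivity)).1 h1).ne
    filter_upwards [h3] with z hz
    simpa using (ENNReal.rpow_lt_top_iff_of_pos hpr).1 hz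
  have h3 := (quasiMeasurePreserving_coverMap β).ae h2
  simp_rw [coverMajorant_lift_coverMap] at h3
  obtain ⟨r, hr, hsub, hcmp⟩ := exists_coverKernel_comparable hm
  have h4 : (volume.restrict (coverDomain β)) (Metric.ball m r) ≠ 0 := by
    rw [Measure.restrict_apply Metric.isOpen_ball.measurableSet, inter_eq_self_of_subset_left hsub]
    exact (Metric.measure_ball_pos volume m hr).ne'
  -- The L^p bound only gives finiteness almost everywhere; a ball has positive measure, so it
  -- contains a good point, and Harnack carries finiteness from there to m.
  obtain ⟨m₁, hm₁, hfin⟩ : ∃ m₁ ∈ Metric.ball m r, coverMajorant β (fun z => ‖F z‖ₑ) m₁ < ⊤ := by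
    by_contra! hcon
    apply h4
    refine measure_mono_null (fun x hx => ?_) h3
    exact not_lt.2 (hcon x hx)
  exact (coverMajorant_le_of_kernel_le (fun m' hm' => (hcmp m₁ hm₁ m' hm').2) _).trans_lt
    (ENNReal.mul_lt_top (by simp) hfin)

lemma integrableOn_coverKernel_mul {β : ℝ} {p : ℝ≥0∞} (hp1 : 1 < p) (hp2 : p < ⊤) {F : ℂ × ℂ → ℂ}
    (hF : MemLp F p (vol (wormDomain β))) {m : ℂ × ℂ} (hm : m ∈ coverDomain β) :
    IntegrableOn (fun m' => coverKernel β m m' * F (coverMap m')) (coverDomain β) := by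
  refine ⟨aestronglyMeasurable_coverKernel_mul hF.1 m, ?_⟩
  have := coverMajorant_lt_top hp1 hp2 hF hm
  refine lt_of_le_of_lt (le_of_eq ?_) this
  exact lintegral_congr fun m' => enorm_mul _ _

/-! ### Holomorphy -/

/-- Cauchy's estimate in Schwarz form. The factor 2 appears because oscillation is measured from f
x. -/
lemma norm_fderiv_le_of_forall_ball {E : Type*} [NormedAddCommGroup E] [NormedSpace ℂ E] {f : E → ℂ}
    {x : E} {r B : ℝ} (hr : 0 < r) (hf : DifferentiableOn ℂ f (Metric.ball x r))
    (hB : ∀ y ∈ Metric.ball x r, ‖f y‖ ≤ B) : ‖fderiv ℂ f x‖ ≤ 2 * B / r := by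
  refine Complex.norm_fderiv_le_div_of_mapsTo_ball hf (fun y hy => ?_) hr
  rw [mem_closedBall_iff_norm]
  calc _ ≤ ‖f y‖ + ‖f x‖ := norm_sub_le _ _
    _ ≤ B + B := add_le_add (hB y hy) (hB x (Metric.mem_ball_self hr))
    _ = 2 * B := by ring

/-- A locally dominated integral of holomorphic functions is holomorphic. -/
lemma differentiableAt_integral_of_dominated {α : Type*} [MeasurableSpace α] {μ : Measure α}
    {F : ℂ × ℂ → α → ℂ} {x₀ : ℂ × ℂ} {r : ℝ} (hr : 0 < r) {bound : α → ℝ}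
    (hmeas : ∀ x ∈ Metric.ball x₀ r, AEStronglyMeasurable (F x) μ)
    (hdiff : ∀ᵐ a ∂μ, DifferentiableOn ℂ (F · a) (Metric.ball x₀ r))
    (hb : ∀ᵐ a ∂μ, ∀ x ∈ Metric.ball x₀ r, ‖F x a‖ ≤ bound a) (hint : Integrable bound μ) :
    DifferentiableAt ℂ (fun x => ∫ a, F x a ∂μ) x₀ := by
  have hx₀ : x₀ ∈ Metric.ball x₀ r := Metric.mem_ball_self hr
  have hdir : ∀ v : ℂ × ℂ, ‖v‖ ≤ 1 →
      AEStronglyMeasurable (fun a => fderiv ℂ (F · a) x₀ v) μ := by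
    intro v hv
    -- Measurability of the derivative in the parameter is obtained by writing it as a limit of
    -- difference quotients along this sequence.
    set t : ℕ → ℂ := fun n => ((r / 2 / (n + 1) : ℝ) : ℂ) with ht
    have htr : ∀ n : ℕ, ‖t n‖ < r := by
      intro n
      rw [ht, Complex.norm_real, Real.norm_of_nonneg (by positivity)]
      calc r / 2 / ((n : ℝ) + 1) ≤ r / 2 := div_le_self (by positivity) (by linarith [n.cast_nonneg (α := ℝ)])
        _ < r := by linarith
    have ht0 : ∀ n, t n ≠ 0 := fun n =>
      Complex.ofReal_ne_zero.2 (by positivity)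
    have hmem : ∀ n, x₀ + t n • v ∈ Metric.ball x₀ r := by
      intro n
      rw [mem_ball_iff_norm, add_sub_cancel_left, norm_smul]
      exact (mul_le_of_le_one_right (norm_nonneg _) hv).trans_lt (htr n)
    have hlim : Filter.Tendsto t Filter.atTop (nhds 0) := by
      have : Filter.Tendsto (fun n : ℕ => r / 2 / ((n : ℝ) + 1)) Filter.atTop (nhds 0) :=
        tendsto_const_div_atTop_nhds_zero_nat (r / 2) |>.comp (Filter.tendsto_add_atTop_nat 1) |>.congr
          fun n => by simp
      have h0 := (Complex.continuous_ofReal.tendsto 0).comp this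
      rwa [Complex.ofReal_zero] at h0
    refine aestronglyMeasurable_of_tendsto_ae Filter.atTop
      (f := fun n a => (t n)⁻¹ • (F (x₀ + t n • v) a - F x₀ a))
      (fun n => ((hmeas _ (hmem n)).sub (hmeas _ hx₀)).const_smul (t n)⁻¹) ?_
    filter_upwards [hdiff] with a ha
    have h1 := ((ha x₀ hx₀).differentiableAt (Metric.ball_mem_nhds x₀ hr)).hasFDerivAt.hasLineDerivAt v
    have h2 := hasDerivAt_iff_tendsto_slope_zero.1 h1
    have h3 : Filter.Tendsto t Filter.atTop (nhdsWithin 0 {0}ᶜ) :=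
      tendsto_nhdsWithin_iff.2 ⟨hlim, Filter.Eventually.of_forall ht0⟩
    refine (h2.comp h3).congr fun n => ?_
    simp
  have hF' : AEStronglyMeasurable (fun a => fderiv ℂ (F · a) x₀) μ := by
    have e : (fun a => fderiv ℂ (F · a) x₀) = fun a =>
        fderiv ℂ (F · a) x₀ (1, 0) • ContinuousLinearMap.fst ℂ ℂ ℂ +
          fderiv ℂ (F · a) x₀ (0, 1) • ContinuousLinearMap.snd ℂ ℂ ℂ := by
      ext a <;> simp
    rw [e]
    exact ((hdir (1, 0) (by simp)).smul_const _).add ((hdir (0, 1) (by simp)).smul_const _)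
  -- Halving the radius leaves room for Cauchy estimates that are uniform in the centre.
  have hball : ∀ x ∈ Metric.ball x₀ (r / 2), Metric.ball x (r / 2) ⊆ Metric.ball x₀ r := by
    intro x hx
    apply Metric.ball_subset_ball'
    have := Metric.mem_ball.1 hx
    linarith
  refine (hasFDerivAt_integral_of_dominated_of_fderiv_le (𝕜 := ℂ)
    (F' := fun x a => fderiv ℂ (F · a) x) (bound := fun a => 2 * bound a / (r / 2))
    (Metric.ball_mem_nhds x₀ (half_pos hr)) ?_ ?_ hF' ?_ ?_ ?_).differentiableAt
  · filter_upwards [Metric.ball_mem_nhds x₀ hr] with x hx using hmeas x hx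
  · exact hint.mono' (hmeas x₀ hx₀) (hb.mono fun a ha => ha x₀ hx₀)
  · filter_upwards [hdiff, hb] with a ha hba x hx
    exact norm_fderiv_le_of_forall_ball (half_pos hr) (ha.mono (hball x hx))
      fun y hy => hba y (hball x hx hy)
  · exact (hint.const_mul 2).div_const _
  · filter_upwards [hdiff] with a ha x hx
    have hx' := hball x hx (Metric.mem_ball_self (half_pos hr))
    exact ((ha x hx').differentiableAt (Metric.isOpen_ball.mem_nhds hx')).hasFDerivAt

lemma differentiableAt_coverKernel {β : ℝ} {m m' : ℂ × ℂ} (hm : m ∈ coverDomain β)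
    (hm' : m' ∈ coverDomain β) : DifferentiableAt ℂ (fun m => coverKernel β m m') m := by
  have h1 := (differentiableAt_stripKernel hm.1 hm'.1).comp m differentiableAt_fst
  have h2 := (differentiableAt_stripKernel hm.2 hm'.2).comp m differentiableAt_snd
  exact h1.mul h2

/-- By Harnack, 16 times the modulus of the integrand at m dominates the integrand at all nearby
points. -/
lemma differentiableAt_coverOp {β : ℝ} {p : ℝ≥0∞} (hp1 : 1 < p) (hp2 : p < ⊤) {F : ℂ × ℂ → ℂ}
    (hF : MemLp F p (vol (wormDomain β))) {m : ℂ × ℂ} (hm : m ∈ coverDomain β) :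
    DifferentiableAt ℂ (coverOp β F) m := by
  obtain ⟨r, hr, hsub, hcmp⟩ := exists_coverKernel_comparable hm
  refine differentiableAt_integral_of_dominated hr
    (bound := fun m' => 16 * ‖coverKernel β m m' * F (coverMap m')‖)
    (fun x hx => aestronglyMeasurable_coverKernel_mul hF.1 x) ?_ ?_
    ((integrableOn_coverKernel_mul hp1 hp2 hF hm).norm.const_mul 16)
  · filter_upwards [ae_restrict_mem (measurableSet_coverDomain β)] with m' hm' x hx
    exact ((differentiableAt_coverKernel (hsub hx) hm').mul_const _).differentiableWithinAt
  · filter_upwards [ae_restrict_mem (measurableSet_coverDomain β)] with m' hm' x hx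
    rw [norm_mul, norm_mul, ← mul_assoc]
    gcongr
    exact (hcmp x hx m' hm').1

/-- `wormOp` maps `L^p` functions to holomorphic functions. -/
lemma differentiableAt_wormOp {β : ℝ} {p : ℝ≥0∞} (hp1 : 1 < p) (hp2 : p < ⊤) {F : ℂ × ℂ → ℂ}
    (hF : MemLp F p (vol (wormDomain β))) {z : ℂ × ℂ} (hz : z ∈ wormDomain β) :
    DifferentiableAt ℂ (wormOp β F) z := by
  have hz2 : z.2 ≠ 0 := hz.1
  -- A branch of the lift that is holomorphic near z₂ even when z₂ lies on the cut of the principal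
  -- logarithm.
  set L : ℂ → ℂ := fun w => 2 * Complex.I * (Complex.log z.2 + Complex.log (w / z.2)) with hL
  set s : ℂ × ℂ → ℂ × ℂ := fun w => (w.1 - L w.2, L w.2) with hs
  have hLd : DifferentiableAt ℂ L z.2 := by
    have h1 : z.2 / z.2 ∈ Complex.slitPlane := by rw [div_self hz2]; exact Complex.one_mem_slitPlane
    have : DifferentiableAt ℂ (fun w => Complex.log (w / z.2)) z.2 :=
      (differentiableAt_id.div_const z.2).clog h1
    exact (this.const_add _).const_mul _
  have hsd : DifferentiableAt ℂ s z := by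
    have h2 : DifferentiableAt ℂ (fun w : ℂ × ℂ => L w.2) z := hLd.comp z differentiableAt_snd
    exact (differentiableAt_fst.sub h2).prodMk h2
  have hcov : ∀ w : ℂ × ℂ, w.2 ≠ 0 → coverMap (s w) = w := by
    intro w hw
    have : -(Complex.I * L w.2 / 2) = Complex.log z.2 + Complex.log (w.2 / z.2) := by
      rw [hL]
      linear_combination (-(Complex.log z.2 + Complex.log (w.2 / z.2))) * Complex.I_mul_I
    simp only [coverMap, hs, this]
    rw [Complex.exp_add, Complex.exp_log hz2, Complex.exp_log (div_ne_zero hw hz2),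
      mul_div_cancel₀ _ hz2]
    simp
  have hsz : s z ∈ coverDomain β := by rw [← coverMap_mem_iff, hcov z hz2]; exact hz
  have hcomp := (differentiableAt_coverOp hp1 hp2 hF hsz).comp z hsd
  refine hcomp.congr_of_eventuallyEq ?_
  filter_upwards [(isOpen_wormDomain β).mem_nhds hz] with w hw
  rw [Function.comp_apply, ← wormOp_coverMap, hcov w hw.1]

lemma differentiableOn_wormOp {β : ℝ} {p : ℝ≥0∞} (hp1 : 1 < p) (hp2 : p < ⊤) {F : ℂ × ℂ → ℂ}
    (hF : MemLp F p (vol (wormDomain β))) : DifferentiableOn ℂ (wormOp β F) (wormDomain β) :=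
  fun _ hz => (differentiableAt_wormOp hp1 hp2 hF hz).differentiableWithinAt

/-- `wormOp` is bounded on `L^p`. -/
lemma exists_eLpNorm_wormOp_le (β : ℝ) {p : ℝ≥0∞} (hp1 : 1 < p) (hp2 : p < ⊤) :
    ∃ C : NNReal, ∀ F : ℂ × ℂ → ℂ, MemLp F p (vol (wormDomain β)) →
      MemLp (wormOp β F) p (vol (wormDomain β)) ∧
      eLpNorm (wormOp β F) p (vol (wormDomain β)) ≤ C * eLpNorm F p (vol (wormDomain β)) := by
  obtain ⟨C, hC⟩ := exists_eLpNorm_coverMajorant_le β hp1 hp2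
  refine ⟨C, fun F hF => ?_⟩
  have h1 : eLpNorm (wormOp β F) p (vol (wormDomain β)) ≤ C * eLpNorm F p (vol (wormDomain β)) :=
    (eLpNorm_mono_enorm fun z => enorm_coverOp_le β F (lift 0 z)).trans (hC F hF.1)
  exact ⟨⟨(differentiableOn_wormOp hp1 hp2 hF).continuousOn.aestronglyMeasurable
    (measurableSet_wormDomain β), h1.trans_lt (ENNReal.mul_lt_top ENNReal.coe_lt_top hF.2)⟩, h1⟩

/-! ### The Bergman projection -/

/-- `wormOp` reproduces holomorphic `L^p` functions. -/
lemma wormOp_eq_self {β : ℝ} {p : ℝ≥0∞} (hp1 : 1 < p) (hp2 : p < ⊤) {F : ℂ × ℂ → ℂ}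
    (hF : MemLp F p (vol (wormDomain β))) (hFd : DifferentiableOn ℂ F (wormDomain β))
    {z : ℂ × ℂ} (hz : z ∈ wormDomain β) : wormOp β F z = F z := by
  have hm := lift_mem 0 hz
  set m := lift 0 z with hmdef
  have hmz : coverMap m = z := coverMap_lift 0 hz.1
  have hlift : ∀ m' ∈ coverDomain β, DifferentiableAt ℂ (fun m => F (coverMap m)) m' := by
    intro m' hm'
    have h1 : DifferentiableAt ℂ F (coverMap m') :=
      (hFd _ (coverMap_mem_iff.2 hm')).differentiableAt
        ((isOpen_wormDomain β).mem_nhds (coverMap_mem_iff.2 hm'))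
    have h2 : DifferentiableAt ℂ coverMap m' := by unfold coverMap; fun_prop
    exact h1.comp m' h2
  have hint := integrableOn_coverKernel_mul hp1 hp2 hF hm
  rw [wormOp, coverOp]
  rw [IntegrableOn, coverDomain, Measure.volume_eq_prod, ← Measure.prod_restrict] at hint
  rw [coverDomain, Measure.volume_eq_prod, ← Measure.prod_restrict, integral_prod_symm _ hint]
  -- The one-variable reproducing property is applied in u for almost every fixed v, then in v;
  -- Fubini supplies both integrability conditions.
  have hinner : ∀ᵐ v ∂(volume.restrict (strip (β - Real.pi / 2))),
      ∫ u in strip (Real.pi / 2), coverKernel β m (u, v) * F (coverMap (u, v)) =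
        stripKernel (β - Real.pi / 2) (m.2 - (starRingEnd ℂ) v) * F (coverMap (m.1, v)) := by
    filter_upwards [hint.prod_left_ae, ae_restrict_mem (measurableSet_strip _)] with v hv hvs
    simp only [coverKernel, mul_assoc] at hv ⊢
    refine setIntegral_stripKernel_mul hm.1 (H := fun u =>
      stripKernel (β - Real.pi / 2) (m.2 - (starRingEnd ℂ) v) * F (coverMap (u, v)))
      (fun u hu => ?_) hv
    exact (((hlift (u, v) ⟨hu, hvs⟩).comp (g := fun m => F (coverMap m)) (f := fun u => (u, v)) u
      (differentiableAt_id.prodMk (differentiableAt_const v))).const_mul _).differentiableWithinAt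
  rw [integral_congr_ae hinner, setIntegral_stripKernel_mul hm.2
    (H := fun v => F (coverMap (m.1, v))) (fun v hv => ?_) (hint.integral_prod_right.congr hinner)]
  · exact congrArg F hmz
  · exact ((hlift (m.1, v) ⟨hm.1, hv⟩).comp (g := fun m => F (coverMap m)) (f := fun v => (m.1, v)) v
      ((differentiableAt_const m.1).prodMk differentiableAt_id)).differentiableWithinAt

/-! ### Symmetry of the operator for the weighted measure. -/

lemma coverDensity_le {β : ℝ} {z : ℂ × ℂ} (hz : z ∈ wormDomain β) :
    ENNReal.ofReal (4 / ‖z.2‖ ^ 2) ≤ ENNReal.ofReal (4 * Real.exp (β - Real.pi / 2)) := by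
  have h0 : 0 < ‖z.2‖ ^ 2 := by have := norm_pos_iff.2 hz.1; positivity
  have h1 := (Real.le_log_iff_exp_le h0).1 (abs_lt.1 hz.2.2).1.le
  apply ENNReal.ofReal_le_ofReal
  rw [div_le_iff₀ h0, mul_assoc]
  have := mul_le_mul_of_nonneg_left h1 (Real.exp_pos (β - Real.pi / 2)).le
  rw [← Real.exp_add, add_neg_cancel, Real.exp_zero] at this
  linarith

lemma coverVol_absolutelyContinuous (β : ℝ) : coverVol β ≪ vol (wormDomain β) :=
  withDensity_absolutelyContinuous _ _

lemma lintegral_coverVol_lt_top {β : ℝ} {f : ℂ × ℂ → ℝ≥0∞}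
    (h : ∫⁻ z in wormDomain β, f z < ⊤) : ∫⁻ z, f z ∂(coverVol β) < ⊤ := by
  rw [coverVol, lintegral_withDensity_eq_lintegral_mul_non_measurable _ measurable_coverDensity
    (Filter.Eventually.of_forall fun _ => ENNReal.ofReal_lt_top)]
  calc _ ≤ ∫⁻ z in wormDomain β, ENNReal.ofReal (4 * Real.exp (β - Real.pi / 2)) * f z :=
        setLIntegral_mono' (measurableSet_wormDomain β) fun z hz =>
          mul_le_mul' (coverDensity_le hz) le_rfl
    _ < ⊤ := by
        rw [lintegral_const_mul' _ _ ENNReal.ofReal_ne_top]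
        exact ENNReal.mul_lt_top ENNReal.ofReal_lt_top h

lemma measurable_coverKernel_comp {α : Type*} [MeasurableSpace α] {β : ℝ} {f g : α → ℂ × ℂ}
    (hf : Measurable f) (hg : Measurable g) : Measurable fun a => coverKernel β (f a) (g a) :=
  Measurable.comp (g := fun q : (ℂ × ℂ) × (ℂ × ℂ) => coverKernel β q.1 q.2)
    (f := fun a => (f a, g a)) (measurable_coverKernel β) (hf.prodMk hg)

/-- The integrand of the sesquilinear form of `wormOp`. -/
def wormForm (β : ℝ) (F G : ℂ × ℂ → ℂ) (q : ((ℂ × ℂ) × (ℂ × ℂ)) × ℤ) : ℂ :=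
  (starRingEnd ℂ) (G q.1.1) * (coverKernel β (lift 0 q.1.1) (lift q.2 q.1.2) * F q.1.2)

/-- Exchanging the two points and negating the sheet number conjugates the integrand. As this
exchange preserves the measure, self-adjointness follows. -/
lemma wormForm_swap (β : ℝ) (F G : ℂ × ℂ → ℂ) (q : ((ℂ × ℂ) × (ℂ × ℂ)) × ℤ) :
    wormForm β F G (Prod.map Prod.swap (-·) q) = (starRingEnd ℂ) (wormForm β G F q) := by
  simp only [wormForm, Prod.map_fst, Prod.map_snd, Prod.fst_swap, Prod.snd_swap, map_mul,
    Complex.conj_conj]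
  rw [coverKernel_lift, neg_neg, coverKernel_swap]
  ring

lemma coverOp_lift_eq {β : ℝ} {F : ℂ × ℂ → ℂ} (hF : AEStronglyMeasurable F (vol (wormDomain β)))
    (m : ℂ × ℂ) : coverOp β F m =
      ∫ q, coverKernel β m (lift q.2 q.1) * F q.1 ∂((coverVol β).prod Measure.count) := by
  have h := aestronglyMeasurable_coverKernel_mul hF m
  rw [coverOp]
  rw [← (measurePreserving_lift β).map_eq] at h ⊢
  rw [integral_map measurable_uncurry_lift.aemeasurable h]
  refine integral_congr_ae ?_
  have hD : ∀ᵐ w ∂(coverVol β), w ∈ wormDomain β :=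
    (coverVol_absolutelyContinuous β).ae_le (ae_restrict_mem (measurableSet_wormDomain β))
  filter_upwards [Measure.quasiMeasurePreserving_fst.ae hD] with q hq
  rw [coverMap_lift _ hq.1]

lemma coverMajorant_lift_eq {β : ℝ} {f : ℂ × ℂ → ℝ≥0∞}
    (hf : AEMeasurable f (vol (wormDomain β))) (m : ℂ × ℂ) : coverMajorant β f m =
      ∫⁻ q, ‖coverKernel β m (lift q.2 q.1)‖ₑ * f q.1 ∂((coverVol β).prod Measure.count) := by
  have h : AEMeasurable (fun m' => ‖coverKernel β m m'‖ₑ * f (coverMap m'))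
      (volume.restrict (coverDomain β)) :=
    (measurable_coverKernel_comp measurable_const measurable_id).enorm.aemeasurable.mul
      (hf.comp_quasiMeasurePreserving (quasiMeasurePreserving_coverMap β))
  rw [coverMajorant]
  rw [← (measurePreserving_lift β).map_eq] at h ⊢
  rw [lintegral_map' h measurable_uncurry_lift.aemeasurable]
  refine lintegral_congr_ae ?_
  have hD : ∀ᵐ w ∂(coverVol β), w ∈ wormDomain β :=
    (coverVol_absolutelyContinuous β).ae_le (ae_restrict_mem (measurableSet_wormDomain β))
  filter_upwards [Measure.quasiMeasurePreserving_fst.ae hD] with q hq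
  rw [coverMap_lift _ hq.1]

lemma aestronglyMeasurable_wormForm {β : ℝ} {F G : ℂ × ℂ → ℂ}
    (hF : AEStronglyMeasurable F (vol (wormDomain β)))
    (hG : AEStronglyMeasurable G (vol (wormDomain β))) :
    AEStronglyMeasurable (wormForm β F G)
      (((coverVol β).prod (coverVol β)).prod Measure.count) := by
  have hF' := hF.mono_ac (coverVol_absolutelyContinuous β)
  have hG' := hG.mono_ac (coverVol_absolutelyContinuous β)
  have hl : Measurable fun q : ((ℂ × ℂ) × (ℂ × ℂ)) × ℤ => lift q.2 q.1.2 :=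
    measurable_uncurry_lift.comp (measurable_fst.snd.prodMk measurable_snd)
  have hl0 : Measurable fun q : ((ℂ × ℂ) × (ℂ × ℂ)) × ℤ => lift 0 q.1.1 :=
    (measurable_lift 0).comp measurable_fst.fst
  have hker : Measurable fun q : ((ℂ × ℂ) × (ℂ × ℂ)) × ℤ =>
      coverKernel β (lift 0 q.1.1) (lift q.2 q.1.2) :=
    measurable_coverKernel_comp hl0 hl
  have h1 : AEStronglyMeasurable (fun q : ((ℂ × ℂ) × (ℂ × ℂ)) × ℤ => G q.1.1)
      (((coverVol β).prod (coverVol β)).prod Measure.count) :=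
    hG'.comp_quasiMeasurePreserving
      (Measure.quasiMeasurePreserving_fst.comp Measure.quasiMeasurePreserving_fst)
  have h2 : AEStronglyMeasurable (fun q : ((ℂ × ℂ) × (ℂ × ℂ)) × ℤ => F q.1.2)
      (((coverVol β).prod (coverVol β)).prod Measure.count) :=
    hF'.comp_quasiMeasurePreserving
      (Measure.quasiMeasurePreserving_snd.comp Measure.quasiMeasurePreserving_fst)
  have h3 := Complex.continuous_conj.comp_aestronglyMeasurable h1
  have h4 := hker.aestronglyMeasurable.mul h2
  exact h3.mul h4

lemma lintegral_enorm_wormForm {β : ℝ} {F G : ℂ × ℂ → ℂ}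
    (hF : AEStronglyMeasurable F (vol (wormDomain β)))
    (hG : AEStronglyMeasurable G (vol (wormDomain β))) :
    ∫⁻ q, ‖wormForm β F G q‖ₑ ∂(((coverVol β).prod (coverVol β)).prod Measure.count) =
      ∫⁻ z, ‖G z‖ₑ * coverMajorant β (fun z => ‖F z‖ₑ) (lift 0 z) ∂(coverVol β) := by
  have hF' := hF.mono_ac (coverVol_absolutelyContinuous β)
  have hassoc := (measurePreserving_prodAssoc (coverVol β) (coverVol β)
    (Measure.count : Measure ℤ)).symm MeasurableEquiv.prodAssoc
  have h := (aestronglyMeasurable_wormForm hF hG).enorm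
  have h' : AEMeasurable (fun q => ‖wormForm β F G (MeasurableEquiv.prodAssoc.symm q)‖ₑ)
      ((coverVol β).prod ((coverVol β).prod Measure.count)) :=
    h.comp_quasiMeasurePreserving hassoc.quasiMeasurePreserving
  rw [← hassoc.lintegral_comp_emb (MeasurableEquiv.measurableEmbedding _), lintegral_prod _ h']
  refine lintegral_congr fun z => ?_
  have h1 : Measurable fun q : (ℂ × ℂ) × ℤ => coverKernel β (lift 0 z) (lift q.2 q.1) :=
    measurable_coverKernel_comp measurable_const measurable_uncurry_lift
  have h2 : AEMeasurable (fun q : (ℂ × ℂ) × ℤ => ‖F q.1‖ₑ) ((coverVol β).prod Measure.count) :=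
    hF'.enorm.comp_quasiMeasurePreserving Measure.quasiMeasurePreserving_fst
  have h3 : AEMeasurable (fun q : (ℂ × ℂ) × ℤ =>
      ‖coverKernel β (lift 0 z) (lift q.2 q.1)‖ₑ * ‖F q.1‖ₑ) ((coverVol β).prod Measure.count) :=
    h1.enorm.aemeasurable.mul h2
  rw [coverMajorant_lift_eq hF.enorm, ← lintegral_const_mul'' _ h3]
  refine lintegral_congr fun q => ?_
  show ‖(starRingEnd ℂ) (G z) * (coverKernel β (lift 0 z) (lift q.2 q.1) * F q.1)‖ₑ = _
  rw [enorm_mul, enorm_mul, RCLike.enorm_conj]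

/-- The integral of the modulus is that of |G| times the majorant of F. Both are in L² by the Schur
bound, and a product ab is at most a² + b². This justifies Fubini for the sesquilinear form. -/
lemma integrable_wormForm {β : ℝ} {F G : ℂ × ℂ → ℂ} (hF : MemLp F 2 (vol (wormDomain β)))
    (hG : MemLp G 2 (vol (wormDomain β))) :
    Integrable (wormForm β F G) (((coverVol β).prod (coverVol β)).prod Measure.count) := by
  refine ⟨aestronglyMeasurable_wormForm hF.1 hG.1, ?_⟩
  rw [HasFiniteIntegral, lintegral_enorm_wormForm hF.1 hG.1]
  apply lintegral_coverVol_lt_top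
  obtain ⟨C, hC⟩ := exists_eLpNorm_coverMajorant_le β (p := 2) (by norm_num) (by norm_num)
  have h2 := (hC F hF.1).trans_lt (ENNReal.mul_lt_top ENNReal.coe_lt_top hF.2)
  rw [eLpNorm_lt_top_iff_lintegral_rpow_enorm_lt_top (by norm_num) (by norm_num)] at h2
  have h3 := hG.2
  rw [eLpNorm_lt_top_iff_lintegral_rpow_enorm_lt_top (by norm_num) (by norm_num)] at h3
  have h4 : AEMeasurable (fun z => ‖G z‖ₑ ^ (2 : ℝ≥0∞).toReal) (vol (wormDomain β)) :=
    hG.1.enorm.pow_const _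
  refine lt_of_le_of_lt ?_ (ENNReal.add_lt_top.2 ⟨h3, h2⟩)
  rw [← lintegral_add_left' h4]
  refine lintegral_mono fun z => ?_
  simp only [ENNReal.toReal_ofNat, ENNReal.rpow_ofNat, enorm_eq_self]
  rcases le_total ‖G z‖ₑ (coverMajorant β (fun z => ‖F z‖ₑ) (lift 0 z)) with h | h
  · exact (mul_le_mul' h le_rfl).trans ((sq _).symm.le.trans le_add_self)
  · exact (mul_le_mul' le_rfl h).trans ((sq _).symm.le.trans le_self_add)

lemma integral_wormForm {β : ℝ} {F G : ℂ × ℂ → ℂ} (hF : MemLp F 2 (vol (wormDomain β)))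
    (hG : MemLp G 2 (vol (wormDomain β))) :
    ∫ z, (starRingEnd ℂ) (G z) * wormOp β F z ∂(coverVol β) =
      ∫ q, wormForm β F G q ∂(((coverVol β).prod (coverVol β)).prod Measure.count) := by
  have hassoc := (measurePreserving_prodAssoc (coverVol β) (coverVol β)
    (Measure.count : Measure ℤ)).symm MeasurableEquiv.prodAssoc
  have hi := integrable_wormForm hF hG
  rw [← hassoc.integral_comp' , integral_prod]
  · refine integral_congr_ae (Filter.Eventually.of_forall fun z => ?_)
    simp only [wormOp]
    rw [coverOp_lift_eq hF.1, ← integral_const_mul]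
    rfl
  · exact (hassoc.integrable_comp_emb (MeasurableEquiv.measurableEmbedding _)).2 hi

lemma measurePreserving_neg_count : MeasurePreserving (fun n : ℤ => -n) Measure.count Measure.count :=
  ⟨measurable_of_countable _, by
    refine Measure.ext_of_singleton fun n => ?_
    rw [Measure.map_apply (measurable_of_countable _) (measurableSet_singleton n)]
    have : (fun n : ℤ => -n) ⁻¹' {n} = {-n} := by ext m; simp
    rw [this, Measure.count_singleton, Measure.count_singleton]⟩

/-- `wormOp` is self-adjoint with respect to `coverVol`. -/
lemma integral_conj_mul_wormOp {β : ℝ} {F G : ℂ × ℂ → ℂ} (hF : MemLp F 2 (vol (wormDomain β)))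
    (hG : MemLp G 2 (vol (wormDomain β))) :
    ∫ z, (starRingEnd ℂ) (G z) * wormOp β F z ∂(coverVol β) =
      ∫ z, (starRingEnd ℂ) (wormOp β G z) * F z ∂(coverVol β) := by
  have h1 : ∫ z, (starRingEnd ℂ) (wormOp β G z) * F z ∂(coverVol β) =
      (starRingEnd ℂ) (∫ z, (starRingEnd ℂ) (F z) * wormOp β G z ∂(coverVol β)) := by
    rw [← integral_conj]
    refine integral_congr_ae (Filter.Eventually.of_forall fun z => ?_)
    simp only [map_mul, Complex.conj_conj, mul_comm]
  have hswap : MeasurePreserving (Prod.map Prod.swap (-·) :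
      ((ℂ × ℂ) × (ℂ × ℂ)) × ℤ → ((ℂ × ℂ) × (ℂ × ℂ)) × ℤ)
      (((coverVol β).prod (coverVol β)).prod Measure.count)
      (((coverVol β).prod (coverVol β)).prod Measure.count) :=
    (Measure.measurePreserving_swap (μ := coverVol β) (ν := coverVol β)).prod
      measurePreserving_neg_count
  have hemb : MeasurableEmbedding (Prod.map Prod.swap (-·) :
      ((ℂ × ℂ) × (ℂ × ℂ)) × ℤ → ((ℂ × ℂ) × (ℂ × ℂ)) × ℤ) :=
    (MeasurableEquiv.prodComm.prodCongr (MeasurableEquiv.neg ℤ)).measurableEmbedding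
  rw [h1, integral_wormForm hF hG, integral_wormForm hG hF, ← integral_conj,
    ← hswap.integral_comp hemb]
  simp_rw [wormForm_swap]

lemma integral_coverVol (β : ℝ) (f : ℂ × ℂ → ℂ) :
    ∫ z, f z ∂(coverVol β) = ∫ z in wormDomain β, ((4 / ‖z.2‖ ^ 2 : ℝ) : ℂ) * f z := by
  rw [coverVol, integral_withDensity_eq_integral_toReal_smul measurable_coverDensity
    (Filter.Eventually.of_forall fun _ => ENNReal.ofReal_lt_top)]
  refine integral_congr_ae (Filter.Eventually.of_forall fun z => ?_)
  simp only [ENNReal.toReal_ofReal (show 0 ≤ 4 / ‖z.2‖ ^ 2 by positivity), Complex.real_smul]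

/-- The Bergman projection of the worm domain as an integral operator. -/
def wormProj (β : ℝ) (f : ℂ × ℂ → ℂ) (z : ℂ × ℂ) : ℂ :=
  z.2⁻¹ * wormOp β (fun w => w.2 * f w) z

lemma norm_snd_le {β : ℝ} {z : ℂ × ℂ} (hz : z ∈ wormDomain β) :
    ‖z.2‖ ≤ Real.exp (β - Real.pi / 2) ∧ ‖z.2⁻¹‖ ≤ Real.exp (β - Real.pi / 2) := by
  have h0 : 0 < ‖z.2‖ := norm_pos_iff.2 hz.1
  have h1 := abs_lt.1 hz.2.2
  rw [Real.log_pow] at h1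
  have h2 := (abs_nonneg _).trans_lt hz.2.2
  push_cast at h1
  constructor
  · rw [← Real.log_le_iff_le_exp h0]; linarith
  · rw [norm_inv, ← Real.log_le_iff_le_exp (by positivity), Real.log_inv]; linarith

lemma memLp_bounded_mul {β : ℝ} {p : ℝ≥0∞} {ψ f : ℂ × ℂ → ℂ} {M : ℝ}
    (hf : MemLp f p (vol (wormDomain β))) (hψ : ContinuousOn ψ (wormDomain β))
    (hM : ∀ z ∈ wormDomain β, ‖ψ z‖ ≤ M) :
    MemLp (fun z => ψ z * f z) p (vol (wormDomain β)) ∧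
    eLpNorm (fun z => ψ z * f z) p (vol (wormDomain β)) ≤
      ENNReal.ofReal M * eLpNorm f p (vol (wormDomain β)) := by
  have hm := hψ.aestronglyMeasurable (μ := volume) (measurableSet_wormDomain β)
  have hb : ∀ᵐ z ∂(vol (wormDomain β)), ‖ψ z * f z‖ ≤ M * ‖f z‖ := by
    filter_upwards [ae_restrict_mem (measurableSet_wormDomain β)] with z hz
    rw [norm_mul]
    gcongr
    exact hM z hz
  exact ⟨hf.of_le_mul (hm.mul hf.1) hb, eLpNorm_le_mul_eLpNorm_of_ae_le_mul hb p⟩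

lemma memLp_snd_mul {β : ℝ} {p : ℝ≥0∞} {f : ℂ × ℂ → ℂ} (hf : MemLp f p (vol (wormDomain β))) :
    MemLp (fun z => z.2 * f z) p (vol (wormDomain β)) :=
  (memLp_bounded_mul hf continuous_snd.continuousOn fun _ hz => (norm_snd_le hz).1).1

lemma continuousOn_inv_snd (β : ℝ) : ContinuousOn (fun z : ℂ × ℂ => z.2⁻¹) (wormDomain β) :=
  continuous_snd.continuousOn.inv₀ fun _ hz => hz.1

lemma memLp_inv_snd_mul {β : ℝ} {p : ℝ≥0∞} {f : ℂ × ℂ → ℂ} (hf : MemLp f p (vol (wormDomain β))) :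
    MemLp (fun z => z.2⁻¹ * f z) p (vol (wormDomain β)) :=
  (memLp_bounded_mul hf (continuousOn_inv_snd β) fun _ hz => (norm_snd_le hz).2).1

/-- `wormProj` is the Bergman projection. -/
lemma exists_isBergmanProjection {β : ℝ} (f : Lp ℂ 2 (vol (wormDomain β))) :
    ∃ g : Lp ℂ 2 (vol (wormDomain β)), IsBergmanProjection (wormDomain β) f g ∧
      g =ᵐ[vol (wormDomain β)] wormProj β f := by
  have h12 : (1 : ℝ≥0∞) < 2 := by norm_num
  have h2t : (2 : ℝ≥0∞) < ⊤ := by norm_num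
  have hf := Lp.memLp f
  have hf2 := memLp_snd_mul hf
  obtain ⟨C, hC⟩ := exists_eLpNorm_wormOp_le β h12 h2t
  have hg : MemLp (wormProj β f) 2 (vol (wormDomain β)) := memLp_inv_snd_mul (hC _ hf2).1
  have hgd : DifferentiableOn ℂ (wormProj β f) (wormDomain β) := by
    have h1 : DifferentiableOn ℂ (fun z : ℂ × ℂ => z.2⁻¹) (wormDomain β) :=
      differentiable_snd.differentiableOn.inv fun z hz => hz.1
    exact h1.mul (differentiableOn_wormOp h12 h2t hf2)
  refine ⟨hg.toLp _, ⟨⟨_, hgd, hg.coeFn_toLp⟩, ?_⟩, hg.coeFn_toLp⟩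
  rw [Submodule.mem_orthogonal]
  rintro h ⟨H, hHd, hhH⟩
  have hh := Lp.memLp h
  have hH : MemLp H 2 (vol (wormDomain β)) := hh.ae_eq hhH
  have hH2 := memLp_snd_mul hH
  have hrep : ∀ z ∈ wormDomain β, wormOp β (fun w => w.2 * H w) z = z.2 * H z := fun z hz =>
    wormOp_eq_self h12 h2t hH2 (differentiable_snd.differentiableOn.mul hHd) hz
  have hsa := integral_conj_mul_wormOp hf2 hH2
  rw [integral_coverVol, integral_coverVol] at hsa
  -- The weight cancels the conjugate of z₂ coming from z₂H and leaves z₂⁻¹ in front of `wormOp`,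
  -- which is `wormProj`.
  have e1 : ∫ z in wormDomain β, ((4 / ‖z.2‖ ^ 2 : ℝ) : ℂ) *
      ((starRingEnd ℂ) (z.2 * H z) * wormOp β (fun w => w.2 * f w) z) =
      4 * ∫ z in wormDomain β, (starRingEnd ℂ) (H z) * wormProj β f z := by
    rw [← integral_const_mul]
    refine setIntegral_congr_fun (measurableSet_wormDomain β) fun z hz => ?_
    have h0 : z.2 ≠ 0 := hz.1
    have h0' : (starRingEnd ℂ) z.2 ≠ 0 := by rwa [Ne, map_eq_zero]
    simp only [wormProj, map_mul]
    push_cast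
    rw [← Complex.mul_conj']
    field_simp
  have e2 : ∫ z in wormDomain β, ((4 / ‖z.2‖ ^ 2 : ℝ) : ℂ) *
      ((starRingEnd ℂ) (wormOp β (fun w => w.2 * H w) z) * (z.2 * f z)) =
      4 * ∫ z in wormDomain β, (starRingEnd ℂ) (H z) * f z := by
    rw [← integral_const_mul]
    refine setIntegral_congr_fun (measurableSet_wormDomain β) fun z hz => ?_
    have h0 : z.2 ≠ 0 := hz.1
    have h0' : (starRingEnd ℂ) z.2 ≠ 0 := by rwa [Ne, map_eq_zero]
    simp only [hrep z hz, map_mul]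
    push_cast
    rw [← Complex.mul_conj']
    field_simp
  rw [e1, e2] at hsa
  have hsa' := mul_left_cancel₀ (by norm_num : (4 : ℂ) ≠ 0) hsa
  rw [inner_sub_right, L2.inner_def, L2.inner_def, sub_eq_zero]
  refine Eq.trans ?_ (hsa'.symm.trans ?_)
  · refine integral_congr_ae (hhH.mono fun z hz => ?_)
    simp only [hz, RCLike.inner_apply, mul_comm]
  · refine integral_congr_ae ?_
    filter_upwards [hhH, hg.coeFn_toLp] with z hz hz2
    simp only [hz, hz2, RCLike.inner_apply, mul_comm]

/-! ### Weak derivatives along the symmetries -/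

lemma flow_add (c₁ c₂ s t : ℝ) (z : ℂ × ℂ) :
    flow c₁ c₂ s (flow c₁ c₂ t z) = flow c₁ c₂ (s + t) z := by
  simp only [flow]
  refine Prod.ext ?_ ?_
  · push_cast; ring
  · simp only [mul_assoc, ← Complex.exp_add]
    congr 2
    push_cast
    ring

lemma flow_zero (c₁ c₂ : ℝ) (z : ℂ × ℂ) : flow c₁ c₂ 0 z = z := by simp [flow]

lemma continuous_flow (c₁ c₂ : ℝ) : Continuous fun q : ℝ × (ℂ × ℂ) => flow c₁ c₂ q.1 q.2 := by
  unfold flow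
  fun_prop

/-- The symmetries as homeomorphisms. -/
def flowHomeomorph (c₁ c₂ t : ℝ) : (ℂ × ℂ) ≃ₜ (ℂ × ℂ) where
  toFun := flow c₁ c₂ t
  invFun := flow c₁ c₂ (-t)
  left_inv z := by rw [flow_add, neg_add_cancel, flow_zero]
  right_inv z := by rw [flow_add, add_neg_cancel, flow_zero]
  continuous_toFun := (continuous_flow c₁ c₂).comp (by fun_prop : Continuous fun z : ℂ × ℂ => (t, z))
  continuous_invFun := (continuous_flow c₁ c₂).comp (by fun_prop : Continuous fun z : ℂ × ℂ => (-t, z))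

lemma norm_flow_snd (c₁ c₂ t : ℝ) (z : ℂ × ℂ) : ‖(flow c₁ c₂ t z).2‖ = ‖z.2‖ := by
  rw [flow, norm_mul, Complex.norm_exp_ofReal_mul_I, mul_one]

lemma flow_mem_iff {β : ℝ} (c₁ c₂ t : ℝ) {z : ℂ × ℂ} :
    flow c₁ c₂ t z ∈ wormDomain β ↔ z ∈ wormDomain β := by
  have h1 : (flow c₁ c₂ t z).1.im = z.1.im := by simp [flow, -Complex.ofReal_mul]
  have h2 : (flow c₁ c₂ t z).2 ≠ 0 ↔ z.2 ≠ 0 := by simp [flow]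
  simp only [wormDomain, mem_ofPred_eq, norm_flow_snd, h1, h2]

lemma measurePreserving_flow (β c₁ c₂ t : ℝ) :
    MeasurePreserving (flow c₁ c₂ t) (vol (wormDomain β)) (vol (wormDomain β)) := by
  have h1 : MeasurePreserving (fun w : ℂ => w + (t * c₁ : ℝ)) := measurePreserving_add_right _ _
  have h2 : MeasurePreserving (fun w : ℂ => w * Complex.exp ((t * c₂ : ℝ) * Complex.I)) := by
    have := (rotation (Circle.exp (t * c₂))).measurePreserving
    convert this using 1
    ext w
    rw [rotation_apply, Circle.coe_exp, mul_comm]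
  have h3 : MeasurePreserving (flow c₁ c₂ t) volume volume := h1.prod h2
  have h4 := h3.restrict_preimage (measurableSet_wormDomain β)
  rwa [show flow c₁ c₂ t ⁻¹' wormDomain β = wormDomain β from
    Set.ext fun z => flow_mem_iff c₁ c₂ t] at h4

lemma measurableEmbedding_flow (c₁ c₂ t : ℝ) : MeasurableEmbedding (flow c₁ c₂ t) :=
  (flowHomeomorph c₁ c₂ t).measurableEmbedding

lemma measurePreserving_flow_prod (β c₁ c₂ : ℝ) (ν : Measure ℝ) [SFinite ν] :
    MeasurePreserving (fun q : ℝ × (ℂ × ℂ) => (q.1, flow c₁ c₂ q.1 q.2))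
      (ν.prod (vol (wormDomain β))) (ν.prod (vol (wormDomain β))) :=
  (MeasurePreserving.id ν).skew_product (g := flow c₁ c₂) (continuous_flow c₁ c₂).measurable
    (Filter.Eventually.of_forall fun t => (measurePreserving_flow β c₁ c₂ t).map_eq)

lemma memLp_comp_flow {β : ℝ} {p : ℝ≥0∞} {f : ℂ × ℂ → ℂ} (hf : MemLp f p (vol (wormDomain β)))
    (c₁ c₂ : ℝ) (ν : Measure ℝ) [IsFiniteMeasure ν] :
    MemLp (fun q : ℝ × (ℂ × ℂ) => f (flow c₁ c₂ q.1 q.2)) p (ν.prod (vol (wormDomain β))) :=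
  (hf.comp_snd ν).comp_measurePreserving (measurePreserving_flow_prod β c₁ c₂ ν)

/-- The vector field generating the symmetries. -/
def flowField (c₁ c₂ : ℝ) (z : ℂ × ℂ) : ℂ × ℂ := (c₁, Complex.I * c₂ * z.2)

lemma hasDerivAt_flow (c₁ c₂ t : ℝ) (z : ℂ × ℂ) :
    HasDerivAt (fun t => flow c₁ c₂ t z) (flowField c₁ c₂ (flow c₁ c₂ t z)) t := by
  have h0 : HasDerivAt (fun t : ℝ => (t : ℂ)) 1 t := (hasDerivAt_id t).ofReal_comp
  have h1 : HasDerivAt (fun t : ℝ => z.1 + (t * c₁ : ℝ)) (c₁ : ℂ) t := by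
    have := (h0.mul_const (c₁ : ℂ)).const_add z.1
    simpa using this
  have h2 : HasDerivAt (fun t : ℝ => z.2 * Complex.exp ((t * c₂ : ℝ) * Complex.I))
      (Complex.I * c₂ * (z.2 * Complex.exp ((t * c₂ : ℝ) * Complex.I))) t := by
    have := (((h0.mul_const (c₂ : ℂ)).mul_const Complex.I).cexp).const_mul z.2
    simp only [Complex.ofReal_mul]
    refine this.congr_deriv ?_
    ring
  exact h1.prodMk h2

/-- `g` is the weak derivative of `f` along the symmetries. -/
def HasWeakFlowDeriv (β c₁ c₂ : ℝ) (f g : ℂ × ℂ → ℂ) : Prop :=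
  ∀ φ : ℂ × ℂ → ℝ, IsTestFunction (wormDomain β) φ →
    ∫ z in wormDomain β, ((fderiv ℝ φ z (flowField c₁ c₂ z) : ℝ) : ℂ) * f z =
      -∫ z in wormDomain β, (φ z : ℂ) * g z

lemma flow_eq_affine (c₁ c₂ t : ℝ) (z : ℂ × ℂ) : flow c₁ c₂ t z =
    (((t * c₁ : ℝ) : ℂ), (0 : ℂ)) + ((ContinuousLinearMap.fst ℝ ℂ ℂ).prod
      ((ContinuousLinearMap.mul ℝ ℂ (Complex.exp ((t * c₂ : ℝ) * Complex.I))).comp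
        (ContinuousLinearMap.snd ℝ ℂ ℂ))) z := by
  refine Prod.ext ?_ ?_ <;> simp [flow, add_comm, mul_comm]

/-- A flow carries its own generating field to itself, so differentiation along the field commutes
with composition with the flow. -/
lemma fderiv_comp_flow {φ : ℂ × ℂ → ℝ} (hφ : Differentiable ℝ φ) (c₁ c₂ t : ℝ) (z : ℂ × ℂ) :
    fderiv ℝ (fun z => φ (flow c₁ c₂ t z)) z (flowField c₁ c₂ z) =
      fderiv ℝ φ (flow c₁ c₂ t z) (flowField c₁ c₂ (flow c₁ c₂ t z)) := by
  have h1 : HasFDerivAt (flow c₁ c₂ t) ((ContinuousLinearMap.fst ℝ ℂ ℂ).prod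
      ((ContinuousLinearMap.mul ℝ ℂ (Complex.exp ((t * c₂ : ℝ) * Complex.I))).comp
        (ContinuousLinearMap.snd ℝ ℂ ℂ))) z := by
    rw [funext (flow_eq_affine c₁ c₂ t)]
    exact (ContinuousLinearMap.hasFDerivAt _).const_add _
  have h2 := (hφ (flow c₁ c₂ t z)).hasFDerivAt.comp z h1
  rw [show (fun z => φ (flow c₁ c₂ t z)) = φ ∘ flow c₁ c₂ t from rfl, h2.fderiv]
  rw [ContinuousLinearMap.comp_apply]
  congr 1
  refine Prod.ext ?_ ?_
  · simp [flowField]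
  · simp [flowField, flow]
    ring

lemma isTestFunction_comp_flow {β : ℝ} {φ : ℂ × ℂ → ℝ} (hφ : IsTestFunction (wormDomain β) φ)
    (c₁ c₂ t : ℝ) : IsTestFunction (wormDomain β) fun z => φ (flow c₁ c₂ t z) := by
  refine ⟨?_, hφ.2.1.comp_homeomorph (flowHomeomorph c₁ c₂ t), ?_⟩
  · refine hφ.1.comp ?_
    rw [funext (flow_eq_affine c₁ c₂ t)]
    fun_prop
  · have : tsupport (fun z => φ (flow c₁ c₂ t z)) = flowHomeomorph c₁ c₂ t ⁻¹' tsupport φ :=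
      tsupport_comp_eq_preimage φ (flowHomeomorph c₁ c₂ t)
    rw [this]
    intro z hz
    exact (flow_mem_iff c₁ c₂ t).1 (hφ.2.2 hz)

lemma continuous_fderiv_flowField {φ : ℂ × ℂ → ℝ} (hφ : ContDiff ℝ ∞ φ) (c₁ c₂ : ℝ) :
    Continuous fun z => fderiv ℝ φ z (flowField c₁ c₂ z) := by
  have h := hφ.continuous_fderiv (by simp)
  have h2 : Continuous (flowField c₁ c₂) := by unfold flowField; fun_prop
  exact h.clm_apply h2

lemma hasCompactSupport_fderiv_flowField {φ : ℂ × ℂ → ℝ} (hφ : HasCompactSupport φ) (c₁ c₂ : ℝ) :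
    HasCompactSupport fun z => fderiv ℝ φ z (flowField c₁ c₂ z) := by
  refine (hφ.fderiv (𝕜 := ℝ)).mono fun z hz => ?_
  contrapose! hz
  simp only [Function.mem_support, not_not] at hz ⊢
  rw [hz]
  rfl

lemma memLp_ofReal_of_hasCompactSupport {ψ : ℂ × ℂ → ℝ} (hψ : Continuous ψ)
    (hs : HasCompactSupport ψ) (q : ℝ≥0∞) (μ : Measure (ℂ × ℂ)) [IsFiniteMeasureOnCompacts μ] :
    MemLp (fun z => (ψ z : ℂ)) q μ :=
  (hψ.memLp_of_hasCompactSupport hs).ofReal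

/-- The fundamental theorem of calculus for weak derivatives along the symmetries. -/
lemma HasWeakFlowDeriv.ae_eq {β c₁ c₂ : ℝ} {p : ℝ≥0∞} (hp : 1 ≤ p) {f g : ℂ × ℂ → ℂ}
    (h : HasWeakFlowDeriv β c₁ c₂ f g) (hf : MemLp f p (vol (wormDomain β)))
    (hg : MemLp g p (vol (wormDomain β))) {t : ℝ} (ht : 0 ≤ t) :
    ∀ᵐ z ∂(vol (wormDomain β)),
      f (flow c₁ c₂ t z) = f z + ∫ s in Ioc 0 t, g (flow c₁ c₂ s z) := by
  set ν : Measure ℝ := volume.restrict (Ioc 0 t) with hν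
  set q := p.conjExponent with hq
  have hpq : p.HolderConjugate q := ENNReal.HolderConjugate.conjExponent hp
  have hgp : ∀ ψ : ℂ × ℂ → ℂ, MemLp ψ q (vol (wormDomain β)) →
      Integrable (fun x : ℝ × (ℂ × ℂ) => ψ x.2 * g (flow c₁ c₂ x.1 x.2)) (ν.prod (vol (wormDomain β))) :=
    fun ψ hψ => (hψ.comp_snd ν).integrable_mul (memLp_comp_flow hg c₁ c₂ ν)
  have hft : MemLp (fun z => f (flow c₁ c₂ t z)) p (vol (wormDomain β)) :=
    hf.comp_measurePreserving (measurePreserving_flow β c₁ c₂ t)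
  have hI : ∀ ψ : ℂ × ℂ → ℂ, MemLp ψ q (vol (wormDomain β)) →
      Integrable (fun z => ψ z * ∫ s, g (flow c₁ c₂ s z) ∂ν) (vol (wormDomain β)) := by
    intro ψ hψ
    have := (hgp ψ hψ).integral_prod_right
    simpa only [integral_const_mul] using this
  -- The defect in the claimed identity. It is shown to be locally integrable and orthogonal to all
  -- test functions, hence zero almost everywhere.
  set A : ℂ × ℂ → ℂ := fun z => f (flow c₁ c₂ t z) - f z - ∫ s, g (flow c₁ c₂ s z) ∂ν with hA
  have hAi : ∀ ψ : ℂ × ℂ → ℂ, MemLp ψ q (vol (wormDomain β)) → Integrable (fun z => ψ z * A z) (vol (wormDomain β)) := by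
    intro ψ hψ
    have h1 := ((hψ.integrable_mul hft).sub (hψ.integrable_mul hf)).sub (hI ψ hψ)
    refine h1.congr (Filter.Eventually.of_forall fun z => ?_)
    simp only [hA, Pi.sub_apply, Pi.mul_apply]
    ring
  have key : ∀ φ, IsTestFunction (wormDomain β) φ → ∫ z in wormDomain β, (φ z : ℂ) * A z = 0 := by
    intro φ hφ
    set X : ℂ × ℂ → ℝ := fun z => fderiv ℝ φ z (flowField c₁ c₂ z) with hX
    have hφq := memLp_ofReal_of_hasCompactSupport hφ.1.continuous hφ.2.1 q (vol (wormDomain β))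
    have hXq := memLp_ofReal_of_hasCompactSupport (continuous_fderiv_flowField hφ.1 c₁ c₂)
      (hasCompactSupport_fderiv_flowField hφ.2.1 c₁ c₂) q (vol (wormDomain β))
    have hφd : Differentiable ℝ φ := hφ.1.differentiable (by simp)
    have hneg : ∀ s z, flow (-c₁) (-c₂) s z = flow c₁ c₂ (-s) z := by
      intro s z; simp [flow]
    have e1 : ∫ z in wormDomain β, (φ z : ℂ) * f (flow c₁ c₂ t z) =
        ∫ z in wormDomain β, (φ (flow c₁ c₂ (-t) z) : ℂ) * f z := by
      rw [← (measurePreserving_flow β c₁ c₂ t).integral_comp (measurableEmbedding_flow c₁ c₂ t)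
        (fun z => (φ (flow c₁ c₂ (-t) z) : ℂ) * f z)]
      simp_rw [flow_add, neg_add_cancel, flow_zero]
    -- Measure preservation has moved the flow from f onto φ, where the classical fundamental
    -- theorem applies.
    have e2 : ∀ z, (φ (flow c₁ c₂ (-t) z) : ℂ) - φ z = -∫ s, (X (flow c₁ c₂ (-s) z) : ℂ) ∂ν := by
      intro z
      have hd : ∀ s ∈ uIcc 0 t, HasDerivAt (fun s => φ (flow c₁ c₂ (-s) z))
          (-X (flow c₁ c₂ (-s) z)) s := by
        intro s _
        have h1 := (hasDerivAt_flow c₁ c₂ (-s) z).scomp s (hasDerivAt_neg s)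
        have h2 := (hφd (flow c₁ c₂ (-s) z)).hasFDerivAt.comp_hasDerivAt s h1
        refine h2.congr_deriv ?_
        simp [hX]
      have hc : Continuous fun s : ℝ => -X (flow c₁ c₂ (-s) z) :=
        ((continuous_fderiv_flowField hφ.1 c₁ c₂).comp ((continuous_flow c₁ c₂).comp
          (by fun_prop : Continuous fun s : ℝ => (-s, z)))).neg
      have h3 := intervalIntegral.integral_eq_sub_of_hasDerivAt hd (hc.intervalIntegrable 0 t)
      rw [intervalIntegral.integral_of_le ht, neg_zero, flow_zero, integral_neg] at h3
      rw [integral_complex_ofReal, ← Complex.ofReal_sub, ← h3]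
      push_cast
      rfl
    have e3 : Integrable (fun x : ℝ × (ℂ × ℂ) => (X (flow c₁ c₂ (-x.1) x.2) : ℂ) * f x.2)
        (ν.prod (vol (wormDomain β))) := by
      have := (memLp_comp_flow hXq (-c₁) (-c₂) ν).integrable_mul (hf.comp_snd ν)
      simp only [hneg] at this
      exact this
    -- The weak derivative is tested against the transported function φ ∘ flow₋ₛ, and the flow is
    -- then moved back onto g.
    have e4 : ∀ s, ∫ z in wormDomain β, (X (flow c₁ c₂ (-s) z) : ℂ) * f z =
        -∫ z in wormDomain β, (φ z : ℂ) * g (flow c₁ c₂ s z) := by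
      intro s
      have h1 := h _ (isTestFunction_comp_flow hφ c₁ c₂ (-s))
      simp_rw [fderiv_comp_flow hφd] at h1
      rw [h1, ← (measurePreserving_flow β c₁ c₂ s).integral_comp (measurableEmbedding_flow c₁ c₂ s)]
      simp_rw [flow_add, neg_add_cancel, flow_zero]
    have i1 : Integrable (fun z => (φ z : ℂ) * f (flow c₁ c₂ t z)) (vol (wormDomain β)) :=
      hφq.integrable_mul hft
    have i2 : Integrable (fun z => (φ z : ℂ) * f z) (vol (wormDomain β)) :=
      hφq.integrable_mul hf
    have i3 := hI _ hφq
    have i4 : Integrable (fun z => (φ (flow c₁ c₂ (-t) z) : ℂ) * f z) (vol (wormDomain β)) :=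
      (memLp_ofReal_of_hasCompactSupport
      (isTestFunction_comp_flow hφ c₁ c₂ (-t)).1.continuous
      (isTestFunction_comp_flow hφ c₁ c₂ (-t)).2.1 q (vol (wormDomain β))).integrable_mul hf
    calc ∫ z in wormDomain β, (φ z : ℂ) * A z = (∫ z in wormDomain β, (φ z : ℂ) * f (flow c₁ c₂ t z)) -
          (∫ z in wormDomain β, (φ z : ℂ) * f z) -
          ∫ z in wormDomain β, (φ z : ℂ) * ∫ s, g (flow c₁ c₂ s z) ∂ν := by
          rw [← integral_sub i1 i2, ← integral_sub (f := fun z => (φ z : ℂ) * f (flow c₁ c₂ t z) - φ z * f z)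
            (i1.sub i2) i3]
          refine integral_congr_ae (Filter.Eventually.of_forall fun z => ?_)
          simp only [hA]
          ring
      _ = (∫ z in wormDomain β, -∫ s, (X (flow c₁ c₂ (-s) z) : ℂ) * f z ∂ν) -
          ∫ z in wormDomain β, (φ z : ℂ) * ∫ s, g (flow c₁ c₂ s z) ∂ν := by
          rw [e1, ← integral_sub i4 i2]
          congr 1
          refine integral_congr_ae (Filter.Eventually.of_forall fun z => ?_)
          beta_reduce
          rw [← sub_mul, e2, integral_mul_const, neg_mul]
      _ = 0 := by
          rw [integral_neg, ← integral_integral_swap e3]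
          simp_rw [e4]
          rw [integral_neg, neg_neg, integral_integral_swap (hgp _ hφq)]
          simp_rw [integral_const_mul]
          rw [sub_self]
  have hloc : LocallyIntegrableOn A (wormDomain β) volume := by
    rw [locallyIntegrableOn_iff (isOpen_wormDomain β).isLocallyClosed]
    intro K hKD hK
    have hKq : MemLp (K.indicator fun _ => (1 : ℂ)) q (vol (wormDomain β)) :=
      memLp_indicator_const q hK.measurableSet 1 (Or.inr (hK.measure_lt_top.ne))
    have h1 := hAi _ hKq
    have h2 : (fun z => K.indicator (fun _ => (1 : ℂ)) z * A z) = K.indicator A := by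
      ext z
      by_cases hz : z ∈ K <;> simp [hz]
    rw [h2, integrable_indicator_iff hK.measurableSet, IntegrableOn,
      Measure.restrict_restrict hK.measurableSet, inter_eq_self_of_subset_left hKD] at h1
    exact h1
  have hzero := (isOpen_wormDomain β).ae_eq_zero_of_integral_contDiff_smul_eq_zero hloc
    fun φ h1 h2 h3 => by
      have := key φ ⟨h1, h2, h3⟩
      rw [setIntegral_eq_integral_of_forall_compl_eq_zero] at this
      · simpa using this
      · intro z hz
        rw [image_eq_zero_of_notMem_tsupport fun h => hz (h3 h)]
        simp
  filter_upwards [ae_restrict_of_ae hzero, ae_restrict_mem (measurableSet_wormDomain β)] with z hz hzD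
  have := hz hzD
  simp only [hA] at this
  linear_combination this

/-! ### Commutation of the operator with the symmetries. -/

lemma continuous_flowShift (c₁ c₂ : ℝ) : Continuous (flowShift c₁ c₂) := by
  unfold flowShift
  fun_prop

lemma flowShift_zero (c₁ c₂ : ℝ) : flowShift c₁ c₂ 0 = 0 := by simp [flowShift]

lemma coverMajorant_flow_eq (β c₁ c₂ s : ℝ) (F : ℂ × ℂ → ℂ) (m : ℂ × ℂ) :
    ∫⁻ m' in coverDomain β, ‖coverKernel β m m' * F (flow c₁ c₂ s (coverMap m'))‖ₑ =
      coverMajorant β (fun z => ‖F z‖ₑ) (m + flowShift c₁ c₂ s) := by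
  rw [coverMajorant_add_flowShift]
  exact lintegral_congr fun m' => enorm_mul _ _

lemma aestronglyMeasurable_comp_flow_coverMap {β : ℝ} {F : ℂ × ℂ → ℂ}
    (hF : AEStronglyMeasurable F (vol (wormDomain β))) (c₁ c₂ : ℝ) (ν : Measure ℝ) [SFinite ν] :
    AEStronglyMeasurable (fun q : ℝ × (ℂ × ℂ) => F (flow c₁ c₂ q.1 (coverMap q.2)))
      (ν.prod (volume.restrict (coverDomain β))) := by
  have h1 : MeasurePreserving (fun q : ℝ × (ℂ × ℂ) => (q.1, q.2 + flowShift c₁ c₂ q.1))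
      (ν.prod (volume.restrict (coverDomain β))) (ν.prod (volume.restrict (coverDomain β))) :=
    (MeasurePreserving.id ν).skew_product (g := fun s m => m + flowShift c₁ c₂ s)
      (measurable_snd.add ((continuous_flowShift c₁ c₂).measurable.comp measurable_fst))
      (Filter.Eventually.of_forall fun s => (measurePreserving_add_flowShift β c₁ c₂ s).map_eq)
  have h2 := (quasiMeasurePreserving_coverMap β).comp
    ((Measure.quasiMeasurePreserving_snd (μ := ν)).comp h1.quasiMeasurePreserving)
  have h3 := hF.comp_quasiMeasurePreserving h2
  refine h3.congr (Filter.Eventually.of_forall fun q => ?_)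
  simp only [Function.comp_apply, coverMap_add_flowShift]

/-- `wormOp` commutes with derivatives along the symmetries. -/
lemma HasWeakFlowDeriv.fderiv_wormOp {β c₁ c₂ : ℝ} {p : ℝ≥0∞} (hp1 : 1 < p) (hp2 : p < ⊤)
    {f g : ℂ × ℂ → ℂ} (h : HasWeakFlowDeriv β c₁ c₂ f g) (hf : MemLp f p (vol (wormDomain β)))
    (hg : MemLp g p (vol (wormDomain β))) {z : ℂ × ℂ} (hz : z ∈ wormDomain β) :
    fderiv ℂ (wormOp β f) z (flowField c₁ c₂ z) = wormOp β g z := by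
  set m := lift 0 z with hmdef
  have hm : m ∈ coverDomain β := lift_mem 0 hz
  have hmz : coverMap m = z := coverMap_lift 0 hz.1
  have hshift : ∀ s, m + flowShift c₁ c₂ s ∈ coverDomain β := fun s =>
    (add_flowShift_mem_iff c₁ c₂ s).2 hm
  have hcs : Continuous fun s => m + flowShift c₁ c₂ s := continuous_const.add (continuous_flowShift c₁ c₂)
  obtain ⟨r, hr, hsub, hcmp⟩ := exists_coverKernel_comparable hm
  obtain ⟨δ, hδ, hball⟩ : ∃ δ > 0, ∀ s : ℝ, |s| < δ → m + flowShift c₁ c₂ s ∈ Metric.ball m r := by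
    have h1 : (fun s => m + flowShift c₁ c₂ s) ⁻¹' Metric.ball m r ∈ nhds (0 : ℝ) := by
      apply hcs.continuousAt.preimage_mem_nhds
      rw [flowShift_zero, add_zero]
      exact Metric.ball_mem_nhds m hr
    obtain ⟨δ, hδ, h2⟩ := Metric.mem_nhds_iff.1 h1
    exact ⟨δ, hδ, fun s hs => h2 (by simpa using hs)⟩
  have hop : ∀ s, coverOp β g (m + flowShift c₁ c₂ s) =
      ∫ m' in coverDomain β, coverKernel β m m' * g (flow c₁ c₂ s (coverMap m')) := fun s =>
    coverOp_add_flowShift β c₁ c₂ s g m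
  -- The fundamental theorem for f along the flow, integrated against the kernel. Translation
  -- invariance moves the flow off f and g, and Harnack near m gives the integrability for Fubini.
  have key : ∀ t, 0 ≤ t → t < δ → coverOp β f (m + flowShift c₁ c₂ t) =
      coverOp β f m + ∫ s in (0 : ℝ)..t, coverOp β g (m + flowShift c₁ c₂ s) := by
    intro t ht htδ
    set ν : Measure ℝ := volume.restrict (Ioc 0 t) with hν
    have hmeas : AEStronglyMeasurable (fun q : ℝ × (ℂ × ℂ) =>
        coverKernel β m q.2 * g (flow c₁ c₂ q.1 (coverMap q.2)))
        (ν.prod (volume.restrict (coverDomain β))) :=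
      (measurable_coverKernel_comp measurable_const measurable_snd).aestronglyMeasurable.mul
        (aestronglyMeasurable_comp_flow_coverMap hg.1 c₁ c₂ ν)
    have hint : Integrable (fun q : ℝ × (ℂ × ℂ) =>
        coverKernel β m q.2 * g (flow c₁ c₂ q.1 (coverMap q.2)))
        (ν.prod (volume.restrict (coverDomain β))) := by
      refine ⟨hmeas, ?_⟩
      rw [HasFiniteIntegral, lintegral_prod _ hmeas.enorm]
      simp_rw [coverMajorant_flow_eq]
      calc _ ≤ ∫⁻ s in Ioc 0 t, 16 * coverMajorant β (fun z => ‖g z‖ₑ) m := by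
            refine setLIntegral_mono' measurableSet_Ioc fun s hs => ?_
            refine coverMajorant_le_of_kernel_le (fun m' hm' => (hcmp _ (hball s ?_) m' hm').1) _
            rw [abs_of_pos hs.1]
            exact hs.2.trans_lt htδ
        _ < ⊤ := by
            rw [lintegral_const]
            exact ENNReal.mul_lt_top (ENNReal.mul_lt_top (by simp) (coverMajorant_lt_top hp1 hp2 hg hm))
              (by simp)
    have h1 : coverOp β f (m + flowShift c₁ c₂ t) =
        ∫ m' in coverDomain β, (coverKernel β m m' * f (coverMap m') +
          ∫ s, coverKernel β m m' * g (flow c₁ c₂ s (coverMap m')) ∂ν) := by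
      rw [coverOp_add_flowShift, coverOp_congr (h.ae_eq hp1.le hf hg ht), coverOp]
      refine integral_congr_ae (Filter.Eventually.of_forall fun m' => ?_)
      simp only [integral_const_mul, mul_add]
      rfl
    rw [h1, integral_add (integrableOn_coverKernel_mul hp1 hp2 hf hm) hint.integral_prod_right,
      ← integral_integral_swap hint, intervalIntegral.integral_of_le ht]
    simp_rw [hop]
    rfl
  have hcont : Continuous fun s => coverOp β g (m + flowShift c₁ c₂ s) := by
    refine continuous_iff_continuousAt.2 fun s => ?_
    exact ContinuousAt.comp (g := coverOp β g) (f := fun s => m + flowShift c₁ c₂ s)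
      (differentiableAt_coverOp hp1 hp2 hg (hshift s)).continuousAt hcs.continuousAt
  -- Only t ≥ 0 is available, but a one-sided derivative suffices: holomorphy already gives the
  -- two-sided one, and the two must agree.
  have hd1 : HasDerivWithinAt (fun t => coverOp β f (m + flowShift c₁ c₂ t)) (coverOp β g m)
      (Ici 0) 0 := by
    have h1 : HasDerivAt (fun t => coverOp β f m + ∫ s in (0 : ℝ)..t,
        coverOp β g (m + flowShift c₁ c₂ s)) (coverOp β g (m + flowShift c₁ c₂ 0)) 0 :=
      (hcont.integral_hasStrictDerivAt 0 0).hasDerivAt.const_add _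
    rw [flowShift_zero, add_zero] at h1
    refine h1.hasDerivWithinAt.congr_of_eventuallyEq ?_ (key 0 le_rfl hδ)
    filter_upwards [self_mem_nhdsWithin, mem_nhdsWithin_of_mem_nhds (Iio_mem_nhds hδ)] with t ht0 htδ
    exact key t ht0 htδ
  have hflow : ∀ t, wormOp β f (flow c₁ c₂ t z) = coverOp β f (m + flowShift c₁ c₂ t) := by
    intro t
    rw [← wormOp_coverMap, coverMap_add_flowShift, hmz]
  have hd2 : HasDerivAt (fun t => wormOp β f (flow c₁ c₂ t z))
      (fderiv ℂ (wormOp β f) z (flowField c₁ c₂ z)) 0 := by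
    have h1 := (differentiableAt_wormOp hp1 hp2 hf hz).hasFDerivAt.restrictScalars ℝ
    have h2 := hasDerivAt_flow c₁ c₂ 0 z
    rw [flow_zero] at h2
    have h3 : HasFDerivAt (wormOp β f) ((fderiv ℂ (wormOp β f) z).restrictScalars ℝ)
        (flow c₁ c₂ 0 z) := by rwa [flow_zero]
    exact h3.comp_hasDerivAt 0 h2
  simp_rw [hflow] at hd2
  exact (uniqueDiffWithinAt_Ici (0 : ℝ)).eq_deriv _ hd2.hasDerivWithinAt hd1

/-! ### Weak partial derivatives -/

/-- `g` is the weak partial derivative of `f` in the `i`-th real coordinate direction. -/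
def HasWeakPartial (β : ℝ) (i : Fin 4) (f g : ℂ × ℂ → ℂ) : Prop :=
  ∀ φ : ℂ × ℂ → ℝ, IsTestFunction (wormDomain β) φ →
    ∫ z in wormDomain β, (partialDeriv i φ z : ℂ) * f z =
      - ∫ z in wormDomain β, (φ z : ℂ) * g z

/-! ### Calculus with weak first-order derivatives. -/

lemma integrable_mul_of_hasCompactSupport {D : Set (ℂ × ℂ)} {f χ : ℂ × ℂ → ℂ}
    (hf : LocallyIntegrable f (vol D)) (hχ : Continuous χ) (hs : HasCompactSupport χ) :
    Integrable (fun z => χ z * f z) (vol D) := by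
  have h1 : IntegrableOn f (tsupport χ) (vol D) := hf.integrableOn_isCompact hs
  have h2 : IntegrableOn (fun z => χ z * f z) (tsupport χ) (vol D) :=
    h1.continuousOn_mul hχ.continuousOn hs
  refine (integrableOn_iff_integrable_of_support_subset fun z hz => ?_).1 h2
  exact subset_tsupport _ fun h => hz (by simp [h])

lemma continuous_mul_of_tsupport_subset {D : Set (ℂ × ℂ)} (hD : IsOpen D) {φ ψ : ℂ × ℂ → ℂ}
    (hφ : Continuous φ) (hs : tsupport φ ⊆ D) (hψ : ContinuousOn ψ D) :
    Continuous fun z => φ z * ψ z := by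
  refine continuous_of_tsupport fun z hz => ?_
  exact hφ.continuousAt.mul (hψ.continuousAt (hD.mem_nhds (hs (tsupport_mul_subset_left hz))))

lemma contDiff_mul_of_tsupport_subset {D : Set (ℂ × ℂ)} (hD : IsOpen D) {φ ψ : ℂ × ℂ → ℂ}
    (hφ : ContDiff ℝ ∞ φ) (hs : tsupport φ ⊆ D) (hψ : ContDiffOn ℝ ∞ ψ D) :
    ContDiff ℝ ∞ fun z => φ z * ψ z := by
  refine contDiff_iff_contDiffAt.2 fun z => ?_
  by_cases hz : z ∈ tsupport φ
  · exact hφ.contDiffAt.mul (hψ.contDiffAt (hD.mem_nhds (hs hz)))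
  · have h1 : (fun z => φ z * ψ z) =ᶠ[nhds z] fun _ => 0 :=
      (notMem_tsupport_iff_eventuallyEq.1 hz).mono fun w hw => by simp [hw]
    exact contDiffAt_const.congr_of_eventuallyEq h1

lemma IsTestFunction.ofReal {D : Set (ℂ × ℂ)} {φ : ℂ × ℂ → ℝ} (h : IsTestFunction D φ) :
    ContDiff ℝ ∞ (fun z => (φ z : ℂ)) ∧ HasCompactSupport (fun z => (φ z : ℂ)) ∧
      tsupport (fun z => (φ z : ℂ)) ⊆ D := by
  have hs : tsupport (fun z => (φ z : ℂ)) = tsupport φ := by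
    unfold tsupport
    congr 1
    ext z
    simp
  refine ⟨Complex.ofRealCLM.contDiff.comp h.1, ?_, hs ▸ h.2.2⟩
  rw [HasCompactSupport, hs]
  exact h.2.1

lemma fderiv_ofReal_comp {φ : ℂ × ℂ → ℝ} {z : ℂ × ℂ} (h : DifferentiableAt ℝ φ z) (v : ℂ × ℂ) :
    fderiv ℝ (fun z => (φ z : ℂ)) z v = (fderiv ℝ φ z v : ℝ) := by
  have := (Complex.ofRealCLM.hasFDerivAt.comp z h.hasFDerivAt).fderiv
  rw [show (fun z => (φ z : ℂ)) = Complex.ofRealCLM ∘ φ from rfl, this]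
  rfl

/-- Complex-valued test functions. -/
lemma HasWeakPartial.integral_fderiv_mul {β : ℝ} {i : Fin 4} {f g χ : ℂ × ℂ → ℂ}
    (h : HasWeakPartial β i f g) (hf : LocallyIntegrable f (vol (wormDomain β)))
    (hg : LocallyIntegrable g (vol (wormDomain β))) (hχ : ContDiff ℝ ∞ χ)
    (hs : HasCompactSupport χ) (hD : tsupport χ ⊆ wormDomain β) :
    ∫ z in wormDomain β, fderiv ℝ χ z (coordDir i) * f z =
      - ∫ z in wormDomain β, χ z * g z := by
  have test : ∀ L : ℂ →L[ℝ] ℝ, IsTestFunction (wormDomain β) (fun z => L (χ z)) := fun L => by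
    refine ⟨L.contDiff.comp hχ, hs.comp_left (g := L) (map_zero L), ?_⟩
    exact (closure_mono (Function.support_comp_subset (map_zero L) χ)).trans hD
  have hd : ∀ (L : ℂ →L[ℝ] ℝ) (z : ℂ × ℂ),
      partialDeriv i (fun z => L (χ z)) z = L (fderiv ℝ χ z (coordDir i)) := fun L z => by
    have := (L.hasFDerivAt.comp z (hχ.differentiable (by simp) z).hasFDerivAt).fderiv
    simp only [partialDeriv]
    rw [show (fun z => L (χ z)) = L ∘ χ from rfl, this]
    rfl
  have hre := h _ (test Complex.reCLM)
  have him := h _ (test Complex.imCLM)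
  simp_rw [hd] at hre him
  have hi : ∀ (L : ℂ →L[ℝ] ℝ) (u : ℂ × ℂ → ℂ), LocallyIntegrable u (vol (wormDomain β)) →
      ∀ η : ℂ × ℂ → ℂ, Continuous η → HasCompactSupport η →
      Integrable (fun z => ((L (η z) : ℝ) : ℂ) * u z) (vol (wormDomain β)) := by
    intro L u hu η hη hηs
    exact integrable_mul_of_hasCompactSupport hu (χ := fun z => ((L (η z) : ℝ) : ℂ)) (by fun_prop)
      (hηs.comp_left (g := fun w => ((L w : ℝ) : ℂ)) (by simp))
  have split : ∀ (u : ℂ × ℂ → ℂ), LocallyIntegrable u (vol (wormDomain β)) →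
      ∀ η : ℂ × ℂ → ℂ, Continuous η → HasCompactSupport η →
      ∫ z in wormDomain β, η z * u z =
        (∫ z in wormDomain β, ((Complex.reCLM (η z) : ℝ) : ℂ) * u z) +
        Complex.I * ∫ z in wormDomain β, ((Complex.imCLM (η z) : ℝ) : ℂ) * u z := by
    intro u hu η hη hηs
    rw [← integral_const_mul, ← integral_add (hi _ u hu η hη hηs)
      ((hi _ u hu η hη hηs).const_mul _)]
    refine integral_congr_ae (Filter.Eventually.of_forall fun z => ?_)
    simp only [Complex.reCLM_apply, Complex.imCLM_apply]
    conv_lhs => rw [← Complex.re_add_im (η z)]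
    ring
  have hχ' : Continuous fun z => fderiv ℝ χ z (coordDir i) :=
    (hχ.continuous_fderiv (by simp)).clm_apply continuous_const
  rw [split f hf _ hχ' (hs.fderiv_apply (𝕜 := ℝ) _), split g hg _ hχ.continuous hs, hre, him]
  ring

/-- The product rule. -/
lemma HasWeakPartial.mul {β : ℝ} {i : Fin 4} {f g ψ ψ' : ℂ × ℂ → ℂ} (h : HasWeakPartial β i f g)
    (hf : LocallyIntegrable f (vol (wormDomain β))) (hg : LocallyIntegrable g (vol (wormDomain β)))
    (hψ : ContDiffOn ℝ ∞ ψ (wormDomain β))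
    (hψ' : ∀ z ∈ wormDomain β, fderiv ℝ ψ z (coordDir i) = ψ' z) :
    HasWeakPartial β i (fun z => ψ z * f z) (fun z => ψ' z * f z + ψ z * g z) := by
  intro φ hφ
  have hopen := isOpen_wormDomain β
  obtain ⟨h1, h2, h3⟩ := hφ.ofReal
  have hψ'c : ContinuousOn ψ' (wormDomain β) := by
    have := (hψ.continuousOn_fderiv_of_isOpen hopen (by simp)).clm_apply
      (continuousOn_const (c := coordDir i))
    exact this.congr fun z hz => (hψ' z hz).symm
  have hχ := contDiff_mul_of_tsupport_subset hopen h1 h3 hψ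
  have hχs : HasCompactSupport fun z => (φ z : ℂ) * ψ z := h2.mul_right
  have hχD : tsupport (fun z => (φ z : ℂ) * ψ z) ⊆ wormDomain β :=
    (tsupport_mul_subset_left (f := fun z => (φ z : ℂ)) (g := ψ)).trans h3
  -- The product φψ serves as a complex test function; it is smooth on all of ℂ² because φ is
  -- supported inside the domain.
  have key := h.integral_fderiv_mul hf hg hχ hχs hχD
  have hχ'c : Continuous fun z => fderiv ℝ (fun z => (φ z : ℂ) * ψ z) z (coordDir i) :=
    (hχ.continuous_fderiv (by simp)).clm_apply continuous_const
  have i1 : Integrable (fun z => fderiv ℝ (fun z => (φ z : ℂ) * ψ z) z (coordDir i) * f z)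
      (vol (wormDomain β)) :=
    integrable_mul_of_hasCompactSupport hf hχ'c (hχs.fderiv_apply (𝕜 := ℝ) _)
  have i2 : Integrable (fun z => (φ z : ℂ) * ψ' z * f z) (vol (wormDomain β)) :=
    integrable_mul_of_hasCompactSupport hf
      (continuous_mul_of_tsupport_subset hopen h1.continuous h3 hψ'c) h2.mul_right
  have i3 : Integrable (fun z => (φ z : ℂ) * ψ z * g z) (vol (wormDomain β)) :=
    integrable_mul_of_hasCompactSupport hg hχ.continuous hχs
  have e1 : ∫ z in wormDomain β, (partialDeriv i φ z : ℂ) * (ψ z * f z) =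
      ∫ z in wormDomain β, (fderiv ℝ (fun z => (φ z : ℂ) * ψ z) z (coordDir i) * f z -
        (φ z : ℂ) * ψ' z * f z) := by
    refine setIntegral_congr_fun (measurableSet_wormDomain β) fun z hz => ?_
    have d1 : DifferentiableAt ℝ (fun z => (φ z : ℂ)) z := h1.differentiable (by simp) z
    have d2 : DifferentiableAt ℝ ψ z :=
      (hψ.contDiffAt (hopen.mem_nhds hz)).differentiableAt (by simp)
    have d3 := fderiv_ofReal_comp (hφ.1.differentiable (by simp) z) (coordDir i)
    have d4 : fderiv ℝ (fun z => (φ z : ℂ) * ψ z) z (coordDir i) =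
        φ z * ψ' z + ψ z * (partialDeriv i φ z : ℂ) := by
      rw [fderiv_fun_mul d1 d2, ← hψ' z hz, partialDeriv, ← d3]
      rfl
    simp only [d4]
    ring
  have e2 : ∫ z in wormDomain β, (φ z : ℂ) * (ψ' z * f z + ψ z * g z) =
      ∫ z in wormDomain β, ((φ z : ℂ) * ψ' z * f z + (φ z : ℂ) * ψ z * g z) := by
    congr 1
    ext z
    ring
  rw [e1, e2, integral_sub i1 i2, integral_add i2 i3, key]
  ring

/-- Classical derivatives are weak derivatives. -/
lemma hasWeakPartial_of_fderiv {β : ℝ} {i : Fin 4} {G g : ℂ × ℂ → ℂ}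
    (hG : DifferentiableOn ℂ G (wormDomain β)) (hg : ContinuousOn g (wormDomain β))
    (h : ∀ z ∈ wormDomain β, fderiv ℂ G z (coordDir i) = g z) : HasWeakPartial β i G g := by
  intro φ hφ
  have hopen := isOpen_wormDomain β
  obtain ⟨h1, h2, h3⟩ := hφ.ofReal
  have hGc := hG.continuousOn
  have h1' : Continuous fun z => (partialDeriv i φ z : ℂ) :=
    Complex.continuous_ofReal.comp
      ((hφ.1.continuous_fderiv (by simp)).clm_apply continuous_const)
  have hsub : tsupport (fun z => (partialDeriv i φ z : ℂ)) ⊆ tsupport φ := by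
    refine closure_minimal (fun z hz => ?_) (isClosed_tsupport φ)
    refine tsupport_fderiv_subset ℝ (subset_tsupport _ fun h0 => hz ?_)
    simp [partialDeriv, h0]
  have h2' : HasCompactSupport fun z => (partialDeriv i φ z : ℂ) :=
    hφ.2.1.of_isClosed_subset (isClosed_tsupport _) hsub
  have i1 := (continuous_mul_of_tsupport_subset hopen h1' (hsub.trans hφ.2.2)
    hGc).integrable_of_hasCompactSupport (μ := volume) h2'.mul_right
  have i2 := (continuous_mul_of_tsupport_subset hopen h1.continuous h3
    hg).integrable_of_hasCompactSupport (μ := volume) h2.mul_right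
  have i3 := (continuous_mul_of_tsupport_subset hopen h1.continuous h3
    hGc).integrable_of_hasCompactSupport (μ := volume) h2.mul_right
  have key := integral_bilinear_hasLineDerivAt_right_eq_neg_left_of_integrable
    (μ := (volume : Measure (ℂ × ℂ))) (v := coordDir i) (B := ContinuousLinearMap.mul ℝ ℂ)
    (f := fun z => (φ z : ℂ)) (f' := fun z => (partialDeriv i φ z : ℂ)) (g := G) (g' := g)
    i1 i2 i3 (fun z _ => ?_) fun z hz => ?_
  · simp only [ContinuousLinearMap.mul_apply'] at key
    have hz : ∀ η : ℂ × ℂ → ℂ, tsupport η ⊆ wormDomain β → ∀ u : ℂ × ℂ → ℂ,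
        ∫ z in wormDomain β, η z * u z = ∫ z, η z * u z := fun η hη u =>
      setIntegral_eq_integral_of_forall_compl_eq_zero fun z hz => by
        rw [image_eq_zero_of_notMem_tsupport fun h0 => hz (hη h0), zero_mul]
    rw [hz _ (hsub.trans hφ.2.2), hz _ h3, key, neg_neg]
  · have hd := hφ.1.differentiable (by simp) z
    have := ((h1.differentiable (by simp) z).hasFDerivAt (𝕜 := ℝ)).hasLineDerivAt (coordDir i)
    rwa [fderiv_ofReal_comp hd] at this
  · have hzD := h3 hz
    have := (((hG z hzD).differentiableAt (hopen.mem_nhds hzD)).hasFDerivAt.restrictScalars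
      ℝ).hasLineDerivAt (coordDir i)
    rw [← h z hzD]
    exact this

lemma HasWeakPartial.hasWeakFlowDeriv_translation {β : ℝ} {f g : ℂ × ℂ → ℂ}
    (h : HasWeakPartial β 0 f g) : HasWeakFlowDeriv β 1 0 f g := by
  intro φ hφ
  rw [← h φ hφ]
  simp [partialDeriv, flowField, coordDir]

/-- The rotation field is x₂ ∂/∂y₂ - y₂ ∂/∂x₂. Neither coefficient depends on the variable being
differentiated, so integration by parts leaves no zero-order term. -/
lemma HasWeakPartial.hasWeakFlowDeriv_rotation {β : ℝ} {f g₂ g₃ : ℂ × ℂ → ℂ}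
    (h₂ : HasWeakPartial β 2 f g₂) (h₃ : HasWeakPartial β 3 f g₃)
    (hf : LocallyIntegrable f (vol (wormDomain β)))
    (hg₂ : LocallyIntegrable g₂ (vol (wormDomain β)))
    (hg₃ : LocallyIntegrable g₃ (vol (wormDomain β))) :
    HasWeakFlowDeriv β 0 1 f
      (fun z => ((z.2.re : ℝ) : ℂ) * g₃ z + -((z.2.im : ℝ) : ℂ) * g₂ z) := by
  intro φ hφ
  have hre : HasWeakPartial β 3 (fun z => ((z.2.re : ℝ) : ℂ) * f z)
      (fun z => 0 * f z + ((z.2.re : ℝ) : ℂ) * g₃ z) := by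
    let L : ℂ × ℂ →L[ℝ] ℂ := Complex.ofRealCLM.comp (Complex.reCLM.comp (ContinuousLinearMap.snd ℝ ℂ ℂ))
    refine h₃.mul (ψ := L) (ψ' := fun _ => 0) hf hg₃ L.contDiff.contDiffOn fun z _ => ?_
    rw [L.fderiv]
    simp [L, coordDir]
  have him : HasWeakPartial β 2 (fun z => -((z.2.im : ℝ) : ℂ) * f z)
      (fun z => 0 * f z + -((z.2.im : ℝ) : ℂ) * g₂ z) := by
    let L : ℂ × ℂ →L[ℝ] ℂ :=
      -Complex.ofRealCLM.comp (Complex.imCLM.comp (ContinuousLinearMap.snd ℝ ℂ ℂ))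
    refine h₂.mul (ψ := L) (ψ' := fun _ => 0) hf hg₂ L.contDiff.contDiffOn fun z _ => ?_
    rw [L.fderiv]
    simp [L, coordDir]
  obtain ⟨h1, h2, h3⟩ := hφ.ofReal
  have hd : ∀ j, Continuous fun z => (partialDeriv j φ z : ℂ) := fun j =>
    Complex.continuous_ofReal.comp
      ((hφ.1.continuous_fderiv (by simp)).clm_apply continuous_const)
  have hds : ∀ j, HasCompactSupport fun z => (partialDeriv j φ z : ℂ) := fun j =>
    (hφ.2.1.fderiv_apply (𝕜 := ℝ) (coordDir j)).comp_left (g := fun x : ℝ => (x : ℂ)) (by simp)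
  have i1 : Integrable (fun z => (partialDeriv 3 φ z : ℂ) * (((z.2.re : ℝ) : ℂ) * f z))
      (vol (wormDomain β)) := by
    simp_rw [← mul_assoc]
    exact integrable_mul_of_hasCompactSupport hf ((hd 3).mul (by fun_prop)) (hds 3).mul_right
  have i2 : Integrable (fun z => (partialDeriv 2 φ z : ℂ) * (-((z.2.im : ℝ) : ℂ) * f z))
      (vol (wormDomain β)) := by
    simp_rw [← mul_assoc]
    exact integrable_mul_of_hasCompactSupport hf ((hd 2).mul (by fun_prop)) (hds 2).mul_right
  have i3 : Integrable (fun z => (φ z : ℂ) * (0 * f z + ((z.2.re : ℝ) : ℂ) * g₃ z))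
      (vol (wormDomain β)) := by
    simp_rw [zero_mul, zero_add, ← mul_assoc]
    exact integrable_mul_of_hasCompactSupport hg₃ (h1.continuous.mul (by fun_prop)) h2.mul_right
  have i4 : Integrable (fun z => (φ z : ℂ) * (0 * f z + -((z.2.im : ℝ) : ℂ) * g₂ z))
      (vol (wormDomain β)) := by
    simp_rw [zero_mul, zero_add, ← mul_assoc]
    exact integrable_mul_of_hasCompactSupport hg₂ (h1.continuous.mul (by fun_prop)) h2.mul_right
  have e1 : ∫ z in wormDomain β, ((fderiv ℝ φ z (flowField 0 1 z) : ℝ) : ℂ) * f z =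
      ∫ z in wormDomain β, ((partialDeriv 3 φ z : ℂ) * (((z.2.re : ℝ) : ℂ) * f z) +
        (partialDeriv 2 φ z : ℂ) * (-((z.2.im : ℝ) : ℂ) * f z)) := by
    refine integral_congr_ae (Filter.Eventually.of_forall fun z => ?_)
    have hv : flowField 0 1 z = z.2.re • coordDir 3 + (-z.2.im) • coordDir 2 := by
      refine Prod.ext ?_ ?_
      · simp [flowField, coordDir]
      · apply Complex.ext <;> simp [flowField, coordDir]
    simp only [hv, map_add, map_smul, smul_eq_mul, partialDeriv]
    push_cast
    ring
  have e2 : ∫ z in wormDomain β, (φ z : ℂ) * (((z.2.re : ℝ) : ℂ) * g₃ z +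
        -((z.2.im : ℝ) : ℂ) * g₂ z) =
      ∫ z in wormDomain β, ((φ z : ℂ) * (0 * f z + ((z.2.re : ℝ) : ℂ) * g₃ z) +
        (φ z : ℂ) * (0 * f z + -((z.2.im : ℝ) : ℂ) * g₂ z)) := by
    congr 1
    ext z
    ring
  rw [e1, e2, integral_add i1 i2, integral_add i3 i4, hre φ hφ, him φ hφ]
  ring

/-! ### Sobolev bounds -/

/-- All iterated weak partial derivatives of `f` of order at most `k` exist and have `L^p` norm at
most `C`. -/
def HasSobolevBound (β : ℝ) (p : ℝ≥0∞) : ℕ → (ℂ × ℂ → ℂ) → NNReal → Prop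
  | 0, f, C => MemLp f p (vol (wormDomain β)) ∧ eLpNorm f p (vol (wormDomain β)) ≤ C
  | k + 1, f, C => (MemLp f p (vol (wormDomain β)) ∧ eLpNorm f p (vol (wormDomain β)) ≤ C) ∧
      ∀ i, ∃ g, HasWeakPartial β i f g ∧ HasSobolevBound β p k g C

namespace HasSobolevBound

variable {β : ℝ} {p : ℝ≥0∞} {k : ℕ} {f g : ℂ × ℂ → ℂ} {C C' : NNReal}

lemma base (h : HasSobolevBound β p k f C) :
    MemLp f p (vol (wormDomain β)) ∧ eLpNorm f p (vol (wormDomain β)) ≤ C := by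
  cases k with
  | zero => exact h
  | succ k => exact h.1

lemma locallyIntegrable (h : HasSobolevBound β p k f C) (hp : 1 ≤ p) :
    LocallyIntegrable f (vol (wormDomain β)) := h.base.1.locallyIntegrable hp

lemma mono (h : HasSobolevBound β p k f C) (hC : C ≤ C') : HasSobolevBound β p k f C' := by
  have hC' : (C : ℝ≥0∞) ≤ C' := ENNReal.coe_le_coe.2 hC
  induction k generalizing f with
  | zero => exact ⟨h.1, h.2.trans hC'⟩
  | succ k ih =>
    refine ⟨⟨h.1.1, h.1.2.trans hC'⟩, fun i => ?_⟩
    obtain ⟨g, hg, hb⟩ := h.2 i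
    exact ⟨g, hg, ih hb⟩

lemma of_succ (h : HasSobolevBound β p (k + 1) f C) : HasSobolevBound β p k f C := by
  induction k generalizing f with
  | zero => exact h.1
  | succ k ih =>
    refine ⟨h.1, fun i => ?_⟩
    obtain ⟨g, hg, hb⟩ := h.2 i
    exact ⟨g, hg, ih hb⟩

end HasSobolevBound

lemma HasWeakPartial.add {β : ℝ} {i : Fin 4} {f f' g g' : ℂ × ℂ → ℂ}
    (h : HasWeakPartial β i f g) (h' : HasWeakPartial β i f' g')
    (hf : LocallyIntegrable f (vol (wormDomain β)))
    (hf' : LocallyIntegrable f' (vol (wormDomain β)))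
    (hg : LocallyIntegrable g (vol (wormDomain β)))
    (hg' : LocallyIntegrable g' (vol (wormDomain β))) :
    HasWeakPartial β i (fun z => f z + f' z) (fun z => g z + g' z) := by
  intro φ hφ
  obtain ⟨h1, h2, -⟩ := hφ.ofReal
  have hd : Continuous fun z => (partialDeriv i φ z : ℂ) :=
    Complex.continuous_ofReal.comp
      ((hφ.1.continuous_fderiv (by simp)).clm_apply continuous_const)
  have hds : HasCompactSupport fun z => (partialDeriv i φ z : ℂ) :=
    (hφ.2.1.fderiv_apply (𝕜 := ℝ) (coordDir i)).comp_left (g := fun x : ℝ => (x : ℂ)) (by simp)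
  simp_rw [mul_add]
  rw [integral_add (integrable_mul_of_hasCompactSupport hf hd hds)
    (integrable_mul_of_hasCompactSupport hf' hd hds),
    integral_add (integrable_mul_of_hasCompactSupport hg h1.continuous h2)
    (integrable_mul_of_hasCompactSupport hg' h1.continuous h2), h φ hφ, h' φ hφ]
  ring

lemma HasSobolevBound.add {β : ℝ} {p : ℝ≥0∞} {k : ℕ} {f g : ℂ × ℂ → ℂ} {C C' : NNReal}
    (hp : 1 ≤ p) (h : HasSobolevBound β p k f C) (h' : HasSobolevBound β p k g C') :
    HasSobolevBound β p k (fun z => f z + g z) (C + C') := by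
  have base : MemLp (fun z => f z + g z) p (vol (wormDomain β)) ∧
      eLpNorm (fun z => f z + g z) p (vol (wormDomain β)) ≤ (C + C' : NNReal) := by
    refine ⟨h.base.1.add h'.base.1, (eLpNorm_add_le h.base.1.1 h'.base.1.1 hp).trans ?_⟩
    rw [ENNReal.coe_add]
    exact add_le_add h.base.2 h'.base.2
  induction k generalizing f g with
  | zero => exact base
  | succ k ih =>
    refine ⟨base, fun i => ?_⟩
    obtain ⟨u, hu, hb⟩ := h.2 i
    obtain ⟨u', hu', hb'⟩ := h'.2 i
    refine ⟨_, hu.add hu' (h.locallyIntegrable hp) (h'.locallyIntegrable hp)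
      (hb.locallyIntegrable hp) (hb'.locallyIntegrable hp), ih hb hb' ?_⟩
    refine ⟨hb.base.1.add hb'.base.1, (eLpNorm_add_le hb.base.1.1 hb'.base.1.1 hp).trans ?_⟩
    rw [ENNReal.coe_add]
    exact add_le_add hb.base.2 hb'.base.2

/-- Operators on functions that preserve Sobolev bounds up to a constant. -/
def IsSobolevBounded (β : ℝ) (p : ℝ≥0∞) (k : ℕ) (T : (ℂ × ℂ → ℂ) → ℂ × ℂ → ℂ) : Prop :=
  ∃ K : NNReal, ∀ f C, HasSobolevBound β p k f C → HasSobolevBound β p k (T f) (K * C)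

lemma IsSobolevBounded.comp {β : ℝ} {p : ℝ≥0∞} {k : ℕ} {S T : (ℂ × ℂ → ℂ) → ℂ × ℂ → ℂ}
    (hS : IsSobolevBounded β p k S) (hT : IsSobolevBounded β p k T) :
    IsSobolevBounded β p k (fun f => S (T f)) := by
  obtain ⟨K, hK⟩ := hS
  obtain ⟨L, hL⟩ := hT
  refine ⟨K * L, fun f C h => ?_⟩
  rw [mul_assoc]
  exact hK _ _ (hL _ _ h)

/-- Multiplication by `ψ` preserves Sobolev bounds. -/
abbrev IsSobolevMultiplier (β : ℝ) (p : ℝ≥0∞) (k : ℕ) (ψ : ℂ × ℂ → ℂ) : Prop :=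
  IsSobolevBounded β p k fun f z => ψ z * f z

lemma IsSobolevMultiplier.mul {β : ℝ} {p : ℝ≥0∞} {k : ℕ} {ψ χ : ℂ × ℂ → ℂ}
    (hψ : IsSobolevMultiplier β p k ψ) (hχ : IsSobolevMultiplier β p k χ) :
    IsSobolevMultiplier β p k (fun z => ψ z * χ z) := by
  have := IsSobolevBounded.comp hψ hχ
  simpa only [IsSobolevMultiplier, mul_assoc] using this

lemma bounded_mul_bound {β : ℝ} {p : ℝ≥0∞} {ψ f : ℂ × ℂ → ℂ} {M C : NNReal}
    (hψ : ContinuousOn ψ (wormDomain β)) (hM : ∀ z ∈ wormDomain β, ‖ψ z‖ ≤ M)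
    (h : MemLp f p (vol (wormDomain β)) ∧ eLpNorm f p (vol (wormDomain β)) ≤ C) :
    MemLp (fun z => ψ z * f z) p (vol (wormDomain β)) ∧
      eLpNorm (fun z => ψ z * f z) p (vol (wormDomain β)) ≤ (M * C : NNReal) := by
  obtain ⟨h1, h2⟩ := memLp_bounded_mul h.1 hψ hM
  refine ⟨h1, h2.trans ?_⟩
  rw [ENNReal.coe_mul, ENNReal.ofReal_coe_nnreal]
  exact mul_le_mul' le_rfl h.2

lemma isSobolevMultiplier_zero {β : ℝ} {p : ℝ≥0∞} {ψ : ℂ × ℂ → ℂ} {M : NNReal}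
    (hψ : ContinuousOn ψ (wormDomain β)) (hM : ∀ z ∈ wormDomain β, ‖ψ z‖ ≤ M) :
    IsSobolevMultiplier β p 0 ψ :=
  ⟨M, fun _ _ h => bounded_mul_bound hψ hM h⟩

/-- The inductive engine for multipliers: by the product rule, the derivatives of ψf involve only
ψ'f and ψ times a derivative of f, both controlled to order k. -/
lemma IsSobolevMultiplier.succ {β : ℝ} {p : ℝ≥0∞} (hp : 1 ≤ p) {k : ℕ} {ψ : ℂ × ℂ → ℂ} {M : NNReal}
    (hk : IsSobolevMultiplier β p k ψ)
    (hψ : ContDiffOn ℝ ∞ ψ (wormDomain β)) (hM : ∀ z ∈ wormDomain β, ‖ψ z‖ ≤ M)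
    {ψ' : Fin 4 → ℂ × ℂ → ℂ}
    (hd : ∀ i, ∀ z ∈ wormDomain β, fderiv ℝ ψ z (coordDir i) = ψ' i z)
    (hk' : ∀ i, IsSobolevMultiplier β p k (ψ' i)) : IsSobolevMultiplier β p (k + 1) ψ := by
  obtain ⟨K, hK⟩ := hk
  choose L hL using hk'
  refine ⟨M + (∑ i, L i + K), fun f C h => ⟨?_, fun i => ?_⟩⟩
  · obtain ⟨h1, h2⟩ := bounded_mul_bound hψ.continuousOn hM h.base
    refine ⟨h1, h2.trans (ENNReal.coe_le_coe.2 ?_)⟩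
    gcongr
    exact le_self_add
  · obtain ⟨g, hg, hb⟩ := h.2 i
    refine ⟨_, hg.mul (h.locallyIntegrable hp) (hb.locallyIntegrable hp) hψ (hd i),
      ((hL i f C h.of_succ).add hp (hK g C hb)).mono ?_⟩
    rw [← add_mul]
    refine mul_le_mul' (le_trans (add_le_add ?_ le_rfl) le_add_self) le_rfl
    exact Finset.single_le_sum (f := L) (fun _ _ => zero_le) (Finset.mem_univ i)

lemma isSobolevMultiplier_const (β : ℝ) {p : ℝ≥0∞} (hp : 1 ≤ p) (k : ℕ) (c : ℂ) :
    IsSobolevMultiplier β p k fun _ => c := by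
  induction k generalizing c with
  | zero => exact isSobolevMultiplier_zero (M := ‖c‖₊) continuousOn_const fun _ _ => le_rfl
  | succ k ih =>
    exact (ih c).succ hp (M := ‖c‖₊) contDiffOn_const (fun _ _ => le_rfl)
      (ψ' := fun _ _ => 0) (fun i z _ => by simp) fun i => ih 0

lemma isSobolevMultiplier_linear {β : ℝ} {p : ℝ≥0∞} (hp : 1 ≤ p) (k : ℕ) (L : ℂ × ℂ →L[ℝ] ℂ)
    {M : NNReal} (hM : ∀ z ∈ wormDomain β, ‖L z‖ ≤ M) : IsSobolevMultiplier β p k L := by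
  induction k with
  | zero => exact isSobolevMultiplier_zero L.continuous.continuousOn hM
  | succ k ih =>
    exact ih.succ hp L.contDiff.contDiffOn hM (ψ' := fun i _ => L (coordDir i))
      (fun i z _ => by rw [L.fderiv]) fun i => isSobolevMultiplier_const β hp k _

/-- A bound for `|z₂|` and `|z₂⁻¹|` on the worm domain. -/
def sndBound (β : ℝ) : NNReal := Real.toNNReal (Real.exp (β - Real.pi / 2))

lemma coe_sndBound (β : ℝ) : (sndBound β : ℝ) = Real.exp (β - Real.pi / 2) :=
  Real.coe_toNNReal _ (Real.exp_pos _).le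

lemma isSobolevMultiplier_snd (β : ℝ) {p : ℝ≥0∞} (hp : 1 ≤ p) (k : ℕ) :
    IsSobolevMultiplier β p k fun z => z.2 :=
  isSobolevMultiplier_linear hp k (ContinuousLinearMap.snd ℝ ℂ ℂ) (M := sndBound β) fun z hz => by
    rw [coe_sndBound]
    exact (norm_snd_le hz).1

lemma isSobolevMultiplier_re (β : ℝ) {p : ℝ≥0∞} (hp : 1 ≤ p) (k : ℕ) :
    IsSobolevMultiplier β p k fun z => ((z.2.re : ℝ) : ℂ) :=
  isSobolevMultiplier_linear hp k
    (Complex.ofRealCLM.comp (Complex.reCLM.comp (ContinuousLinearMap.snd ℝ ℂ ℂ)))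
    (M := sndBound β) fun z hz => by
      rw [coe_sndBound]
      refine le_trans ?_ (norm_snd_le hz).1
      simpa using Complex.abs_re_le_norm z.2

lemma isSobolevMultiplier_neg_im (β : ℝ) {p : ℝ≥0∞} (hp : 1 ≤ p) (k : ℕ) :
    IsSobolevMultiplier β p k fun z => -((z.2.im : ℝ) : ℂ) :=
  isSobolevMultiplier_linear hp k
    (-Complex.ofRealCLM.comp (Complex.imCLM.comp (ContinuousLinearMap.snd ℝ ℂ ℂ)))
    (M := sndBound β) fun z hz => by
      rw [coe_sndBound]
      refine le_trans ?_ (norm_snd_le hz).1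
      simpa using Complex.abs_im_le_norm z.2

/-- The derivatives of z₂⁻¹ are constant multiples of z₂⁻¹ · z₂⁻¹, a product of multipliers of the
preceding order, so the induction closes. -/
lemma isSobolevMultiplier_inv_snd (β : ℝ) {p : ℝ≥0∞} (hp : 1 ≤ p) (k : ℕ) :
    IsSobolevMultiplier β p k fun z => z.2⁻¹ := by
  have hM : ∀ z ∈ wormDomain β, ‖z.2⁻¹‖ ≤ sndBound β := fun z hz => by
    rw [coe_sndBound]
    exact (norm_snd_le hz).2
  induction k with
  | zero => exact isSobolevMultiplier_zero (continuousOn_inv_snd β) hM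
  | succ k ih =>
    refine ih.succ hp ?_ hM (ψ' := fun i z => -(coordDir i).2 * (z.2⁻¹ * z.2⁻¹)) (fun i z hz => ?_)
      fun i => (isSobolevMultiplier_const β hp k _).mul (ih.mul ih)
    · exact contDiff_snd.contDiffOn.inv fun z hz => hz.1
    · have h1 := (((hasDerivAt_inv hz.1).comp_hasFDerivAt z
        (hasFDerivAt_snd (𝕜 := ℂ) (p := z))).restrictScalars ℝ).fderiv
      rw [show (fun z : ℂ × ℂ => z.2⁻¹) = Inv.inv ∘ Prod.snd from rfl, h1]
      simp
      ring

/-- `wormOp` is bounded on Sobolev spaces. -/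
lemma isSobolevBounded_wormOp (β : ℝ) {p : ℝ≥0∞} (hp1 : 1 < p) (hp2 : p < ⊤) (k : ℕ) :
    IsSobolevBounded β p k (wormOp β) := by
  obtain ⟨K, hK⟩ := exists_eLpNorm_wormOp_le β hp1 hp2
  have base : ∀ f (C : NNReal),
      MemLp f p (vol (wormDomain β)) ∧ eLpNorm f p (vol (wormDomain β)) ≤ C →
      MemLp (wormOp β f) p (vol (wormDomain β)) ∧
        eLpNorm (wormOp β f) p (vol (wormDomain β)) ≤ (K * C : NNReal) := by
    intro f C hf
    obtain ⟨h1, h2⟩ := hK f hf.1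
    refine ⟨h1, h2.trans ?_⟩
    rw [ENNReal.coe_mul]
    exact mul_le_mul' le_rfl hf.2
  have hp := hp1.le
  induction k with
  | zero => exact ⟨K, base⟩
  | succ k ih =>
    obtain ⟨A, hA⟩ := (isSobolevMultiplier_re β hp k)
    obtain ⟨B, hB⟩ := (isSobolevMultiplier_neg_im β hp k)
    have h1 : ∀ i, IsSobolevBounded β p k fun f z => (coordDir i).1 * wormOp β f z := fun i =>
      (isSobolevMultiplier_const β hp k (coordDir i).1).comp ih
    have h2 : ∀ i, IsSobolevBounded β p k fun f z =>
        -Complex.I * (coordDir i).2 * (z.2⁻¹ * wormOp β f z) := fun i =>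
      (isSobolevMultiplier_const β hp k (-Complex.I * (coordDir i).2)).comp
        ((isSobolevMultiplier_inv_snd β hp k).comp ih)
    choose L₁ hL₁ using h1
    choose L₂ hL₂ using h2
    refine ⟨K + ∑ i, (L₁ i + L₂ i * (A + B)), fun f C h => ⟨?_, fun i => ?_⟩⟩
    · obtain ⟨h1, h2⟩ := base f C h.base
      refine ⟨h1, h2.trans (ENNReal.coe_le_coe.2 ?_)⟩
      gcongr
      exact le_self_add
    · obtain ⟨g₀, hg₀, hb₀⟩ := h.2 0
      obtain ⟨g₂, hg₂, hb₂⟩ := h.2 2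
      obtain ⟨g₃, hg₃, hb₃⟩ := h.2 3
      -- The weak rotational derivative of f, of Sobolev order k because its coefficients are
      -- multipliers.
      set γ : ℂ × ℂ → ℂ := fun z => ((z.2.re : ℝ) : ℂ) * g₃ z + -((z.2.im : ℝ) : ℂ) * g₂ z
      have hγ : HasSobolevBound β p k γ (A * C + B * C) := (hA _ _ hb₃).add hp (hB _ _ hb₂)
      have hf := h.base.1
      have hrot := hg₂.hasWeakFlowDeriv_rotation hg₃ (h.locallyIntegrable hp)
        (hb₂.locallyIntegrable hp) (hb₃.locallyIntegrable hp)
      refine ⟨fun z => (coordDir i).1 * wormOp β g₀ z +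
        -Complex.I * (coordDir i).2 * (z.2⁻¹ * wormOp β γ z), ?_, ?_⟩
      · refine hasWeakPartial_of_fderiv (differentiableOn_wormOp hp1 hp2 hf) ?_ fun z hz => ?_
        · have c1 := (differentiableOn_wormOp hp1 hp2 hb₀.base.1).continuousOn
          have c2 := (differentiableOn_wormOp hp1 hp2 hγ.base.1).continuousOn
          exact (continuousOn_const.mul c1).add
            (continuousOn_const.mul ((continuousOn_inv_snd β).mul c2))
        · rw [← hg₀.hasWeakFlowDeriv_translation.fderiv_wormOp hp1 hp2 hf hb₀.base.1 hz,
            ← hrot.fderiv_wormOp hp1 hp2 hf hγ.base.1 hz, ← smul_eq_mul, ← smul_eq_mul,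
            ← smul_eq_mul z.2⁻¹, ← map_smul, ← map_smul, ← map_smul, ← map_add]
          -- The direction (a, b) equals a(1, 0) - i b z₂⁻¹ (0, i z₂), a complex combination of the
          -- two flow fields. Complex linearity of the derivative makes these two fields enough for
          -- all four real directions.
          congr 1
          have hz2 : z.2 ≠ 0 := hz.1
          refine Prod.ext ?_ ?_
          · simp [flowField]
          · simp only [flowField, Prod.snd_add, Prod.smul_snd, smul_eq_mul]
            push_cast
            field_simp
            ring_nf
            simp
      · refine ((hL₁ i _ _ hb₀).add hp (hL₂ i _ _ hγ)).mono ?_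
        rw [← add_mul, ← mul_assoc, ← add_mul]
        refine mul_le_mul' (le_trans ?_ le_add_self) le_rfl
        exact Finset.single_le_sum (f := fun i => L₁ i + L₂ i * (A + B)) (fun _ _ => zero_le)
          (Finset.mem_univ i)

/-- The Bergman projection is bounded on Sobolev spaces. -/
lemma isSobolevBounded_wormProj (β : ℝ) {p : ℝ≥0∞} (hp1 : 1 < p) (hp2 : p < ⊤) (k : ℕ) :
    IsSobolevBounded β p k (wormProj β) :=
  (isSobolevMultiplier_inv_snd β hp1.le k).comp
    ((isSobolevBounded_wormOp β hp1 hp2 k).comp (isSobolevMultiplier_snd β hp1.le k))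

/-! ### Sobolev spaces and Sobolev bounds -/

lemma IsTestFunction.iterate_partialDeriv {D : Set (ℂ × ℂ)} {φ : ℂ × ℂ → ℝ}
    (h : IsTestFunction D φ) (i : Fin 4) (n : ℕ) : IsTestFunction D ((partialDeriv i)^[n] φ) := by
  have h1 := partialDeriv_iterate_good i n ⟨h.1, h.2.1⟩
  refine ⟨h1.1, h1.2, ?_⟩
  clear h1
  induction n with
  | zero => exact h.2.2
  | succ n ih =>
    rw [Function.iterate_succ_apply']
    refine (closure_minimal (fun z hz => ?_) (isClosed_tsupport _)).trans ih
    refine tsupport_fderiv_subset ℝ (subset_tsupport _ fun h0 => hz ?_)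
    simp [partialDeriv, h0]

lemma partialDeriv_comm {φ : ℂ × ℂ → ℝ} (h : ContDiff ℝ ∞ φ) (i j : Fin 4) :
    partialDeriv i (partialDeriv j φ) = partialDeriv j (partialDeriv i φ) := by
  have hd : ∀ z, DifferentiableAt ℝ (fderiv ℝ φ) z := fun z =>
    (h.fderiv_right (m := ∞) (by simp)).differentiable (by simp) z
  have h2 : ∀ i j z, partialDeriv i (partialDeriv j φ) z =
      fderiv ℝ (fderiv ℝ φ) z (coordDir i) (coordDir j) := by
    intro i j z
    unfold partialDeriv
    rw [fderiv_clm_apply (hd z) (differentiableAt_const _)]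
    simp
  ext z
  rw [h2, h2]
  exact (h.contDiffAt.isSymmSndFDerivAt (by
    simpa using WithTop.coe_le_coe.2 (le_top : (2 : ℕ∞) ≤ ⊤))).eq _ _

lemma partialDeriv_iterate_comm {φ : ℂ × ℂ → ℝ} (h : ContDiff ℝ ∞ φ ∧ HasCompactSupport φ)
    (i j : Fin 4) (n : ℕ) :
    partialDeriv i ((partialDeriv j)^[n] φ) = (partialDeriv j)^[n] (partialDeriv i φ) := by
  induction n with
  | zero => rfl
  | succ n ih =>
    rw [Function.iterate_succ_apply', Function.iterate_succ_apply', ← ih,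
      partialDeriv_comm (partialDeriv_iterate_good j n h).1]

/-- `multiDeriv` fixes the order of differentiation; symmetry of second derivatives lets the
additional one be taken first. -/
lemma multiDeriv_add_single (α : Fin 4 → ℕ) (i : Fin 4) {φ : ℂ × ℂ → ℝ}
    (h : ContDiff ℝ ∞ φ ∧ HasCompactSupport φ) :
    multiDeriv (α + Pi.single i 1) φ = multiDeriv α (partialDeriv i φ) := by
  have h3 := partialDeriv_iterate_good 3 (α 3) h
  have h2 := partialDeriv_iterate_good 2 (α 2) h3
  have h1 := partialDeriv_iterate_good 1 (α 1) h2
  unfold multiDeriv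
  fin_cases i
  · simp [Function.iterate_succ_apply, partialDeriv_iterate_comm h,
      partialDeriv_iterate_comm h3, partialDeriv_iterate_comm h2]
  · simp [Function.iterate_succ_apply, partialDeriv_iterate_comm h,
      partialDeriv_iterate_comm h3]
  · simp [Function.iterate_succ_apply, partialDeriv_iterate_comm h]
  · simp [Function.iterate_succ_apply]

/-- A multi-index from its entries. -/
def MultiIndex.ofNat {k : ℕ} (α : Fin 4 → ℕ) (h : ∑ i, α i ≤ k) : MultiIndex k :=
  ⟨fun i => ⟨α i, Nat.lt_succ_of_le ((Finset.single_le_sum (fun _ _ => Nat.zero_le _)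
    (Finset.mem_univ i)).trans h)⟩, h⟩

lemma MultiIndex.toNat_ofNat {k : ℕ} (α : Fin 4 → ℕ) (h : ∑ i, α i ≤ k) :
    (MultiIndex.ofNat α h).toNat = α := rfl

/-- The defining relations only link each component to the zeroth one. Testing the relation for α on
∂ᵢφ and that for α + eᵢ on φ gives the same left side, so the second component is the weak i-th
partial of the first. -/
lemma hasSobolevBound_component {β : ℝ} {p : ℝ≥0∞} [Fact (1 ≤ p)] {k : ℕ}
    (u : sobolevSpace (wormDomain β) k p) (j : ℕ) (α : Fin 4 → ℕ) (h : ∑ i, α i + j ≤ k) :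
    HasSobolevBound β p j (u.1 (MultiIndex.ofNat α ((Nat.le_add_right _ j).trans h))) ‖u‖₊ := by
  have base : ∀ α : MultiIndex k, MemLp (u.1 α) p (vol (wormDomain β)) ∧
      eLpNorm (u.1 α) p (vol (wormDomain β)) ≤ ‖u‖₊ := by
    intro α
    refine ⟨Lp.memLp _, ?_⟩
    rw [← Lp.enorm_def]
    exact ENNReal.coe_le_coe.2 (PiLp.nnnorm_apply_le u.1 α)
  induction j generalizing α with
  | zero => exact base _
  | succ j ih =>
    refine ⟨base _, fun i => ?_⟩
    have hs : ∑ l, (α + Pi.single i 1 : Fin 4 → ℕ) l = ∑ l, α l + 1 := by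
      simp [Finset.sum_add_distrib, Finset.sum_pi_single']
    refine ⟨_, fun φ hφ => ?_, ih (α + Pi.single i 1) (by rw [hs]; omega)⟩
    have h1 := u.2 (MultiIndex.ofNat α ((Nat.le_add_right _ _).trans h)) _ (hφ.iterate_partialDeriv i 1)
    have h2 := u.2 (MultiIndex.ofNat (α + Pi.single i 1) (by rw [hs]; omega)) _ hφ
    rw [MultiIndex.toNat_ofNat] at h1 h2
    rw [multiDeriv_add_single α i ⟨hφ.1, hφ.2.1⟩] at h2
    rw [Function.iterate_one] at h1
    have hpow := congrArg (fun n => (-1 : ℂ) ^ n) hs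
    rw [h1, show (-1 : ℂ) ^ _ = _ from hpow, pow_succ, mul_assoc] at h2
    have h3 := mul_left_cancel₀ (pow_ne_zero _ (by norm_num)) h2
    rw [h3]
    ring

lemma sobolevSpace.hasSobolevBound {β : ℝ} {p : ℝ≥0∞} [Fact (1 ≤ p)] {k : ℕ}
    (u : sobolevSpace (wormDomain β) k p) : HasSobolevBound β p k (sobolevSpace.toLp u) ‖u‖₊ :=
  hasSobolevBound_component u k (fun _ => 0) (by simp)

lemma HasSobolevBound.exists_iterate {β : ℝ} {p : ℝ≥0∞} {k : ℕ} (i : Fin 4) (n : ℕ)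
    {f : ℂ × ℂ → ℂ} {C : NNReal} (h : HasSobolevBound β p (k + n) f C) :
    ∃ g, HasSobolevBound β p k g C ∧ ∀ φ, IsTestFunction (wormDomain β) φ →
      ∫ z in wormDomain β, ((partialDeriv i)^[n] φ z : ℂ) * f z =
        (-1) ^ n * ∫ z in wormDomain β, (φ z : ℂ) * g z := by
  induction n generalizing f with
  | zero => exact ⟨f, h, fun φ _ => by simp⟩
  | succ n ih =>
    obtain ⟨g₁, hg₁, hb₁⟩ := h.2 i
    obtain ⟨g, hg, hgφ⟩ := ih hb₁
    refine ⟨g, hg, fun φ hφ => ?_⟩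
    rw [Function.iterate_succ_apply', hg₁ _ (hφ.iterate_partialDeriv i n), hgφ φ hφ]
    ring

/-- Integrations by parts remove the derivatives from the test function from the outside inwards, in
the order 0, 1, 2, 3 of `multiDeriv`. -/
lemma HasSobolevBound.exists_hasWeakDeriv {β : ℝ} {p : ℝ≥0∞} {k : ℕ}
    {f : ℂ × ℂ → ℂ} {C : NNReal} (h : HasSobolevBound β p k f C) (α : Fin 4 → ℕ)
    (hα : ∑ i, α i ≤ k) :
    ∃ g, (MemLp g p (vol (wormDomain β)) ∧ eLpNorm g p (vol (wormDomain β)) ≤ C) ∧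
      HasWeakDeriv (wormDomain β) α f g := by
  obtain ⟨m, hm⟩ := Nat.exists_eq_add_of_le' hα
  rw [Fin.sum_univ_four] at hm
  have h' : HasSobolevBound β p (m + α 3 + α 2 + α 1 + α 0) f C := by
    rwa [show m + α 3 + α 2 + α 1 + α 0 = k by omega]
  obtain ⟨g₀, hb₀, h₀⟩ := h'.exists_iterate 0
  obtain ⟨g₁, hb₁, h₁⟩ := hb₀.exists_iterate 1
  obtain ⟨g₂, hb₂, h₂⟩ := hb₁.exists_iterate 2
  obtain ⟨g₃, hb₃, h₃⟩ := hb₂.exists_iterate 3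
  refine ⟨g₃, hb₃.base, fun φ hφ => ?_⟩
  have t3 := hφ.iterate_partialDeriv 3 (α 3)
  have t2 := t3.iterate_partialDeriv 2 (α 2)
  have t1 := t2.iterate_partialDeriv 1 (α 1)
  rw [multiDeriv, h₀ _ t1, h₁ _ t2, h₂ _ t3, h₃ _ hφ, Fin.sum_univ_four]
  ring

lemma HasWeakDeriv.congr {D : Set (ℂ × ℂ)} {α : Fin 4 → ℕ} {f f' g g' : ℂ × ℂ → ℂ}
    (h : HasWeakDeriv D α f g) (hf : f =ᵐ[vol D] f') (hg : g =ᵐ[vol D] g') :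
    HasWeakDeriv D α f' g' := by
  intro φ hφ
  have h1 : ∫ z in D, (multiDeriv α φ z : ℂ) * f' z = ∫ z in D, (multiDeriv α φ z : ℂ) * f z :=
    integral_congr_ae (hf.mono fun z hz => by simp only [hz])
  have h2 : ∫ z in D, (φ z : ℂ) * g' z = ∫ z in D, (φ z : ℂ) * g z :=
    integral_congr_ae (hg.mono fun z hz => by simp only [hz])
  rw [h1, h2, h φ hφ]

lemma exists_sobolevSpace_of_hasSobolevBound (β : ℝ) (p : ℝ≥0∞) [Fact (1 ≤ p)] (k : ℕ) :
    ∃ K : NNReal, ∀ f C, HasSobolevBound β p k f C →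
      ∃ v : sobolevSpace (wormDomain β) k p, sobolevSpace.toLp v =ᵐ[vol (wormDomain β)] f ∧ ‖v‖ ≤ K * C := by
  -- The cost of passing from the maximum over the finitely many multi-indices to the ℓ^p norm.
  obtain ⟨K, hK⟩ : ∃ K : NNReal, ∀ (w : MultiIndex k → Lp ℂ p (vol (wormDomain β))),
      ‖WithLp.toLp p w‖ ≤ K * ‖w‖ := by
    refine ⟨(Fintype.card (MultiIndex k) : NNReal) ^ (1 / p).toReal, fun w => ?_⟩
    have := (PiLp.lipschitzWith_toLp p
      (fun _ : MultiIndex k => Lp ℂ p (vol (wormDomain β)))).norm_le_mul (WithLp.toLp_zero p) w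
    exact this
  refine ⟨K, fun f C h => ?_⟩
  -- The choice at α = 0 is forced to be f itself, so that f underlies the element being built.
  have hex : ∀ α : MultiIndex k, ∃ g : ℂ × ℂ → ℂ,
      (MemLp g p (vol (wormDomain β)) ∧ eLpNorm g p (vol (wormDomain β)) ≤ C) ∧
      HasWeakDeriv (wormDomain β) α.toNat f g ∧ (α = MultiIndex.zero k → g = f) := by
    intro α
    by_cases hα : α = MultiIndex.zero k
    · refine ⟨f, h.base, fun φ _ => ?_, fun _ => rfl⟩
      subst hα
      simp [MultiIndex.toNat, MultiIndex.zero, multiDeriv]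
    · obtain ⟨g, hg, hw⟩ := h.exists_hasWeakDeriv α.toNat α.2
      exact ⟨g, hg, hw, fun h0 => absurd h0 hα⟩
  choose g hg hw h0 using hex
  have hz : g (MultiIndex.zero k) = f := h0 _ rfl
  have hae : ∀ α, (hg α).1.toLp (g α) =ᵐ[vol (wormDomain β)] g α := fun α => (hg α).1.coeFn_toLp
  have hae0 := (hae (MultiIndex.zero k)).trans (Filter.EventuallyEq.of_eq hz)
  refine ⟨⟨WithLp.toLp p fun α => (hg α).1.toLp (g α), fun α =>
    (hw α).congr ?_ (hae α).symm⟩, ?_, (hK _).trans ?_⟩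
  · exact hae0.symm
  · exact hae0
  · gcongr
    refine (pi_norm_le_iff_of_nonneg C.coe_nonneg).2 fun α => ?_
    rw [Lp.norm_toLp]
    exact ENNReal.toReal_le_of_le_ofReal C.coe_nonneg ((hg α).2.trans (by rw [ENNReal.ofReal_coe_nnreal]))

/-- Weak derivatives are unique. -/
lemma ae_eq_of_integral_testFunction_mul_eq {D : Set (ℂ × ℂ)} (hD : IsOpen D) {f g : ℂ × ℂ → ℂ}
    (hf : LocallyIntegrable f (vol D)) (hg : LocallyIntegrable g (vol D))
    (h : ∀ φ, IsTestFunction D φ →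
      ∫ z in D, (φ z : ℂ) * f z = ∫ z in D, (φ z : ℂ) * g z) : f =ᵐ[vol D] g := by
  have key := hD.ae_eq_zero_of_integral_contDiff_smul_eq_zero (μ := vol D) (f := fun z => f z - g z)
    ((hf.sub hg).locallyIntegrableOn _) fun φ h1 h2 h3 => by
      have hφ : IsTestFunction D φ := ⟨h1, h2, h3⟩
      have i1 := integrable_mul_of_hasCompactSupport hf hφ.ofReal.1.continuous hφ.ofReal.2.1
      have i2 := integrable_mul_of_hasCompactSupport hg hφ.ofReal.1.continuous hφ.ofReal.2.1
      simp_rw [Complex.real_smul, mul_sub]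
      rw [integral_sub i1 i2, h φ hφ, sub_self]
  filter_upwards [key, ae_restrict_mem hD.measurableSet] with z h1 h2
  exact sub_eq_zero.1 (h1 h2)

/-- An element of a Sobolev space is determined by its underlying function. -/
lemma sobolevSpace.toLp_injective {β : ℝ} {p : ℝ≥0∞} [hp : Fact (1 ≤ p)] {k : ℕ}
    {u v : sobolevSpace (wormDomain β) k p}
    (h : sobolevSpace.toLp u =ᵐ[vol (wormDomain β)] sobolevSpace.toLp v) : u = v := by
  refine Subtype.ext (PiLp.ext fun α => Lp.ext ?_)
  refine ae_eq_of_integral_testFunction_mul_eq (isOpen_wormDomain β)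
    ((Lp.memLp _).locallyIntegrable hp.out) ((Lp.memLp _).locallyIntegrable hp.out) fun φ hφ => ?_
  have h1 := u.2 α φ hφ
  have h2 := HasWeakDeriv.congr (v.2 α) h.symm Filter.EventuallyEq.rfl φ hφ
  exact mul_left_cancel₀ (pow_ne_zero _ (by norm_num)) (h1.symm.trans h2)

/-! ### Linearity of the projection -/

lemma wormProj_congr {β : ℝ} {f g : ℂ × ℂ → ℂ} (h : f =ᵐ[vol (wormDomain β)] g) :
    wormProj β f = wormProj β g := by
  ext z
  simp only [wormProj, wormOp]
  rw [coverOp_congr (G := fun w => w.2 * g w) (h.mono fun w hw => by simp only [hw])]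

lemma wormProj_add {β : ℝ} {p : ℝ≥0∞} (hp1 : 1 < p) (hp2 : p < ⊤) {f g : ℂ × ℂ → ℂ}
    (hf : MemLp f p (vol (wormDomain β))) (hg : MemLp g p (vol (wormDomain β)))
    {z : ℂ × ℂ} (hz : z ∈ wormDomain β) :
    wormProj β (f + g) z = wormProj β f z + wormProj β g z := by
  have i1 := integrableOn_coverKernel_mul hp1 hp2 (memLp_snd_mul hf) (lift_mem 0 hz)
  have i2 := integrableOn_coverKernel_mul hp1 hp2 (memLp_snd_mul hg) (lift_mem 0 hz)
  simp only [wormProj, wormOp, coverOp]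
  rw [← mul_add, ← integral_add i1 i2]
  congr 1
  refine integral_congr_ae (Filter.Eventually.of_forall fun m => ?_)
  simp only [Pi.add_apply]
  ring

lemma wormProj_smul (β : ℝ) (c : ℂ) (f : ℂ × ℂ → ℂ) : wormProj β (c • f) = c • wormProj β f := by
  ext z
  simp only [wormProj, wormOp, coverOp, Pi.smul_apply, smul_eq_mul]
  rw [mul_left_comm c, ← integral_const_mul c]
  congr 1
  refine integral_congr_ae (Filter.Eventually.of_forall fun m => ?_)
  ring

end Worm

end

theorem theorem1p6 (β : ℝ) (hβ : Real.pi / 2 < β) (k : ℕ) (hk : 0 < k)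
    (p : ℝ≥0∞) [Fact (1 ≤ p)] (hp1 : 1 < p) (hp2 : p < ⊤) :
    ∃ T : Worm.sobolevSpace (Worm.wormDomain β) k p →L[ℂ]
        Worm.sobolevSpace (Worm.wormDomain β) k p,
      ∀ (u : Worm.sobolevSpace (Worm.wormDomain β) k p)
        (f : Lp ℂ 2 (Worm.vol (Worm.wormDomain β))),
        f =ᵐ[Worm.vol (Worm.wormDomain β)] Worm.sobolevSpace.toLp u →
        ∃ g : Lp ℂ 2 (Worm.vol (Worm.wormDomain β)),
          Worm.IsBergmanProjection (Worm.wormDomain β) f g ∧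
          Worm.sobolevSpace.toLp (T u) =ᵐ[Worm.vol (Worm.wormDomain β)] g := by
  obtain ⟨K, hK⟩ := Worm.isSobolevBounded_wormProj β hp1 hp2 k
  obtain ⟨L, hL⟩ := Worm.exists_sobolevSpace_of_hasSobolevBound β p k
  have hex : ∀ u : Worm.sobolevSpace (Worm.wormDomain β) k p,
      ∃ v : Worm.sobolevSpace (Worm.wormDomain β) k p,
        (Worm.sobolevSpace.toLp v) =ᵐ[Worm.vol (Worm.wormDomain β)] Worm.wormProj β (Worm.sobolevSpace.toLp u) ∧
          ‖v‖ ≤ L * (K * ‖u‖₊ : NNReal) := fun u => hL _ _ (hK _ _ (Worm.sobolevSpace.hasSobolevBound u))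
  -- The values are chosen separately for each u. Linearity follows because an element of the
  -- Sobolev space is determined by its underlying function, on which S acts as the linear operator
  -- `wormProj`.
  choose S hS hSn using hex
  have hadd : ∀ u v, S (u + v) = S u + S v := fun u v => by
    refine Worm.sobolevSpace.toLp_injective ?_
    have h1 : Worm.wormProj β (Worm.sobolevSpace.toLp (u + v)) = Worm.wormProj β ((Worm.sobolevSpace.toLp u) + (Worm.sobolevSpace.toLp v)) :=
      Worm.wormProj_congr (Lp.coeFn_add (Worm.sobolevSpace.toLp u) (Worm.sobolevSpace.toLp v))
    have h2 := Lp.coeFn_add (Worm.sobolevSpace.toLp (S u)) (Worm.sobolevSpace.toLp (S v))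
    filter_upwards [hS (u + v), hS u, hS v, h2,
      ae_restrict_mem (Worm.measurableSet_wormDomain β)] with z a1 a2 a3 a4 hz
    refine a1.trans (Eq.trans ?_ a4.symm)
    rw [h1, Worm.wormProj_add hp1 hp2 (Lp.memLp _) (Lp.memLp _) hz, Pi.add_apply, a2, a3]
  have hsmul : ∀ (c : ℂ) u, S (c • u) = c • S u := fun c u => by
    refine Worm.sobolevSpace.toLp_injective ?_
    have h1 : Worm.wormProj β (Worm.sobolevSpace.toLp (c • u)) = Worm.wormProj β (c • (Worm.sobolevSpace.toLp u)) :=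
      Worm.wormProj_congr (Lp.coeFn_smul c (Worm.sobolevSpace.toLp u))
    have h2 := Lp.coeFn_smul c (Worm.sobolevSpace.toLp (S u))
    filter_upwards [hS (c • u), hS u, h2] with z a1 a2 a4
    refine a1.trans (Eq.trans ?_ a4.symm)
    rw [h1, Worm.wormProj_smul, Pi.smul_apply, Pi.smul_apply, a2]
  refine ⟨LinearMap.mkContinuous ⟨⟨S, hadd⟩, hsmul⟩ (L * K) fun u => ?_, fun u f hfu => ?_⟩
  · refine (hSn u).trans (le_of_eq ?_)
    push_cast
    ring
  · obtain ⟨g, hg, hgf⟩ := Worm.exists_isBergmanProjection f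
    refine ⟨g, hg, ?_⟩
    -- The integral formula makes sense on L^p and on L² alike, so the two extensions agree on
    -- functions lying in both.
    rw [Worm.wormProj_congr hfu] at hgf
    exact (hS u).trans hgf.symm
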